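/- **Model.** Let $0\le \underline x<\bar x<\infty$, $\tau>0$, and let $c_A,c_P\colon[0,1]\to\mathbb R$ be thrice differentiable (one-sidedly at the end points), strictly increasing and strictly convex with $c_A(0)=c_P(0)=c_A'(0)=c_P'(0)=0$. Let $u_A(e)=e\,c_A'(e)-c_A(e)$. Assume $\tau\ge c_A'(1)>c_P(1)$; $c_A''(e)\neq 0$ for $e\in(0,1]$ and, for all $e\in[0,1]$, $$\frac{\underline x+\tau}{c_P'(1)}+e>e(1-e)\frac{c_A'''(e)}{c_A''(e)}+1-e$$ (the first term on the right being read as $0$ at $e=0$); and $e\mapsto e\,c_A'(e)$ is strictly convex on $[0,1]$. A *mechanism* $m=(e_A,e_P,r_A,r_P,r_\emptyset)$ consists of functions on $[\underline x,\bar x]$ with $e_A(y),e_P(y)\in[0,1]$ and $r_A(y),r_P(y),r_\emptyset(y)\in[0,y+\tau]$ such that, with $$R_{NA}(x)=e_P(x)r_P(x)+(1-e_P(x))r_\emptyset(x),\qquad U_m(x)=R_{NA}(x)+u_A(e_A(x)),$$ $$\lambda_m(x)=\inf_{y\in[\underline x,x]}\bigl(e_P(y)x+(1-e_P(y))(y-r_\emptyset(y))\bigr),$$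 every type $x\in[\underline x,\bar x]$ satisfies $e_A(x)\in\operatorname{argmax}_{e\in[0,1]}\, e\,(r_A(x)-R_{NA}(x))-c_A(e)$ and $U_m(x)\ge x-\lambda_m(x)$. Its profit is $$\Pi_m(x)=x-R_{NA}(x)-u_A(e_A(x))-c_A(e_A(x))-(1-e_A(x))c_P(e_P(x)).$$ A mechanism $m$ is *tight* if every mechanism $m'$ with $\Pi_{m}\le\Pi_{m'}$ and $\lambda_{m}\le\lambda_{m'}$ pointwise satisfies $(\Pi_{m'},\lambda_{m'})=(\Pi_m,\lambda_m)$. For a probability distribution $F$ on $[\underline x,\bar x]$, $m$ is *optimal* if it maximizes $\int\Pi_m\,dF$ among all mechanisms with measurable profit. For $y\in[\underline x,\bar x]$ let $\hat X(y)=\{x\in[y,\bar x]:\lambda_m(x)=e_P(y)x+(1-e_P(y))(y-r_\emptyset(y))\}$. A tight $m$ has *doubly unique binding ICs* if $\hat X(y)$ is a singleton $\{\hat x(y)\}$ for each $y\in(\underline x,\bar x)$, and for each $x\in(\underline x,\bar x)$ there is at most one $y\in(\underline x,\bar x)$ with $x\in\hat X(y)$. Let $\alpha(\bar x)=0$ and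 $\alpha(y)=\max\{0,\sup_{x\in(y,\bar x]}\frac{\lambda_m(x)-y}{x-y}\}$ for $y<\bar x$, and let $$d_1(y)=y-u_A(e_A(y))-\lambda_m(y),\qquad d_2(y)=(1-\alpha(y))y-u_A(e_A(y))-\lambda_m(y)-\alpha(y)\tau.$$ Among the types $y$ with $e_P(y)\in(0,1)$, define SuperLow by $d_1<0$, Low by $d_2<0=d_1$, Middle by $d_2<0<d_1$, High by $d_2=0<d_1$, and SuperHigh by $0<d_2$. Let $$D(y)=\frac{c_A'(e_A(y))-c_P(e_P(y))}{u_A'(e_A(y))},$$ $$I(y)=\begin{cases}\dfrac{(1-e_A(y))c_P'(e_P(y))}{\hat x(y)-y}, & y\in\text{SuperLow}\cup\text{Low}\cup\text{Middle},\\[2ex] \dfrac{(1-e_A(y))c_P'(e_P(y))}{\hat x(y)-y}-\dfrac{y+\tau}{\hat x(y)-y}D(y), & y\in\text{High},\\[2ex] \dfrac{(1-e_A(y))c_P'(e_P(y))}{\hat x(y)+\tau}, & y\in\text{SuperHigh}.\end{cases}$$ **Theorem.** Let $F$ be absolutely continuous with full support $[\underline x,\bar x]$, and let $m$ be tight, optimal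 and have doubly unique binding ICs, with $\hat x$ the unique binding IC selection on $(\underline x,\bar x)$. Then: 1. for all $[a,b]\subset(\underline x,\bar x)$, $I$ is $F$-integrable on $[a,b]$, $1+D$ is $F$-integrable on $[\hat x(a),\hat x(b)]$, and $$\int_{[a,b]}I\,dF=\int_{[\hat x(a),\hat x(b)]}(1+D)\,dF;$$ 2. $D(x)=-1$ for all $x\in\text{SuperLow}$; 3. $D(x)=0$ for all $x\in\text{Middle}$; 4. $D(x)=I(x)$ for all $x\in\text{SuperHigh}$; 5. $\inf_{y\in(\underline x,\bar x)}\hat x(y)=\sup\text{SuperLow}$, where SuperLow is non-empty. -/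

import Mathlib

open Set MeasureTheory

namespace TaxMech

/-- The primitives of the model: the lowest and the highest surplus, the principal's private
funds, and the two evidence cost functions (only their values on `[0, 1]` matter). -/
structure Env where
  lo : ℝ
  hi : ℝ
  tau : ℝ
  cA : ℝ → ℝ
  cP : ℝ → ℝ

/-- Derivative of a function of an effort level in `[0, 1]` (one-sided at the end points). -/
noncomputable def effDeriv (c : ℝ → ℝ) : ℝ → ℝ :=
  derivWithin c (Icc (0 : ℝ) 1)

/-- A cost function on `[0, 1]`: thrice differentiable, strictly increasing, strictly convex,
with zero cost and zero marginal cost at zero effort. -/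
structure IsCost (c : ℝ → ℝ) : Prop where
  diff1 : DifferentiableOn ℝ c (Icc (0 : ℝ) 1)
  diff2 : DifferentiableOn ℝ (effDeriv c) (Icc (0 : ℝ) 1)
  diff3 : DifferentiableOn ℝ (effDeriv (effDeriv c)) (Icc (0 : ℝ) 1)
  strictMono : StrictMonoOn c (Icc (0 : ℝ) 1)
  strictConvex : StrictConvexOn ℝ (Icc (0 : ℝ) 1) c
  zero : c 0 = 0
  deriv_zero : effDeriv c 0 = 0

/-- The standing assumptions on the primitives. -/
structure Env.Standing (E : Env) : Prop where
  lo_nonneg : 0 ≤ E.lo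
  lo_lt_hi : E.lo < E.hi
  tau_pos : 0 < E.tau
  costA : IsCost E.cA
  costP : IsCost E.cP
  /-- The budget assumption. -/
  budget : effDeriv E.cA 1 ≤ E.tau ∧ E.cP 1 < effDeriv E.cA 1
  /-- The quotient in `regularity` is meaningful. At zero effort it is multiplied by `0`, so
  nothing is required there. -/
  second_ne_zero : ∀ e ∈ Ioc (0 : ℝ) 1, effDeriv (effDeriv E.cA) e ≠ 0
  /-- The regularity assumption bounding the log-convexity of the evidence rent. -/
  regularity : ∀ e ∈ Icc (0 : ℝ) 1,
    e * (1 - e) * (effDeriv (effDeriv (effDeriv E.cA)) e / effDeriv (effDeriv E.cA) e) + (1 - e)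
      < (E.lo + E.tau) / effDeriv E.cP 1 + e
  /-- Strict convexity of effort times marginal cost. -/
  rent_regularity : StrictConvexOn ℝ (Icc (0 : ℝ) 1) (fun e => e * effDeriv E.cA e)

/-- The evidence rent. -/
noncomputable def Env.uA (E : Env) (e : ℝ) : ℝ :=
  e * effDeriv E.cA e - E.cA e

/-- A tax mechanism: the recommended agent effort, the principal's effort, and the refunds after
agent evidence, after principal evidence, and without evidence, as functions of the advance
payment. Only the values on the type space `[lo, hi]` matter. -/
structure Mech where
  eA : ℝ → ℝ
  eP : ℝ → ℝ
  rA : ℝ → ℝ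
  rP : ℝ → ℝ
  r0 : ℝ → ℝ

/-- The expected refund if the agent provides no evidence. -/
def Mech.RNA (m : Mech) (x : ℝ) : ℝ :=
  m.eP x * m.rP x + (1 - m.eP x) * m.r0 x

/-- The interim utility of type `x` from advancing the full surplus. -/
noncomputable def utility (E : Env) (m : Mech) (x : ℝ) : ℝ :=
  m.RNA x + E.uA (m.eA x)

/-- The expected loss of type `x` when advancing `y` (and concealing `x - y`). -/
def devLoss (m : Mech) (x y : ℝ) : ℝ :=
  m.eP y * x + (1 - m.eP y) * (y - m.r0 y)

/-- The loss function of a mechanism: the lowest loss of type `x` when concealing surplus. -/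
noncomputable def loss (E : Env) (m : Mech) (x : ℝ) : ℝ :=
  sInf (devLoss m x '' Icc E.lo x)

/-- The principal's profit from type `x`. -/
noncomputable def profit (E : Env) (m : Mech) (x : ℝ) : ℝ :=
  x - m.RNA x - E.uA (m.eA x) - E.cA (m.eA x) - (1 - m.eA x) * E.cP (m.eP x)

/-- Feasibility of efforts and refunds. -/
def Feasible (E : Env) (m : Mech) : Prop :=
  ∀ y ∈ Icc E.lo E.hi,
    m.eA y ∈ Icc (0 : ℝ) 1 ∧ m.eP y ∈ Icc (0 : ℝ) 1 ∧
    m.rA y ∈ Icc 0 (y + E.tau) ∧ m.rP y ∈ Icc 0 (y + E.tau) ∧ m.r0 y ∈ Icc 0 (y + E.tau)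

/-- Incentive compatibility: every type finds the recommended effort optimal (hidden action) and
finds it optimal to advance the full surplus (hidden information). -/
def IncentiveCompatible (E : Env) (m : Mech) : Prop :=
  ∀ x ∈ Icc E.lo E.hi,
    IsMaxOn (fun e => e * (m.rA x - m.RNA x) - E.cA e) (Icc (0 : ℝ) 1) (m.eA x) ∧
    x - loss E m x ≤ utility E m x

/-- A mechanism is a feasible incentive compatible tax mechanism. -/
def IsMechanism (E : Env) (m : Mech) : Prop :=
  Feasible E m ∧ IncentiveCompatible E m

/-- `m'` is tighter than `m`. -/
def TighterThan (E : Env) (m' m : Mech) : Prop :=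
  ∀ x ∈ Icc E.lo E.hi, profit E m x ≤ profit E m' x ∧ loss E m x ≤ loss E m' x

/-- A mechanism is tight if it is tighter than every mechanism that is tighter than it. -/
def IsTight (E : Env) (m : Mech) : Prop :=
  IsMechanism E m ∧ ∀ m', IsMechanism E m' → TighterThan E m' m → TighterThan E m m'

/-- The profit is a measurable function on the type space. -/
def MeasurableProfit (E : Env) (m : Mech) : Prop :=
  Measurable (fun x : Icc E.lo E.hi => profit E m x)

/-- The expected profit under the type distribution `F`. -/
noncomputable def expectedProfit (E : Env) (F : Measure ℝ) (m : Mech) : ℝ :=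
  ∫ x in Icc E.lo E.hi, profit E m x ∂F

/-- A mechanism is optimal if it maximizes the expected profit across all mechanisms (with
measurable profit, so that the expected profit is defined). -/
def IsOptimal (E : Env) (F : Measure ℝ) (m : Mech) : Prop :=
  IsMechanism E m ∧ MeasurableProfit E m ∧
    ∀ m', IsMechanism E m' → MeasurableProfit E m' →
      expectedProfit E F m' ≤ expectedProfit E F m

/-- The binding IC correspondence: the types `x ≥ y` whose best deviation is to `y`. -/
def bindingIC (E : Env) (m : Mech) (y : ℝ) : Set ℝ :=
  {x ∈ Icc y E.hi | loss E m x = devLoss m x y}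

/-- Doubly unique binding ICs. -/
def DoublyUnique (E : Env) (m : Mech) : Prop :=
  (∀ y ∈ Ioo E.lo E.hi, ∃ x, bindingIC E m y = {x}) ∧
    ∀ x ∈ Ioo E.lo E.hi, ∀ y ∈ Ioo E.lo E.hi, ∀ y' ∈ Ioo E.lo E.hi,
      x ∈ bindingIC E m y → x ∈ bindingIC E m y' → y = y'

/-- The smallest principal effort at `y` that deters all higher types from advancing `y` when
no refund is paid without evidence. -/
noncomputable def alpha (E : Env) (m : Mech) (y : ℝ) : ℝ :=
  open Classical in
  if y < E.hi then max 0 (sSup ((fun x => (loss E m x - y) / (x - y)) '' Ioc y E.hi)) else 0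

/-- The information rent minus the evidence rent. -/
noncomputable def d1 (E : Env) (m : Mech) (y : ℝ) : ℝ :=
  y - E.uA (m.eA y) - loss E m y

/-- The information rent minus the evidence rent and minus the maximal expected refund after
principal evidence. -/
noncomputable def d2 (E : Env) (m : Mech) (y : ℝ) : ℝ :=
  (1 - alpha E m y) * y - E.uA (m.eA y) - loss E m y - alpha E m y * E.tau

/-- The types that are audited randomly. -/
def interiorTypes (E : Env) (m : Mech) : Set ℝ :=
  {y ∈ Icc E.lo E.hi | m.eP y ∈ Ioo (0 : ℝ) 1}

/-- The five intervals of types. -/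
def SuperLow (E : Env) (m : Mech) : Set ℝ :=
  {y ∈ interiorTypes E m | d1 E m y < 0}

def Low (E : Env) (m : Mech) : Set ℝ :=
  {y ∈ interiorTypes E m | d2 E m y < 0 ∧ d1 E m y = 0}

def Middle (E : Env) (m : Mech) : Set ℝ :=
  {y ∈ interiorTypes E m | d2 E m y < 0 ∧ 0 < d1 E m y}

def High (E : Env) (m : Mech) : Set ℝ :=
  {y ∈ interiorTypes E m | d2 E m y = 0 ∧ 0 < d1 E m y}

def SuperHigh (E : Env) (m : Mech) : Set ℝ :=
  {y ∈ interiorTypes E m | 0 < d2 E m y}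

/-- The direct impact. -/
noncomputable def directImpact (E : Env) (m : Mech) (y : ℝ) : ℝ :=
  (effDeriv E.cA (m.eA y) - E.cP (m.eP y)) / effDeriv E.uA (m.eA y)

/-- The indirect impact, given a selection `xhat` of binding IC types (the value `0` outside the
five intervals is never used). -/
noncomputable def indirectImpact (E : Env) (m : Mech) (xhat : ℝ → ℝ) (y : ℝ) : ℝ :=
  open Classical in
  if y ∈ SuperLow E m ∪ Low E m ∪ Middle E m then
    (1 - m.eA y) * effDeriv E.cP (m.eP y) / (xhat y - y)
  else if y ∈ High E m then
    (1 - m.eA y) * effDeriv E.cP (m.eP y) / (xhat y - y)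
      - (y + E.tau) / (xhat y - y) * directImpact E m y
  else if y ∈ SuperHigh E m then
    (1 - m.eA y) * effDeriv E.cP (m.eP y) / (xhat y + E.tau)
  else 0

end TaxMech

open Filter Topology

namespace TaxMech

/-! ### Cost functions and the evidence rent -/

namespace IsCost

variable {c : ℝ → ℝ}

/-! Fix a target loss function `lam`. The choice of a mechanism then decouples across types: an
effort pair at `y` matters only through two families of constraints indexed by `x ≥ y`, one
expressing that the refund without evidence is nonnegative, the other that the refund after evidence
is at most `y + tau`. Its cost with the cheapest refund is `effortCost` (`exists_mechanism`,
`effortFeasible_of_isMechanism`). A tight mechanism minimizes this cost at every type. Its loss is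
concave with slopes in `[0, 1]`, since replacing it by its hull keeps the efforts feasible and
lowers refunds (`IsTight.loss_eq_slopeHull`).

With doubly unique binding ICs, interior types have interior efforts, and the only point at which a
constraint at `y` can be active is `xhat y`. First-order conditions in a few directions bound
`directImpact` and fix its value on SuperLow, Middle and SuperHigh; they also merge the cases of
`indirectImpact` into one formula (`IsTight.indirectImpact_eq`). The two regularity assumptions give
a unique minimizer (`IsTight.effort_unique`), hence continuous efforts, continuous `xhat` and
continuous impacts.

The integral identity is the Euler equation for the loss. Moving it in direction `eta` changes the
minimal cost at `y` at a rate of at most `I(y) * eta (xhat y) - (1 + D(y)) * eta y`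
(`IsTight.variation_impact`). Optimality against `eta` and `-eta` makes the integral of this rate
vanish, and trapezoids `eta` approximate the indicator of an interval. As `xhat` is strictly
increasing, the preimage of `[xhat a, xhat b]` is `[a, b]`.

For the cut-off, types below `inf xhat` bind nobody, so the identity forces `D = -1` there, and
monotonicity of `e_A` and of `y - loss y` upgrades this to SuperLow. Above `inf xhat`, an interval
of SuperLow types would have zero direct side against a positive indirect side. -/

lemma hasDerivWithinAt (h : IsCost c) {e : ℝ} (he : e ∈ Icc (0 : ℝ) 1) :
    HasDerivWithinAt c (effDeriv c e) (Icc 0 1) e :=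
  (h.diff1 e he).hasDerivWithinAt

lemma hasDerivWithinAt_effDeriv (h : IsCost c) {e : ℝ} (he : e ∈ Icc (0 : ℝ) 1) :
    HasDerivWithinAt (effDeriv c) (effDeriv (effDeriv c) e) (Icc 0 1) e :=
  (h.diff2 e he).hasDerivWithinAt

lemma hasDerivWithinAt_effDeriv_effDeriv (h : IsCost c) {e : ℝ} (he : e ∈ Icc (0 : ℝ) 1) :
    HasDerivWithinAt (effDeriv (effDeriv c)) (effDeriv (effDeriv (effDeriv c)) e) (Icc 0 1) e :=
  (h.diff3 e he).hasDerivWithinAt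

lemma continuousOn (h : IsCost c) : ContinuousOn c (Icc 0 1) := h.diff1.continuousOn

lemma continuousOn_effDeriv (h : IsCost c) : ContinuousOn (effDeriv c) (Icc 0 1) :=
  h.diff2.continuousOn

lemma continuousOn_effDeriv_effDeriv (h : IsCost c) :
    ContinuousOn (effDeriv (effDeriv c)) (Icc 0 1) :=
  h.diff3.continuousOn

lemma strictMonoOn_effDeriv (h : IsCost c) : StrictMonoOn (effDeriv c) (Icc 0 1) :=
  h.strictConvex.strictMonoOn_derivWithin h.diff1

lemma effDeriv_nonneg (h : IsCost c) {e : ℝ} (he : e ∈ Icc (0 : ℝ) 1) : 0 ≤ effDeriv c e := by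
  rw [← h.deriv_zero]
  exact h.strictMonoOn_effDeriv.monotoneOn (left_mem_Icc.2 zero_le_one) he he.1

lemma effDeriv_pos (h : IsCost c) {e : ℝ} (he : e ∈ Ioc (0 : ℝ) 1) : 0 < effDeriv c e := by
  rw [← h.deriv_zero]
  exact h.strictMonoOn_effDeriv (left_mem_Icc.2 zero_le_one) ⟨he.1.le, he.2⟩ he.1

lemma effDeriv_le_one (h : IsCost c) {e : ℝ} (he : e ∈ Icc (0 : ℝ) 1) :
    effDeriv c e ≤ effDeriv c 1 :=
  h.strictMonoOn_effDeriv.monotoneOn he (right_mem_Icc.2 zero_le_one) he.2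

lemma nonneg (h : IsCost c) {e : ℝ} (he : e ∈ Icc (0 : ℝ) 1) : 0 ≤ c e := by
  rw [← h.zero]
  exact h.strictMono.monotoneOn (left_mem_Icc.2 zero_le_one) he he.1

lemma pos (h : IsCost c) {e : ℝ} (he : e ∈ Ioc (0 : ℝ) 1) : 0 < c e := by
  rw [← h.zero]
  exact h.strictMono (left_mem_Icc.2 zero_le_one) ⟨he.1.le, he.2⟩ he.1

lemma le_one (h : IsCost c) {e : ℝ} (he : e ∈ Icc (0 : ℝ) 1) : c e ≤ c 1 :=
  h.strictMono.monotoneOn he (right_mem_Icc.2 zero_le_one) he.2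

lemma tangent_le (h : IsCost c) {e z : ℝ} (he : e ∈ Icc (0 : ℝ) 1) (hz : z ∈ Icc (0 : ℝ) 1) :
    c e + effDeriv c e * (z - e) ≤ c z := by
  rcases lt_trichotomy e z with h1 | h1 | h1
  · have := h.strictConvex.convexOn.le_slope_of_hasDerivWithinAt he hz h1 (h.hasDerivWithinAt he)
    rw [slope_def_field, le_div_iff₀ (by linarith)] at this
    linarith
  · simp [h1]
  · have := h.strictConvex.convexOn.slope_le_of_hasDerivWithinAt hz he h1 (h.hasDerivWithinAt he)
    rw [slope_def_field, div_le_iff₀ (by linarith)] at this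
    linarith

lemma hasDerivAt (h : IsCost c) {e : ℝ} (he : e ∈ Ioo (0 : ℝ) 1) :
    HasDerivAt c (effDeriv c e) e :=
  (h.hasDerivWithinAt (Ioo_subset_Icc_self he)).hasDerivAt (Icc_mem_nhds he.1 he.2)

lemma hasDerivAt_effDeriv (h : IsCost c) {e : ℝ} (he : e ∈ Ioo (0 : ℝ) 1) :
    HasDerivAt (effDeriv c) (effDeriv (effDeriv c) e) e :=
  (h.hasDerivWithinAt_effDeriv (Ioo_subset_Icc_self he)).hasDerivAt (Icc_mem_nhds he.1 he.2)

lemma hasDerivAt_effDeriv_effDeriv (h : IsCost c) {e : ℝ} (he : e ∈ Ioo (0 : ℝ) 1) :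
    HasDerivAt (effDeriv (effDeriv c)) (effDeriv (effDeriv (effDeriv c)) e) e :=
  (h.hasDerivWithinAt_effDeriv_effDeriv (Ioo_subset_Icc_self he)).hasDerivAt
    (Icc_mem_nhds he.1 he.2)

lemma effDeriv_effDeriv_nonneg (h : IsCost c) (e : ℝ) :
    0 ≤ effDeriv (effDeriv c) e :=
  h.strictMonoOn_effDeriv.monotoneOn.derivWithin_nonneg

end IsCost

namespace Env.Standing

variable {E : Env}

/-- Strict convexity puts `c_A(1)` strictly below `c_A'(1)`, by the tangents at `1` and `1/2`. This
gap keeps the budget slack for targets that are at least `lo`, even after a small perturbation. -/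
lemma cA_one_lt_tau (hE : E.Standing) : E.cA 1 < E.tau := by
  refine lt_of_lt_of_le ?_ hE.budget.1
  have h2 : (1 / 2 : ℝ) ∈ Icc (0 : ℝ) 1 := by constructor <;> norm_num
  have h1 : (1 : ℝ) ∈ Icc (0 : ℝ) 1 := by constructor <;> norm_num
  have h0 : (0 : ℝ) ∈ Icc (0 : ℝ) 1 := by constructor <;> norm_num
  have a := hE.costA.tangent_le h1 h2
  have b := hE.costA.tangent_le h2 h0
  have d := hE.costA.strictMonoOn_effDeriv h2 h1 (by norm_num)
  rw [hE.costA.zero] at b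
  linarith

lemma effDeriv_effDeriv_cA_pos (hE : E.Standing) {e : ℝ} (he : e ∈ Ioc (0 : ℝ) 1) :
    0 < effDeriv (effDeriv E.cA) e :=
  lt_of_le_of_ne (hE.costA.effDeriv_effDeriv_nonneg e)
    (hE.second_ne_zero e he).symm

lemma hasDerivWithinAt_uA (hE : E.Standing) {e : ℝ} (he : e ∈ Icc (0 : ℝ) 1) :
    HasDerivWithinAt E.uA (e * effDeriv (effDeriv E.cA) e) (Icc 0 1) e := by
  exact (((hasDerivWithinAt_id e (Icc (0 : ℝ) 1)).mul
    (hE.costA.hasDerivWithinAt_effDeriv he)).sub (hE.costA.hasDerivWithinAt he)).congr_deriv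
    (by simp only [id]; ring)

lemma effDeriv_uA (hE : E.Standing) {e : ℝ} (he : e ∈ Icc (0 : ℝ) 1) :
    effDeriv E.uA e = e * effDeriv (effDeriv E.cA) e :=
  (hE.hasDerivWithinAt_uA he).derivWithin (uniqueDiffOn_Icc zero_lt_one e he)

lemma hasDerivAt_uA (hE : E.Standing) {e : ℝ} (he : e ∈ Ioo (0 : ℝ) 1) :
    HasDerivAt E.uA (effDeriv E.uA e) e := by
  rw [hE.effDeriv_uA (Ioo_subset_Icc_self he)]
  exact (hE.hasDerivWithinAt_uA (Ioo_subset_Icc_self he)).hasDerivAt (Icc_mem_nhds he.1 he.2)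

lemma effDeriv_uA_pos (hE : E.Standing) {e : ℝ} (he : e ∈ Ioc (0 : ℝ) 1) :
    0 < effDeriv E.uA e := by
  rw [hE.effDeriv_uA ⟨he.1.le, he.2⟩]
  exact mul_pos he.1 (hE.effDeriv_effDeriv_cA_pos he)

lemma continuousOn_uA (hE : E.Standing) : ContinuousOn E.uA (Icc 0 1) :=
  (continuousOn_id.mul hE.costA.continuousOn_effDeriv).sub hE.costA.continuousOn

lemma continuousOn_effDeriv_uA (hE : E.Standing) : ContinuousOn (effDeriv E.uA) (Icc 0 1) :=
  (continuousOn_id.mul hE.costA.continuousOn_effDeriv_effDeriv).congr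
    fun _ he => hE.effDeriv_uA he

lemma strictMonoOn_uA (hE : E.Standing) : StrictMonoOn E.uA (Icc 0 1) := by
  refine strictMonoOn_of_deriv_pos (convex_Icc 0 1) hE.continuousOn_uA fun e he => ?_
  rw [interior_Icc] at he
  rw [(hE.hasDerivAt_uA he).deriv]
  exact hE.effDeriv_uA_pos ⟨he.1, he.2.le⟩

lemma uA_zero (hE : E.Standing) : E.uA 0 = 0 := by simp [Env.uA, hE.costA.zero]

lemma uA_nonneg (hE : E.Standing) {e : ℝ} (he : e ∈ Icc (0 : ℝ) 1) : 0 ≤ E.uA e := by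
  rw [← hE.uA_zero]
  exact hE.strictMonoOn_uA.monotoneOn (left_mem_Icc.2 zero_le_one) he he.1

lemma uA_pos (hE : E.Standing) {e : ℝ} (he : e ∈ Ioc (0 : ℝ) 1) : 0 < E.uA e := by
  rw [← hE.uA_zero]
  exact hE.strictMonoOn_uA (left_mem_Icc.2 zero_le_one) ⟨he.1.le, he.2⟩ he.1

/-- The budget needed for the agent's incentives never exceeds the cost of full effort. -/
lemma effDeriv_sub_uA_le (hE : E.Standing) {e : ℝ} (he : e ∈ Icc (0 : ℝ) 1) :
    effDeriv E.cA e - E.uA e ≤ E.cA 1 := by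
  have := hE.costA.tangent_le he (right_mem_Icc.2 zero_le_one)
  unfold Env.uA
  linarith

end Env.Standing

/-! ### The pointwise problem for a target loss function -/

/-- Effort pairs at `y` that can be completed to a mechanism whose loss is at least `lam`. -/
structure EffortFeasible (E : Env) (lam : ℝ → ℝ) (y e p : ℝ) : Prop where
  agent : e ∈ Icc (0 : ℝ) 1
  principal : p ∈ Icc (0 : ℝ) 1
  no_refund : ∀ x ∈ Icc y E.hi, lam x ≤ p * x + (1 - p) * y
  full_refund : ∀ x ∈ Icc y E.hi, lam x - lam y - E.uA e ≤ p * (x + E.tau)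

/-- The refund that makes type `y` indifferent, if it is nonnegative. -/
noncomputable def refund (E : Env) (lam : ℝ → ℝ) (y e : ℝ) : ℝ :=
  max (y - lam y - E.uA e) 0

/-- The cost of implementing the efforts `e`, `p` at `y` with the cheapest refund. -/
noncomputable def effortCost (E : Env) (lam : ℝ → ℝ) (y e p : ℝ) : ℝ :=
  refund E lam y e + e * effDeriv E.cA e + (1 - e) * E.cP p

/-- In this form the agent's part is, under the standing assumptions, a maximum of two strictly
convex functions of `e`: one where a refund tops up the evidence rent, one where the rent alone
suffices. -/
lemma effortCost_eq (E : Env) (lam : ℝ → ℝ) (y e p : ℝ) :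
    effortCost E lam y e p =
      max (y - lam y + E.cA e) (e * effDeriv E.cA e) + (1 - e) * E.cP p := by
  unfold effortCost refund Env.uA
  rw [← max_add_add_right]
  congr 2 <;> ring

/-- Target loss functions for which the budget constraint is slack. -/
def Admissible (E : Env) (lam : ℝ → ℝ) : Prop :=
  ∀ x ∈ Icc E.lo E.hi, lam x ≤ x ∧ E.cA 1 - E.tau ≤ lam x

/-- Feasible effort functions for an admissible target are implemented by a mechanism. -/
lemma exists_mechanism {E : Env} (hE : E.Standing) {lam e p : ℝ → ℝ} (hlam : Admissible E lam)
    (hf : ∀ y ∈ Icc E.lo E.hi, EffortFeasible E lam y (e y) (p y)) :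
    ∃ m, IsMechanism E m ∧ ∀ y ∈ Icc E.lo E.hi,
      lam y ≤ loss E m y ∧ profit E m y = y - effortCost E lam y (e y) (p y) := by
  set R : ℝ → ℝ := fun y => refund E lam y (e y) with hR
  -- `B` is the part of the total refund `R` paid after principal evidence. It is as large as the
  -- cap allows, because such refunds do not enter `devLoss`; only the remainder `R - B` tempts
  -- deviators.
  set B : ℝ → ℝ := fun y => min (R y) (p y * (y + E.tau)) with hB
  let m : Mech :=
    { eA := e, eP := p, rA := fun y => R y + effDeriv E.cA (e y), rP := fun y => B y / p y,
      r0 := fun y => (R y - B y) / (1 - p y) }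
  have key : ∀ y ∈ Icc E.lo E.hi, 0 ≤ R y ∧ R y + effDeriv E.cA (e y) ≤ y + E.tau ∧
      p y * (B y / p y) = B y ∧ (1 - p y) * ((R y - B y) / (1 - p y)) = R y - B y ∧
      B y / p y ∈ Icc 0 (y + E.tau) ∧ (R y - B y) / (1 - p y) ∈ Icc 0 (y + E.tau) ∧
      ∀ x ∈ Icc y E.hi, lam x ≤ p y * x + (1 - p y) * y - (R y - B y) := by
    intro y hy
    obtain ⟨ha, hp, h1, h2⟩ := hf y hy
    have hyt : 0 < y + E.tau := by linarith [hE.lo_nonneg, hE.tau_pos, hy.1]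
    have hR0 : 0 ≤ R y := le_max_right _ _
    have hdA : effDeriv E.cA (e y) ≤ E.tau := (hE.costA.effDeriv_le_one ha).trans hE.budget.1
    have hdA0 := hE.costA.effDeriv_nonneg ha
    have hbud : R y + effDeriv E.cA (e y) ≤ y + E.tau := by
      rcases max_cases (y - lam y - E.uA (e y)) 0 with h | h
      · have := hE.effDeriv_sub_uA_le ha
        simp only [hR, refund, h.1]; linarith [(hlam y hy).2]
      · simp only [hR, refund, h.1]; linarith [hE.lo_nonneg, hy.1]
    have hB0 : 0 ≤ B y := le_min hR0 (mul_nonneg hp.1 hyt.le)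
    have hBR : B y ≤ R y := min_le_left _ _
    have hBp : B y ≤ p y * (y + E.tau) := min_le_right _ _
    have hABp : R y - B y ≤ (1 - p y) * (y + E.tau) := by
      rcases min_cases (R y) (p y * (y + E.tau)) with h | h
      · simp only [hB, h.1]; nlinarith [hp.2]
      · simp only [hB, h.1]; nlinarith [hp.2]
    refine ⟨hR0, hbud, ?_, ?_, ⟨div_nonneg hB0 hp.1, ?_⟩,
      ⟨div_nonneg (sub_nonneg.2 hBR) (sub_nonneg.2 hp.2), ?_⟩, ?_⟩
    -- When `p y = 0` the quotient is `0` by convention, and the cap forces `B y = 0`; likewise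
    -- below with `1 - p y` and `R y - B y`.
    · rcases eq_or_ne (p y) 0 with h | h
      · rw [h] at hBp ⊢; simp at hBp ⊢; linarith
      · field_simp
    · rcases eq_or_ne (1 - p y) 0 with h | h
      · rw [h] at hABp ⊢; simp at hABp ⊢; linarith
      · field_simp
    · exact div_le_of_le_mul₀ hp.1 hyt.le (by linarith)
    · exact div_le_of_le_mul₀ (sub_nonneg.2 hp.2) hyt.le (by linarith)
    · intro x hx
      rcases min_cases (R y) (p y * (y + E.tau)) with h | h
      · simp only [hB, h.1]; linarith [h1 x hx]
      · simp only [hB, h.1]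
        have hRpos : 0 < R y := lt_of_le_of_lt (mul_nonneg hp.1 hyt.le) h.2
        have : R y = y - lam y - E.uA (e y) := by
          rcases max_cases (y - lam y - E.uA (e y)) 0 with h' | h'
          · exact h'.1
          · simp only [hR, refund, h'.1] at hRpos; exact absurd hRpos (lt_irrefl _)
        linarith [h2 x hx]
  have hRNA : ∀ y ∈ Icc E.lo E.hi, m.RNA y = R y := by
    intro y hy
    obtain ⟨-, -, h1, h2, -⟩ := key y hy
    change p y * (B y / p y) + (1 - p y) * ((R y - B y) / (1 - p y)) = R y
    rw [h1, h2]; ring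
  have hloss : ∀ x ∈ Icc E.lo E.hi, lam x ≤ loss E m x := by
    intro x hx
    refine le_csInf ⟨_, mem_image_of_mem _ (right_mem_Icc.2 hx.1)⟩ ?_
    rintro _ ⟨y, hy, rfl⟩
    obtain ⟨-, -, -, h2, -, -, h3⟩ := key y ⟨hy.1, hy.2.trans hx.2⟩
    change lam x ≤ p y * x + (1 - p y) * (y - (R y - B y) / (1 - p y))
    rw [mul_sub, h2]
    linarith [h3 x ⟨hy.2, hx.2⟩]
  refine ⟨m, ⟨fun y hy => ?_, fun x hx => ⟨?_, ?_⟩⟩, fun y hy => ⟨hloss y hy, ?_⟩⟩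
  · obtain ⟨h0, hb, -, -, h1, h2, -⟩ := key y hy
    exact ⟨(hf y hy).agent, (hf y hy).principal,
      ⟨add_nonneg h0 (hE.costA.effDeriv_nonneg (hf y hy).agent), hb⟩, h1, h2⟩
  -- The reward `rA - RNA` equals the marginal cost at `e x`, so optimality of `e x` is the tangent
  -- inequality for `cA`.
  · intro z hz
    have := hE.costA.tangent_le (hf x hx).agent hz
    change z * (R x + effDeriv E.cA (e x) - m.RNA x) - E.cA z
      ≤ e x * (R x + effDeriv E.cA (e x) - m.RNA x) - E.cA (e x)
    rw [hRNA x hx]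
    linarith
  · have h1 : x - lam x - E.uA (e x) ≤ R x := le_max_left _ _
    change x - loss E m x ≤ m.RNA x + E.uA (e x)
    rw [hRNA x hx]
    linarith [hloss x hx]
  · change y - m.RNA y - E.uA (e y) - E.cA (e y) - (1 - e y) * E.cP (p y) = _
    rw [hRNA y hy]
    unfold effortCost Env.uA
    ring

lemma loss_le_devLoss {E : Env} (hE : E.Standing) {m : Mech} (hm : IsMechanism E m) {x y : ℝ}
    (hy : y ∈ Icc E.lo x) (hx : x ≤ E.hi) : loss E m x ≤ devLoss m x y := by
  -- Refunds at `z` are at most `z + tau`, so all deviation losses are at least `-tau` and the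
  -- `sInf` is a genuine infimum.
  refine csInf_le ⟨-E.tau, ?_⟩ (mem_image_of_mem _ hy)
  rintro _ ⟨z, hz, rfl⟩
  obtain ⟨-, hp, -, -, h0⟩ := hm.1 z ⟨hz.1, hz.2.trans hx⟩
  have hz0 : 0 ≤ z := hE.lo_nonneg.trans hz.1
  unfold devLoss
  nlinarith [hp.1, hp.2, h0.1, h0.2, mul_nonneg hp.1 (hz0.trans hz.2),
    mul_nonneg (sub_nonneg.2 hp.2) (sub_nonneg.2 h0.2), mul_nonneg hp.1 hE.tau_pos.le]

/-! ### Necessary conditions on the efforts of a mechanism -/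

section Mechanism

variable {E : Env} {m : Mech}

lemma refund_le_RNA (hm : IsMechanism E m) {y : ℝ} (hy : y ∈ Icc E.lo E.hi) :
    refund E (loss E m) y (m.eA y) ≤ m.RNA y := by
  obtain ⟨-, hp, -, hP, h0⟩ := hm.1 y hy
  have h2 := (hm.2 y hy).2
  unfold utility at h2
  refine max_le (by linarith) (add_nonneg (mul_nonneg hp.1 hP.1) ?_)
  exact mul_nonneg (sub_nonneg.2 hp.2) h0.1

/-- The converse of `exists_mechanism`. Nonnegativity of `r0` gives the first constraint; the second
combines the truth-telling bound on `RNA` with the cap on `rP`, which together bound the refund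
without evidence from below. -/
lemma effortFeasible_of_isMechanism (hE : E.Standing) (hm : IsMechanism E m) {y : ℝ}
    (hy : y ∈ Icc E.lo E.hi) : EffortFeasible E (loss E m) y (m.eA y) (m.eP y) := by
  obtain ⟨ha, hp, -, hP, h0⟩ := hm.1 y hy
  have hR : y - loss E m y - E.uA (m.eA y) ≤ m.RNA y :=
    (le_max_left _ _).trans (refund_le_RNA hm hy)
  refine ⟨ha, hp, fun x hx => ?_, fun x hx => ?_⟩
  · have := loss_le_devLoss hE hm ⟨hy.1, hx.1⟩ hx.2
    unfold devLoss at this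
    nlinarith [mul_nonneg (sub_nonneg.2 hp.2) h0.1]
  · have := loss_le_devLoss hE hm ⟨hy.1, hx.1⟩ hx.2
    unfold devLoss at this
    unfold Mech.RNA at hR
    nlinarith [mul_nonneg hp.1 (sub_nonneg.2 hP.2)]

lemma profit_le_sub_effortCost (hm : IsMechanism E m) {y : ℝ} (hy : y ∈ Icc E.lo E.hi) :
    profit E m y ≤ y - effortCost E (loss E m) y (m.eA y) (m.eP y) := by
  have := refund_le_RNA hm hy
  unfold profit effortCost Env.uA
  linarith

end Mechanism

end TaxMech

namespace TaxMech

/-! ### The hull of a loss function by lines of slope at most one -/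

/-- The lower envelope of all lines with slope in `[0, 1]` above `f` on `[a, b]`. -/
noncomputable def slopeHull (a b : ℝ) (f : ℝ → ℝ) (x : ℝ) : ℝ :=
  sInf {v | ∃ s ∈ Icc (0 : ℝ) 1, ∃ t, (∀ z ∈ Icc a b, f z ≤ s * z + t) ∧ v = s * x + t}

section Hull

variable {a b : ℝ} {f : ℝ → ℝ}

lemma slopeHull_le {x s t : ℝ} (hx : x ∈ Icc a b) (hs : s ∈ Icc (0 : ℝ) 1)
    (h : ∀ z ∈ Icc a b, f z ≤ s * z + t) : slopeHull a b f x ≤ s * x + t := by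
  refine csInf_le ⟨f x, ?_⟩ ⟨s, hs, t, h, rfl⟩
  rintro _ ⟨s', -, t', h', rfl⟩
  exact h' x hx

lemma le_slopeHull {x c : ℝ} (hf : ∀ z ∈ Icc a b, f z ≤ z)
    (h : ∀ s ∈ Icc (0 : ℝ) 1, ∀ t, (∀ z ∈ Icc a b, f z ≤ s * z + t) → c ≤ s * x + t) :
    c ≤ slopeHull a b f x := by
  refine le_csInf ⟨x, 1, ⟨zero_le_one, le_rfl⟩, 0, by simpa using hf, by simp⟩ ?_
  rintro _ ⟨s, hs, t, h', rfl⟩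
  exact h s hs t h'

lemma self_le_slopeHull (hf : ∀ z ∈ Icc a b, f z ≤ z) {x : ℝ} (hx : x ∈ Icc a b) :
    f x ≤ slopeHull a b f x :=
  le_slopeHull hf fun _ _ _ h => h x hx

lemma slopeHull_le_id (hf : ∀ z ∈ Icc a b, f z ≤ z) {x : ℝ} (hx : x ∈ Icc a b) :
    slopeHull a b f x ≤ x := by
  simpa using slopeHull_le (s := 1) (t := 0) hx ⟨zero_le_one, le_rfl⟩ (by simpa using hf)

lemma slopeHull_monotoneOn (hf : ∀ z ∈ Icc a b, f z ≤ z) :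
    MonotoneOn (slopeHull a b f) (Icc a b) := fun x hx y _ hxy =>
  le_slopeHull hf fun s hs t h => (slopeHull_le hx hs h).trans
    (by linarith [mul_le_mul_of_nonneg_left hxy hs.1])

lemma slopeHull_sub_le (hf : ∀ z ∈ Icc a b, f z ≤ z) {x y : ℝ} (hy : y ∈ Icc a b) (hxy : x ≤ y) :
    slopeHull a b f y - slopeHull a b f x ≤ y - x := by
  have : slopeHull a b f y - (y - x) ≤ slopeHull a b f x :=
    le_slopeHull hf fun s hs t h => by
      have := slopeHull_le hy hs h
      nlinarith [hs.2]
  linarith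

lemma slopeHull_concaveOn (hf : ∀ z ∈ Icc a b, f z ≤ z) :
    ConcaveOn ℝ (Icc a b) (slopeHull a b f) := by
  refine ⟨convex_Icc a b, fun x hx y hy u v hu hv huv => le_slopeHull hf fun s hs t h => ?_⟩
  have h1 := mul_le_mul_of_nonneg_left (slopeHull_le hx hs h) hu
  have h2 := mul_le_mul_of_nonneg_left (slopeHull_le hy hs h) hv
  simp only [smul_eq_mul]
  calc _ ≤ u * (s * x + t) + v * (s * y + t) := add_le_add h1 h2
    _ = s * (u * x + v * y) + (u + v) * t := by ring
    _ = _ := by rw [huv, one_mul]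

/-- A line above `f` to the right of `y` and above the hull at `y` is above the hull to the right
of `y`. -/
lemma slopeHull_le_of_le_right (hf : ∀ z ∈ Icc a b, f z ≤ z) {y p q : ℝ}
    (hp : p ∈ Icc (0 : ℝ) 1) (hy : a ≤ y) (h0 : slopeHull a b f y ≤ p * y + q)
    (h1 : ∀ z ∈ Icc y b, f z ≤ p * z + q) :
    ∀ x ∈ Icc y b, slopeHull a b f x ≤ p * x + q := by
  intro x hx
  refine le_of_forall_pos_le_add fun d hd => ?_
  have h2 : slopeHull a b f y < p * y + q + d := by linarith
  unfold slopeHull at h2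
  obtain ⟨_, ⟨s, hs, t, h, rfl⟩, hlt⟩ := exists_lt_of_csInf_lt
    (by exact ⟨y, 1, ⟨zero_le_one, le_rfl⟩, 0, by simpa using hf, by simp⟩) h2
  have hxab : x ∈ Icc a b := ⟨hy.trans hx.1, hx.2⟩
  -- The `s`-line nearly attains the hull at `y`. If `s ≤ p`, it stays below the `p`-line raised by
  -- `d` to the right of `y`. If `s > p`, the raised `p`-line dominates the `s`-line, hence `f`, to
  -- the left of `y`, so it competes in the hull.
  rcases le_or_gt s p with hsp | hsp
  · have := slopeHull_le hxab hs h
    nlinarith [hx.1]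
  · have := slopeHull_le (f := f) (s := p) (t := q + d) hxab hp fun z hz => by
      rcases le_total z y with hzy | hzy
      · have := h z hz
        nlinarith
      · linarith [h1 z ⟨hzy, hz.2⟩]
    linarith

end Hull

/-! ### Tight mechanisms -/

section Tight

variable {E : Env} {m : Mech}

lemma loss_le_self (hE : E.Standing) (hm : IsMechanism E m) {x : ℝ} (hx : x ∈ Icc E.lo E.hi) :
    loss E m x ≤ x := by
  have := loss_le_devLoss hE hm (right_mem_Icc.2 hx.1) hx.2
  obtain ⟨-, hp, -, -, h0⟩ := hm.1 x hx
  unfold devLoss at this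
  nlinarith [mul_nonneg (sub_nonneg.2 hp.2) h0.1]

/-- Both effort constraints say that the loss lies below a line of slope `eP y` in `[0, 1]`, so they
survive passing to the hull. The hull dominates the loss, hence needs no larger refunds, and
tightness leaves no room for improvement. Concavity, monotonicity and the Lipschitz bound follow at
once. -/
lemma IsTight.loss_eq_slopeHull (hE : E.Standing) (ht : IsTight E m) {x : ℝ}
    (hx : x ∈ Icc E.lo E.hi) :
    loss E m x = slopeHull E.lo E.hi (fun z => max (loss E m z) E.lo) x := by
  have hm := ht.1
  -- The cut-off at `lo` makes the hull admissible. It does not disturb the constraints, whose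
  -- bounding lines are at least `lo` on `[y, hi]`.
  set f : ℝ → ℝ := fun z => max (loss E m z) E.lo with hfdef
  set H := slopeHull E.lo E.hi f with hH
  have hf : ∀ z ∈ Icc E.lo E.hi, f z ≤ z := fun z hz => max_le (loss_le_self hE hm hz) hz.1
  have hHl : ∀ z ∈ Icc E.lo E.hi, loss E m z ≤ H z := fun z hz =>
    (le_max_left _ _).trans (self_le_slopeHull hf hz)
  have hHlo : ∀ z ∈ Icc E.lo E.hi, E.lo ≤ H z := fun z hz =>
    (le_max_right _ _).trans (self_le_slopeHull hf hz)
  have hadm : Admissible E H := fun z hz =>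
    ⟨slopeHull_le_id hf hz, by linarith [hHlo z hz, hE.lo_nonneg, hE.cA_one_lt_tau]⟩
  have hfeas : ∀ y ∈ Icc E.lo E.hi, EffortFeasible E H y (m.eA y) (m.eP y) := by
    intro y hy
    obtain ⟨ha, hp, h1, h2⟩ := effortFeasible_of_isMechanism hE hm hy
    have hyt : 0 ≤ y + E.tau := by linarith [hE.lo_nonneg, hE.tau_pos, hy.1]
    have hyp := mul_nonneg hp.1 hyt
    have hu := hE.uA_nonneg ha
    refine ⟨ha, hp, fun x hx => ?_, fun x hx => ?_⟩
    · refine slopeHull_le_of_le_right hf hp hy.1 ?_ (fun z hz => ?_) x hx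
      · linarith [(hadm y hy).1]
      · refine max_le (h1 z hz) ?_
        nlinarith [hz.1, hp.1, hy.1]
    · have := slopeHull_le_of_le_right (q := m.eP y * E.tau + H y + E.uA (m.eA y)) hf hp hy.1
        (by linarith) (fun z hz => max_le (by linarith [h2 z hz, hHl y hy]) ?_) x hx
      · linarith
      · nlinarith [hz.1, hp.1, hHlo y hy, mul_le_mul_of_nonneg_left hz.1 hp.1]
  obtain ⟨m', hm', h'⟩ := exists_mechanism hE hadm hfeas
  have htighter : TighterThan E m' m := by
    intro z hz
    refine ⟨?_, (hHl z hz).trans (h' z hz).1⟩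
    rw [(h' z hz).2]
    refine (profit_le_sub_effortCost hm hz).trans ?_
    unfold effortCost refund
    have : max (z - H z - E.uA (m.eA z)) 0 ≤ max (z - loss E m z - E.uA (m.eA z)) 0 :=
      max_le_max (by linarith [hHl z hz]) le_rfl
    linarith
  exact le_antisymm (hHl x hx) ((h' x hx).1.trans (ht.2 m' hm' htighter x hx).2)

lemma max_loss_le (hE : E.Standing) (hm : IsMechanism E m) :
    ∀ z ∈ Icc E.lo E.hi, max (loss E m z) E.lo ≤ z :=
  fun _ hz => max_le (loss_le_self hE hm hz) hz.1

lemma IsTight.lo_le_loss (hE : E.Standing) (ht : IsTight E m) {x : ℝ} (hx : x ∈ Icc E.lo E.hi) :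
    E.lo ≤ loss E m x := by
  rw [ht.loss_eq_slopeHull hE hx]
  exact (le_max_right _ _).trans (self_le_slopeHull (max_loss_le hE ht.1) hx)

lemma IsTight.monotoneOn_loss (hE : E.Standing) (ht : IsTight E m) :
    MonotoneOn (loss E m) (Icc E.lo E.hi) :=
  (slopeHull_monotoneOn (max_loss_le hE ht.1)).congr fun _ hx => (ht.loss_eq_slopeHull hE hx).symm

lemma IsTight.loss_sub_le (hE : E.Standing) (ht : IsTight E m) {x y : ℝ} (hx : E.lo ≤ x)
    (hxy : x ≤ y) (hy : y ≤ E.hi) : loss E m y - loss E m x ≤ y - x := by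
  rw [ht.loss_eq_slopeHull hE ⟨hx, hxy.trans hy⟩, ht.loss_eq_slopeHull hE ⟨hx.trans hxy, hy⟩]
  exact slopeHull_sub_le (max_loss_le hE ht.1) ⟨hx.trans hxy, hy⟩ hxy

lemma IsTight.concaveOn_loss (hE : E.Standing) (ht : IsTight E m) :
    ConcaveOn ℝ (Icc E.lo E.hi) (loss E m) :=
  (slopeHull_concaveOn (max_loss_le hE ht.1)).congr
    fun _ hx => (ht.loss_eq_slopeHull hE hx).symm

lemma IsTight.admissible_loss (hE : E.Standing) (ht : IsTight E m) : Admissible E (loss E m) :=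
  fun _ hx => ⟨loss_le_self hE ht.1 hx,
    by linarith [ht.lo_le_loss hE hx, hE.lo_nonneg, hE.cA_one_lt_tau]⟩

/-- The efforts of a tight mechanism minimize the cost at every type. -/
lemma IsTight.sub_effortCost_le_profit (hE : E.Standing) (ht : IsTight E m) {y e p : ℝ}
    (hy : y ∈ Icc E.lo E.hi) (hf : EffortFeasible E (loss E m) y e p) :
    y - effortCost E (loss E m) y e p ≤ profit E m y := by
  have hm := ht.1
  by_contra! hlt
  -- With the target kept equal to the loss, feasibility is a condition at each type separately, so
  -- the efforts can be changed at `y` alone.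
  obtain ⟨m', hm', h'⟩ := exists_mechanism (lam := loss E m)
    (e := Function.update m.eA y e) (p := Function.update m.eP y p) hE (ht.admissible_loss hE)
    (fun z hz => by
      rcases eq_or_ne z y with rfl | hzy
      · simpa using hf
      · simpa [hzy] using effortFeasible_of_isMechanism hE hm hz)
  have htighter : TighterThan E m' m := by
    intro z hz
    refine ⟨?_, (h' z hz).1⟩
    rw [(h' z hz).2]
    rcases eq_or_ne z y with rfl | hzy
    · simpa using hlt.le
    · simpa [hzy] using profit_le_sub_effortCost hm hz
  have := (ht.2 m' hm' htighter y hy).1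
  rw [(h' y hy).2] at this
  simp only [Function.update_self] at this
  linarith

lemma IsTight.profit_eq (hE : E.Standing) (ht : IsTight E m) {y : ℝ} (hy : y ∈ Icc E.lo E.hi) :
    profit E m y = y - effortCost E (loss E m) y (m.eA y) (m.eP y) :=
  le_antisymm (profit_le_sub_effortCost ht.1 hy)
    (ht.sub_effortCost_le_profit hE hy (effortFeasible_of_isMechanism hE ht.1 hy))

lemma IsTight.effortCost_le (hE : E.Standing) (ht : IsTight E m) {y e p : ℝ}
    (hy : y ∈ Icc E.lo E.hi) (hf : EffortFeasible E (loss E m) y e p) :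
    effortCost E (loss E m) y (m.eA y) (m.eP y) ≤ effortCost E (loss E m) y e p := by
  have := ht.sub_effortCost_le_profit hE hy hf
  rw [ht.profit_eq hE hy] at this
  linarith

lemma IsTight.RNA_eq (hE : E.Standing) (ht : IsTight E m) {y : ℝ} (hy : y ∈ Icc E.lo E.hi) :
    m.RNA y = refund E (loss E m) y (m.eA y) := by
  have := ht.profit_eq hE hy
  unfold profit effortCost at this
  have h2 : E.uA (m.eA y) = m.eA y * effDeriv E.cA (m.eA y) - E.cA (m.eA y) := rfl
  linarith

end Tight

end TaxMech

namespace TaxMech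

/-! ### First-order variations of the pointwise problem -/

/-- A nonnegative continuous function on a compact set stays positive after a small perturbation
in a direction that is positive on its zero set. -/
lemma exists_pos_eventually_forall_le {X : Set ℝ} (hX : IsCompact X) {s w : ℝ → ℝ}
    (hs : ContinuousOn s X) (hw : ContinuousOn w X) (h0 : ∀ x ∈ X, 0 ≤ s x)
    (h : ∀ x ∈ X, s x = 0 → 0 < w x) :
    ∃ κ > 0, ∀ᶠ t in 𝓝[>] (0 : ℝ), ∀ x ∈ X, t * κ ≤ s x + t * w x := by
  -- Membership in `X` becomes a hypothesis inside the claim, so that compactness induction can run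
  -- over arbitrary sets `S`.
  have key : ∃ κ > 0, ∀ᶠ t in 𝓝[>] (0 : ℝ), ∀ x ∈ X, x ∈ X → t * κ ≤ s x + t * w x := by
    refine hX.induction_on (p := fun S => ∃ κ > 0, ∀ᶠ t in 𝓝[>] (0 : ℝ), ∀ x ∈ S, x ∈ X →
      t * κ ≤ s x + t * w x) ⟨1, one_pos, by simp⟩ ?_ ?_ ?_
    · rintro S T hST ⟨κ, hκ, hT⟩
      exact ⟨κ, hκ, hT.mono fun t ht x hx => ht x (hST hx)⟩
    · rintro S T ⟨κ, hκ, hS⟩ ⟨κ', hκ', hT⟩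
      refine ⟨min κ κ', lt_min hκ hκ', ?_⟩
      filter_upwards [hS, hT, self_mem_nhdsWithin] with t h1 h2 ht x hx hxX
      rcases hx with hx | hx
      · exact (mul_le_mul_of_nonneg_left (min_le_left _ _) (le_of_lt ht)).trans (h1 x hx hxX)
      · exact (mul_le_mul_of_nonneg_left (min_le_right _ _) (le_of_lt ht)).trans (h2 x hx hxX)
    · intro x hx
      rcases (h0 x hx).eq_or_lt with hsx | hsx
      · have hwx := h x hx hsx.symm
        refine ⟨{z | w x / 2 < w z}, (hw x hx).eventually_const_lt (by linarith), w x / 2,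
          by linarith, ?_⟩
        filter_upwards [self_mem_nhdsWithin] with t ht z hz hzX
        have := mul_lt_mul_of_pos_left (show w x / 2 < w z from hz) ht
        linarith [h0 z hzX]
      · refine ⟨{z | s x / 2 < s z ∧ w x - 1 < w z},
          ((hs x hx).eventually_const_lt (by linarith)).and
            ((hw x hx).eventually_const_lt (by linarith)), 1, one_pos, ?_⟩
        have : Tendsto (fun t : ℝ => t * (2 - w x)) (𝓝[>] 0) (𝓝 0) := by
          have : Tendsto (fun t : ℝ => t * (2 - w x)) (𝓝 0) (𝓝 (0 * (2 - w x))) :=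
            (continuous_id.mul continuous_const).tendsto 0
          rw [zero_mul] at this
          exact this.mono_left nhdsWithin_le_nhds
        filter_upwards [self_mem_nhdsWithin, this.eventually_lt_const (by linarith : 0 < s x / 2)]
          with t ht ht' z hz hzX
        have := mul_lt_mul_of_pos_left hz.2 ht
        linarith [hz.1]
  obtain ⟨κ, hκ, hk⟩ := key
  exact ⟨κ, hκ, hk.mono fun t ht x hx => ht x hx hx⟩

lemma eventually_abs_sub_le {h : ℝ → ℝ} {h' κ : ℝ} (hd : HasDerivWithinAt h h' (Ioi 0) 0)
    (hκ : 0 < κ) : ∀ᶠ t in 𝓝[>] (0 : ℝ), |h t - h 0 - t * h'| ≤ t * κ := by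
  have := (hasDerivWithinAt_iff_isLittleO.1 hd).def hκ
  filter_upwards [this, self_mem_nhdsWithin] with t ht ht0
  simp only [sub_zero, smul_eq_mul, Real.norm_eq_abs] at ht
  rwa [abs_of_pos (show (0 : ℝ) < t from ht0), mul_comm κ] at ht

/-- Away from `f 0 = 0` one branch of the maximum is relevant and one hypothesis is used. At the
kink both apply, so `ρ` must dominate both the slope and `0`. -/
lemma eventually_max_zero_le {f : ℝ → ℝ} {f' ρ κ : ℝ} (hd : HasDerivWithinAt f f' (Ioi 0) 0)
    (h1 : 0 ≤ f 0 → f' ≤ ρ) (h2 : f 0 ≤ 0 → 0 ≤ ρ) (hκ : 0 < κ) :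
    ∀ᶠ t in 𝓝[>] (0 : ℝ), max (f t) 0 ≤ max (f 0) 0 + t * (ρ + κ) := by
  have hc : Tendsto f (𝓝[>] 0) (𝓝 (f 0)) := hd.continuousWithinAt
  have hz : Tendsto (fun t : ℝ => f 0 + t * (ρ + κ)) (𝓝[>] 0) (𝓝 (f 0)) := by
    have : Tendsto (fun t : ℝ => f 0 + t * (ρ + κ)) (𝓝 0) (𝓝 (f 0 + 0 * (ρ + κ))) :=
      (continuous_const.add (continuous_id.mul continuous_const)).tendsto 0
    rw [zero_mul, add_zero] at this
    exact this.mono_left nhdsWithin_le_nhds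
  have hup := eventually_abs_sub_le hd hκ
  rcases lt_trichotomy (f 0) 0 with h0 | h0 | h0
  · have := h2 h0.le
    filter_upwards [hc.eventually_lt_const h0, self_mem_nhdsWithin] with t ht ht0
    rw [max_eq_right ht.le, max_eq_right h0.le, zero_add]
    exact mul_nonneg (le_of_lt ht0) (by linarith)
  · have a := h1 h0.ge
    have b := h2 h0.le
    filter_upwards [hup, self_mem_nhdsWithin] with t ht ht0
    have ht0' : (0 : ℝ) < t := ht0
    rw [h0] at ht ⊢
    have := (abs_le.1 ht).2
    refine max_le ?_ ?_
    · rw [max_self]; nlinarith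
    · rw [max_self, zero_add]; exact mul_nonneg ht0'.le (by linarith)
  · have a := h1 h0.le
    filter_upwards [hup, hz.eventually_const_lt h0, self_mem_nhdsWithin] with t ht hpos ht0
    have ht0' : (0 : ℝ) < t := ht0
    have := (abs_le.1 ht).2
    rw [max_eq_left h0.le]
    refine max_le ?_ hpos.le
    nlinarith

lemma hasDerivWithinAt_ray {f : ℝ → ℝ} {f' a d : ℝ} {S : Set ℝ} (hf : HasDerivWithinAt f f' S a)
    (hS : ∀ᶠ t in 𝓝[>] (0 : ℝ), a + t * d ∈ S) :
    HasDerivWithinAt (fun t => f (a + t * d)) (f' * d) (Ioi 0) 0 := by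
  have h1 : HasDerivWithinAt (fun t : ℝ => a + t * d) d {t | a + t * d ∈ S} 0 := by
    simpa using (((hasDerivAt_id (0 : ℝ)).mul_const d).const_add a).hasDerivWithinAt
  have h2 : HasDerivWithinAt (fun t : ℝ => f (a + t * d)) (f' * d) {t | a + t * d ∈ S} 0 :=
    HasDerivWithinAt.comp (h₂ := f) (h := fun t : ℝ => a + t * d) (s' := S) 0 (by simpa using hf) h1
      (fun t ht => ht)
  exact h2.mono_of_mem_nhdsWithin hS

variable {E : Env}

/-- Moving the efforts in the direction `(δ, π)` remains feasible when the target moves in the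
direction `eta`, provided this holds to first order on the binding constraints; `ρ` bounds the
directional derivative of the refund. -/
lemma eventually_effortFeasible_and_effortCost_le (hE : E.Standing) {lam eta : ℝ → ℝ}
    {y e p δ π ρ κ : ℝ} (hlam : ContinuousOn lam (Icc y E.hi))
    (heta : ContinuousOn eta (Icc y E.hi)) (hf : EffortFeasible E lam y e p)
    (he : e ∈ Ioo (0 : ℝ) 1) (hπ : ∀ᶠ t in 𝓝[>] (0 : ℝ), p + t * π ∈ Icc (0 : ℝ) 1)
    (h1 : ∀ x ∈ Icc y E.hi, lam x = p * x + (1 - p) * y → eta x < π * (x - y))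
    (h2 : ∀ x ∈ Icc y E.hi, lam x - lam y - E.uA e = p * (x + E.tau) →
      eta x - eta y < π * (x + E.tau) + effDeriv E.uA e * δ)
    (hρ1 : 0 ≤ y - lam y - E.uA e → -eta y - effDeriv E.uA e * δ ≤ ρ)
    (hρ2 : y - lam y - E.uA e ≤ 0 → 0 ≤ ρ) (hκ : 0 < κ) :
    ∀ᶠ t in 𝓝[>] (0 : ℝ),
      EffortFeasible E (fun x => lam x + t * eta x) y (e + t * δ) (p + t * π) ∧
      effortCost E (fun x => lam x + t * eta x) y (e + t * δ) (p + t * π) ≤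
        effortCost E lam y e p +
          t * (ρ + ((effDeriv E.cA e + effDeriv E.uA e - E.cP p) * δ
            + (1 - e) * effDeriv E.cP p * π) + κ) := by
  have heI : e ∈ Icc (0 : ℝ) 1 := Ioo_subset_Icc_self he
  have hray : Tendsto (fun t : ℝ => e + t * δ) (𝓝[>] 0) (𝓝 e) := by
    have : Tendsto (fun t : ℝ => e + t * δ) (𝓝 0) (𝓝 (e + 0 * δ)) :=
      (continuous_const.add (continuous_id.mul continuous_const)).tendsto 0
    rw [zero_mul, add_zero] at this
    exact this.mono_left nhdsWithin_le_nhds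
  have heI' : ∀ᶠ t in 𝓝[>] (0 : ℝ), e + t * δ ∈ Icc (0 : ℝ) 1 :=
    hray.eventually (Icc_mem_nhds he.1 he.2)
  have dU := hasDerivWithinAt_ray (hE.hasDerivAt_uA he).hasDerivWithinAt (S := univ) (d := δ)
    (by simp)
  have dA := hasDerivWithinAt_ray (hE.costA.hasDerivAt_effDeriv he).hasDerivWithinAt (S := univ)
    (d := δ) (by simp)
  have dP := hasDerivWithinAt_ray (hE.costP.hasDerivWithinAt hf.principal) hπ
  have dI : HasDerivWithinAt (fun t : ℝ => e + t * δ) δ (Ioi 0) 0 := by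
    simpa using (((hasDerivAt_id (0 : ℝ)).mul_const δ).const_add e).hasDerivWithinAt
  -- Compactness of `[y, hi]` turns strictness on the active set into feasibility for all `x` at
  -- once. The margin in the second family absorbs the error of linearizing `uA`.
  obtain ⟨κ1, hκ1, hk1⟩ := exists_pos_eventually_forall_le (isCompact_Icc (a := y) (b := E.hi))
    (s := fun x => p * x + (1 - p) * y - lam x) (w := fun x => π * (x - y) - eta x)
    (by fun_prop) (by fun_prop) (fun x hx => by linarith [hf.no_refund x hx])
    (fun x hx h => by linarith [h1 x hx (by linarith)])
  obtain ⟨κ2, hκ2, hk2⟩ := exists_pos_eventually_forall_le (isCompact_Icc (a := y) (b := E.hi))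
    (s := fun x => p * (x + E.tau) - (lam x - lam y - E.uA e))
    (w := fun x => π * (x + E.tau) + effDeriv E.uA e * δ - (eta x - eta y))
    (by fun_prop) (by fun_prop) (fun x hx => by linarith [hf.full_refund x hx])
    (fun x hx h => by linarith [h2 x hx (by linarith)])
  have hmax := eventually_max_zero_le (f := fun t => y - (lam y + t * eta y) - E.uA (e + t * δ))
    (f' := -eta y - effDeriv E.uA e * δ) (ρ := ρ) (κ := κ / 2)
    (by
      have h3 : HasDerivWithinAt (fun t : ℝ => y - (lam y + t * eta y)) (-eta y) (Ioi 0) 0 := by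
        simpa using ((((hasDerivAt_id (0 : ℝ)).mul_const (eta y)).const_add
          (lam y)).const_sub y).hasDerivWithinAt
      exact h3.sub dU)
    (by simpa using hρ1) (by simpa using hρ2) (by linarith)
  have hrest := eventually_abs_sub_le (κ := κ / 2)
    ((dI.mul dA).add ((dI.const_sub 1).mul dP)) (by linarith)
  filter_upwards [hk1, hk2, hmax, hrest, hπ, heI', eventually_abs_sub_le dU hκ2,
    self_mem_nhdsWithin] with t a1 a2 a3 a4 a5 a6 a7 ht
  have ht0 : (0 : ℝ) < t := ht
  refine ⟨⟨a6, a5, fun x hx => ?_, fun x hx => ?_⟩, ?_⟩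
  · have := a1 x hx
    have := mul_pos ht0 hκ1
    nlinarith
  · have h3 := a2 x hx
    have h4 := (abs_le.1 a7).1
    simp only [zero_mul, add_zero] at h4
    nlinarith
  · have h4 := (abs_le.1 a4).2
    simp only [Pi.add_apply, Pi.mul_apply, zero_mul, add_zero] at h4 a3
    unfold effortCost refund
    have h5 : effDeriv E.uA e = e * effDeriv (effDeriv E.cA) e := hE.effDeriv_uA heI
    have h6 : t * (δ * effDeriv E.cA e + e * (effDeriv (effDeriv E.cA) e * δ)
        + (-δ * E.cP p + (1 - e) * (effDeriv E.cP p * π)))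
        = t * ((effDeriv E.cA e + effDeriv E.uA e - E.cP p) * δ
            + (1 - e) * effDeriv E.cP p * π) := by rw [h5]; ring
    linarith

/-- The first-order condition in the direction `(δ, π)`. -/
lemma first_order_nonneg (hE : E.Standing) {lam : ℝ → ℝ}
    {y e p δ π ρ : ℝ} (hlam : ContinuousOn lam (Icc y E.hi)) (hf : EffortFeasible E lam y e p)
    (hmin : ∀ e' p', EffortFeasible E lam y e' p' →
      effortCost E lam y e p ≤ effortCost E lam y e' p')
    (he : e ∈ Ioo (0 : ℝ) 1) (hπ : ∀ᶠ t in 𝓝[>] (0 : ℝ), p + t * π ∈ Icc (0 : ℝ) 1)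
    (h1 : ∀ x ∈ Icc y E.hi, lam x = p * x + (1 - p) * y → 0 < π * (x - y))
    (h2 : ∀ x ∈ Icc y E.hi, lam x - lam y - E.uA e = p * (x + E.tau) →
      0 < π * (x + E.tau) + effDeriv E.uA e * δ)
    (hρ1 : 0 ≤ y - lam y - E.uA e → -effDeriv E.uA e * δ ≤ ρ)
    (hρ2 : y - lam y - E.uA e ≤ 0 → 0 ≤ ρ) :
    0 ≤ ρ + ((effDeriv E.cA e + effDeriv E.uA e - E.cP p) * δ
      + (1 - e) * effDeriv E.cP p * π) := by
  refine le_of_forall_pos_le_add fun κ hκ => ?_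
  obtain ⟨t, ⟨hft, hct⟩, ht⟩ := ((eventually_effortFeasible_and_effortCost_le hE (eta := fun _ => 0)
    hlam continuousOn_const hf he hπ h1 (by simpa using h2) (by simpa using hρ1) hρ2 hκ).and
    self_mem_nhdsWithin).exists
  simp only [mul_zero, add_zero] at hft hct
  have h3 := hmin _ _ hft
  have ht0 : (0 : ℝ) < t := ht
  by_contra! hneg
  nlinarith

end TaxMech

namespace TaxMech

/-! ### Interior efforts of tight mechanisms with doubly unique binding ICs -/

variable {E : Env} {m : Mech}

lemma IsTight.continuousOn_loss (hE : E.Standing) (ht : IsTight E m) :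
    ContinuousOn (loss E m) (Icc E.lo E.hi) := by
  refine (LipschitzOnWith.of_dist_le_mul (K := 1) fun x hx y hy => ?_).continuousOn
  rw [NNReal.coe_one, one_mul, Real.dist_eq, Real.dist_eq]
  rcases le_total x y with h | h
  · have h1 := ht.loss_sub_le hE hx.1 h hy.2
    have h2 := ht.monotoneOn_loss hE hx hy h
    rw [abs_of_nonpos (by linarith), abs_of_nonpos (by linarith)]
    linarith
  · have h1 := ht.loss_sub_le hE hy.1 h hx.2
    have h2 := ht.monotoneOn_loss hE hy hx h
    rw [abs_of_nonneg (by linarith), abs_of_nonneg (by linarith)]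
    linarith

lemma IsTight.loss_lo (hE : E.Standing) (ht : IsTight E m) : loss E m E.lo = E.lo :=
  have h := left_mem_Icc.2 hE.lo_lt_hi.le
  le_antisymm (loss_le_self hE ht.1 h) (ht.lo_le_loss hE h)

/-- Feasibility of `r0` squeezes `devLoss` between the loss and the active bound. With the
full-refund analogue below, this is how unique binding ICs leave a single point where effort
constraints can be active. -/
lemma mem_bindingIC_of_no_refund (hE : E.Standing) (hm : IsMechanism E m) {x y : ℝ}
    (hy : E.lo ≤ y) (hx : x ∈ Icc y E.hi)
    (h : loss E m x = m.eP y * x + (1 - m.eP y) * y) : x ∈ bindingIC E m y := by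
  obtain ⟨-, hp, -, -, h0⟩ := hm.1 y ⟨hy, hx.1.trans hx.2⟩
  refine ⟨hx, le_antisymm (loss_le_devLoss hE hm ⟨hy, hx.1⟩ hx.2) ?_⟩
  rw [h, devLoss]
  nlinarith [mul_nonneg (sub_nonneg.2 hp.2) h0.1]

lemma mem_bindingIC_of_full_refund (hE : E.Standing) (hm : IsMechanism E m) {x y : ℝ}
    (hy : E.lo ≤ y) (hx : x ∈ Icc y E.hi)
    (h : loss E m x - loss E m y - E.uA (m.eA y) = m.eP y * (x + E.tau)) :
    x ∈ bindingIC E m y := by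
  have hyI : y ∈ Icc E.lo E.hi := ⟨hy, hx.1.trans hx.2⟩
  obtain ⟨-, hp, -, hP, -⟩ := hm.1 y hyI
  have hR : y - loss E m y - E.uA (m.eA y) ≤ m.RNA y :=
    (le_max_left _ _).trans (refund_le_RNA hm hyI)
  refine ⟨hx, le_antisymm (loss_le_devLoss hE hm ⟨hy, hx.1⟩ hx.2) ?_⟩
  unfold Mech.RNA at hR
  unfold devLoss
  nlinarith [mul_nonneg hp.1 (sub_nonneg.2 hP.2)]

lemma effortFeasible_one (hE : E.Standing) {lam : ℝ → ℝ} (hlam : Admissible E lam) {y e : ℝ}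
    (hy : y ∈ Icc E.lo E.hi) (he : e ∈ Icc (0 : ℝ) 1) : EffortFeasible E lam y e 1 := by
  refine ⟨he, ⟨zero_le_one, le_rfl⟩, fun x hx => ?_, fun x hx => ?_⟩
  · linarith [(hlam x ⟨hy.1.trans hx.1, hx.2⟩).1]
  · linarith [(hlam x ⟨hy.1.trans hx.1, hx.2⟩).1, (hlam y hy).2, hE.uA_nonneg he,
      hE.costA.nonneg (right_mem_Icc.2 zero_le_one)]

/-- At full agent effort auditing is never paid for, so `p` can be raised to `1` for free. Lowering
the effort slightly then saves more than it costs, since `c_A'(1) > c_P(1)`. -/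
lemma IsTight.eA_lt_one (hE : E.Standing) (ht : IsTight E m) {y : ℝ} (hy : y ∈ Icc E.lo E.hi) :
    m.eA y < 1 := by
  have heI := (effortFeasible_of_isMechanism hE ht.1 hy).agent
  refine lt_of_le_of_ne heI.2 fun he => ?_
  have h1 : (1 : ℝ) ∈ Icc (0 : ℝ) 1 := right_mem_Icc.2 zero_le_one
  obtain ⟨z, hz, hzI⟩ : ∃ z, E.cP 1 < effDeriv E.cA z ∧ z ∈ Ioo (0 : ℝ) 1 := by
    have h2 := (hE.costA.continuousOn_effDeriv 1 h1).eventually_const_lt hE.budget.2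
    have h3 : ∀ᶠ z in 𝓝[Ioo (0 : ℝ) 1] 1, E.cP 1 < effDeriv E.cA z :=
      h2.filter_mono (nhdsWithin_mono _ Ioo_subset_Icc_self)
    have : (𝓝[Ioo (0 : ℝ) 1] 1).NeBot := by
      rw [nhdsWithin_Ioo_eq_nhdsLT zero_lt_one]; infer_instance
    exact (h3.and self_mem_nhdsWithin).exists
  have hzI' := Ioo_subset_Icc_self hzI
  have hle := ht.effortCost_le hE hy (effortFeasible_one hE (ht.admissible_loss hE) hy hzI')
  rw [he, effortCost_eq, effortCost_eq] at hle
  have hmono := hE.costA.strictMonoOn_effDeriv hzI' h1 hzI.2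
  have ha := hE.costA.tangent_le hzI' h1
  have hlt : max (y - loss E m y + E.cA z) (z * effDeriv E.cA z) + (1 - z) * E.cP 1 <
      max (y - loss E m y + E.cA 1) (1 * effDeriv E.cA 1) := by
    rw [← lt_sub_iff_add_lt]
    refine max_lt ?_ ?_
    · have := le_max_left (y - loss E m y + E.cA 1) (1 * effDeriv E.cA 1)
      nlinarith [hzI.2]
    · have := le_max_right (y - loss E m y + E.cA 1) (1 * effDeriv E.cA 1)
      nlinarith [hzI.2, hzI.1]
  linarith

/-- If the agent makes no effort but is audited, a small effort `z` with `c_A'(z) < c_P(p)` is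
cheaper, and it relaxes the full-refund constraints. -/
lemma IsTight.eP_eq_zero (hE : E.Standing) (ht : IsTight E m) {y : ℝ} (hy : y ∈ Icc E.lo E.hi)
    (he : m.eA y = 0) : m.eP y = 0 := by
  have hf := effortFeasible_of_isMechanism hE ht.1 hy
  by_contra hp
  have hp0 : 0 < m.eP y := lt_of_le_of_ne hf.principal.1 (Ne.symm hp)
  have hcp := hE.costP.pos ⟨hp0, hf.principal.2⟩
  have h0 : (0 : ℝ) ∈ Icc (0 : ℝ) 1 := left_mem_Icc.2 zero_le_one
  obtain ⟨z, hz, hzI⟩ : ∃ z, effDeriv E.cA z < E.cP (m.eP y) ∧ z ∈ Ioo (0 : ℝ) 1 := by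
    have h2 := (hE.costA.continuousOn_effDeriv 0 h0).eventually_lt_const
      (by rwa [hE.costA.deriv_zero])
    have h3 : ∀ᶠ z in 𝓝[Ioo (0 : ℝ) 1] 0, effDeriv E.cA z < E.cP (m.eP y) :=
      h2.filter_mono (nhdsWithin_mono _ Ioo_subset_Icc_self)
    have : (𝓝[Ioo (0 : ℝ) 1] 0).NeBot := by
      rw [nhdsWithin_Ioo_eq_nhdsGT zero_lt_one]; infer_instance
    exact (h3.and self_mem_nhdsWithin).exists
  have hzI' := Ioo_subset_Icc_self hzI
  have hu := hE.uA_nonneg hzI'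
  have hle := ht.effortCost_le hE hy (e := z) (p := m.eP y)
    ⟨hzI', hf.principal, hf.no_refund, fun x hx => by
      have := hf.full_refund x hx
      rw [he, hE.uA_zero] at this
      linarith⟩
  rw [he, effortCost_eq, effortCost_eq] at hle
  have hg := loss_le_self hE ht.1 hy
  have hlt : max (y - loss E m y + E.cA z) (z * effDeriv E.cA z) <
      y - loss E m y + z * E.cP (m.eP y) := by
    unfold Env.uA at hu
    have := mul_lt_mul_of_pos_left hz hzI.1
    exact max_lt (by linarith) (by linarith)
  rw [hE.costA.zero, max_eq_left (by linarith)] at hle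
  linarith

/-- The mechanism pays out the whole information rent without evidence at types where no
evidence is acquired. -/
lemma IsTight.Icc_subset_bindingIC (hE : E.Standing) (ht : IsTight E m) {y : ℝ}
    (hy : y ∈ Icc E.lo E.hi) (he : m.eA y = 0) (hp : m.eP y = 0) :
    Icc y E.hi ⊆ bindingIC E m y := by
  intro x hx
  have hR := ht.RNA_eq hE hy
  have hg := loss_le_self hE ht.1 hy
  rw [Mech.RNA, he, hp, refund, hE.uA_zero, max_eq_left (by linarith)] at hR
  refine ⟨hx, le_antisymm (loss_le_devLoss hE ht.1 ⟨hy.1, hx.1⟩ hx.2) ?_⟩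
  have := ht.monotoneOn_loss hE hy ⟨hy.1.trans hx.1, hx.2⟩ hx.1
  rw [devLoss, hp]
  linarith

/-- Without any evidence every higher type would be indifferent to mimicking `y`, against uniqueness
of the binding type. -/
lemma IsTight.not_eA_eP_eq_zero (hE : E.Standing) (ht : IsTight E m) (hd : DoublyUnique E m)
    {y : ℝ} (hy : y ∈ Ioo E.lo E.hi) (he : m.eA y = 0) : False := by
  have hyI := Ioo_subset_Icc_self hy
  have h := ht.Icc_subset_bindingIC hE hyI he (ht.eP_eq_zero hE hyI he)
  obtain ⟨x, hx⟩ := hd.1 y hy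
  rw [hx] at h
  have h1 : y = x := h ⟨le_rfl, hy.2.le⟩
  have h2 : E.hi = x := h ⟨hy.2.le, le_rfl⟩
  linarith [hy.2]

/-- If `x` lost everything, the types below it would have to be audited with certainty. The slope
bound then makes such a type `y` lose everything too, so both `x` and `y` bind at `y`. -/
lemma IsTight.loss_lt_self (hE : E.Standing) (ht : IsTight E m) (hd : DoublyUnique E m) {x : ℝ}
    (hx : x ∈ Ioc E.lo E.hi) : loss E m x < x := by
  refine lt_of_le_of_ne (loss_le_self hE ht.1 ⟨hx.1.le, hx.2⟩) fun h => ?_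
  have hy : (E.lo + x) / 2 ∈ Ioo E.lo E.hi := ⟨by linarith [hx.1], by linarith [hx.1, hx.2]⟩
  set y := (E.lo + x) / 2 with hydef
  have hyx : y < x := by linarith [hx.1]
  have hyI := Ioo_subset_Icc_self hy
  obtain ⟨z, hz⟩ := hd.1 y hy
  have hf := effortFeasible_of_isMechanism hE ht.1 hyI
  have h1 := hf.no_refund x ⟨hyx.le, hx.2⟩
  have hp : m.eP y = 1 := by
    refine le_antisymm hf.principal.2 ?_
    rw [h] at h1
    by_contra! hp
    nlinarith
  have h2 := ht.loss_sub_le hE hyI.1 hyx.le hx.2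
  have h3 := loss_le_self hE ht.1 hyI
  have b1 := mem_bindingIC_of_no_refund hE ht.1 hyI.1 (x := y) ⟨le_rfl, hyI.2⟩
    (by rw [hp]; linarith)
  have b2 := mem_bindingIC_of_no_refund hE ht.1 hyI.1 (x := x) ⟨hyx.le, hx.2⟩
    (by rw [hp]; linarith)
  rw [hz] at b1 b2
  have : y = x := (show y = z from b1).trans (show x = z from b2).symm
  linarith

/-- Otherwise the loss is constantly `lo`, zero efforts are feasible, and they are the cheapest
choice; but zero agent effort contradicts unique binding ICs. -/
lemma IsTight.lo_lt_loss_hi (hE : E.Standing) (ht : IsTight E m) (hd : DoublyUnique E m) :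
    E.lo < loss E m E.hi := by
  have hhi := right_mem_Icc.2 hE.lo_lt_hi.le
  by_contra! hle
  have hlam : ∀ x ∈ Icc E.lo E.hi, loss E m x = E.lo := fun x hx =>
    le_antisymm ((ht.monotoneOn_loss hE hx hhi hx.2).trans hle) (ht.lo_le_loss hE hx)
  have hy : (E.lo + E.hi) / 2 ∈ Ioo E.lo E.hi :=
    ⟨by linarith [hE.lo_lt_hi], by linarith [hE.lo_lt_hi]⟩
  set y := (E.lo + E.hi) / 2
  have hyI := Ioo_subset_Icc_self hy
  have hf := effortFeasible_of_isMechanism hE ht.1 hyI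
  have h0 : (0 : ℝ) ∈ Icc (0 : ℝ) 1 := left_mem_Icc.2 zero_le_one
  have hle := ht.effortCost_le hE hyI (e := 0) (p := 0)
    ⟨h0, h0, fun x hx => by rw [hlam x ⟨hyI.1.trans hx.1, hx.2⟩]; linarith [hy.1],
      fun x hx => by rw [hlam x ⟨hyI.1.trans hx.1, hx.2⟩, hlam y hyI, hE.uA_zero]; linarith⟩
  rw [effortCost_eq, effortCost_eq, hlam y hyI, hE.costA.zero, hE.costP.zero,
    zero_mul, max_eq_left (a := y - E.lo + 0) (by linarith [hy.1])] at hle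
  have h1 := le_max_left (y - E.lo + E.cA (m.eA y)) (m.eA y * effDeriv E.cA (m.eA y))
  have h2 : m.eA y = 0 := by
    by_contra he
    have := hE.costA.pos ⟨lt_of_le_of_ne hf.agent.1 (Ne.symm he), hf.agent.2⟩
    have := mul_nonneg (sub_nonneg.2 hf.agent.2) (hE.costP.nonneg hf.principal)
    linarith
  exact ht.not_eA_eP_eq_zero hE hd hy h2

/-- At a type with positive audit probability some constraint on the principal's effort binds. -/
lemma IsTight.exists_active (hE : E.Standing) (ht : IsTight E m) {y : ℝ}
    (hy : y ∈ Icc E.lo E.hi) (he : m.eA y ∈ Ioo (0 : ℝ) 1) (hp : 0 < m.eP y) :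
    ∃ x ∈ Icc y E.hi, loss E m x = m.eP y * x + (1 - m.eP y) * y ∨
      loss E m x - loss E m y - E.uA (m.eA y) = m.eP y * (x + E.tau) := by
  by_contra! hno
  have hf := effortFeasible_of_isMechanism hE ht.1 hy
  have := first_order_nonneg hE (δ := 0) (π := -1) (ρ := 0)
    ((ht.continuousOn_loss hE).mono (Icc_subset_Icc_left hy.1)) hf
    (fun _ _ h => ht.effortCost_le hE hy h) he
    (by
      filter_upwards [Ioo_mem_nhdsGT hp] with t ht
      exact ⟨by linarith [ht.2], by linarith [ht.1, hf.principal.2]⟩)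
    (fun x hx h => absurd h (hno x hx).1) (fun x hx h => absurd h (hno x hx).2) (by simp) (by simp)
  have := hE.costP.effDeriv_pos ⟨hp, hf.principal.2⟩
  nlinarith [he.2]

lemma IsTight.eA_mem_Ioo (hE : E.Standing) (ht : IsTight E m) (hd : DoublyUnique E m)
    {y : ℝ} (hy : y ∈ Ioo E.lo E.hi) : m.eA y ∈ Ioo (0 : ℝ) 1 := by
  have hyI := Ioo_subset_Icc_self hy
  refine ⟨lt_of_le_of_ne (effortFeasible_of_isMechanism hE ht.1 hyI).agent.1 fun h => ?_,
    ht.eA_lt_one hE hyI⟩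
  exact ht.not_eA_eP_eq_zero hE hd hy h.symm

/-- At `p = 0` auditing has zero marginal cost, so substituting it for agent effort saves money. At
`p = 1` an active constraint would require some type to lose its whole surplus or more. -/
lemma IsTight.eP_mem_Ioo (hE : E.Standing) (ht : IsTight E m) (hd : DoublyUnique E m)
    {y : ℝ} (hy : y ∈ Ioo E.lo E.hi) : m.eP y ∈ Ioo (0 : ℝ) 1 := by
  have hyI := Ioo_subset_Icc_self hy
  have he := ht.eA_mem_Ioo hE hd hy
  have heI := Ioo_subset_Icc_self he
  have hf := effortFeasible_of_isMechanism hE ht.1 hyI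
  have hyl := ht.loss_lt_self hE hd ⟨hy.1, hy.2.le⟩
  have hu := hE.effDeriv_uA_pos ⟨he.1, he.2.le⟩
  have hpos : 0 < m.eP y := by
    refine lt_of_le_of_ne hf.principal.1 fun hp => ?_
    have hτ := hE.tau_pos
    -- As `x + tau ≥ tau`, audits rising at this rate more than compensate the full-refund
    -- constraints for agent effort falling at unit rate.
    have hπ : 0 < (effDeriv E.uA (m.eA y) + 1) / E.tau := by positivity
    have := first_order_nonneg hE (δ := -1) (π := (effDeriv E.uA (m.eA y) + 1) / E.tau)
      (ρ := effDeriv E.uA (m.eA y))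
      ((ht.continuousOn_loss hE).mono (Icc_subset_Icc_left hyI.1)) hf
      (fun _ _ h => ht.effortCost_le hE hyI h) he
      (by
        filter_upwards [Ioo_mem_nhdsGT (inv_pos.2 hπ)] with t ht
        rw [← hp]
        have := mul_lt_mul_of_pos_right ht.2 hπ
        rw [inv_mul_cancel₀ hπ.ne'] at this
        exact ⟨by have := mul_pos ht.1 hπ; linarith, by linarith⟩)
      (fun x hx h => mul_pos hπ (by
        rcases hx.1.eq_or_lt with h' | h'
        · rw [← h'] at h; linarith
        · linarith))
      (fun x hx h => by
        have h1 : (effDeriv E.uA (m.eA y) + 1) / E.tau * (x + E.tau) =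
          (effDeriv E.uA (m.eA y) + 1) / E.tau * x + (effDeriv E.uA (m.eA y) + 1) := by
            field_simp
        have h2 := mul_nonneg hπ.le (hE.lo_nonneg.trans (hyI.1.trans hx.1))
        linarith)
      (fun _ => by linarith) (fun _ => hu.le)
    rw [← hp, hE.costP.zero, hE.costP.deriv_zero] at this
    have := hE.costA.effDeriv_pos ⟨he.1, he.2.le⟩
    linarith
  refine ⟨hpos, lt_of_le_of_ne hf.principal.2 fun hp => ?_⟩
  obtain ⟨x, hx, h⟩ := ht.exists_active hE hyI he hpos
  have hxl := ht.loss_lt_self hE hd ⟨hy.1.trans_le hx.1, hx.2⟩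
  rw [hp] at h
  rcases h with h | h
  · linarith
  · linarith [hE.tau_pos, hE.uA_nonneg heI, ht.lo_le_loss hE hyI, hE.lo_nonneg]

end TaxMech

namespace TaxMech

/-! ### The direct and the indirect impact at interior types -/

variable {E : Env} {m : Mech}

lemma eventually_ray_mem_Icc {p : ℝ} (hp : p ∈ Ioo (0 : ℝ) 1) (π : ℝ) :
    ∀ᶠ t in 𝓝[>] (0 : ℝ), p + t * π ∈ Icc (0 : ℝ) 1 := by
  have : Tendsto (fun t : ℝ => p + t * π) (𝓝 0) (𝓝 (p + 0 * π)) :=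
    (continuous_const.add (continuous_id.mul continuous_const)).tendsto 0
  rw [zero_mul, add_zero] at this
  exact (this.mono_left nhdsWithin_le_nhds).eventually (Icc_mem_nhds hp.1 hp.2)

/-- The marginal cost of the principal's effort. -/
noncomputable def marginalAudit (E : Env) (m : Mech) (y : ℝ) : ℝ :=
  (1 - m.eA y) * effDeriv E.cP (m.eP y)

section Interior

variable {y z : ℝ}

/-- The evidence rent is positive, so truth-telling needs a refund strictly below `y - loss y`. If
`y` bound itself, the refund without evidence alone would already be that large. -/
lemma IsTight.lt_binding (hE : E.Standing) (ht : IsTight E m) (hd : DoublyUnique E m)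
    (hy : y ∈ Ioo E.lo E.hi) (hz : bindingIC E m y = {z}) : y < z ∧ z ≤ E.hi := by
  have hyI := Ioo_subset_Icc_self hy
  have hzm : z ∈ bindingIC E m y := by rw [hz]; rfl
  refine ⟨lt_of_le_of_ne hzm.1.1 fun h => ?_, hzm.1.2⟩
  obtain ⟨-, hp, -, hP, -⟩ := ht.1.1 y hyI
  have hl := hzm.2
  rw [← h, devLoss] at hl
  have hR := ht.RNA_eq hE hyI
  have he := ht.eA_mem_Ioo hE hd hy
  have hu := hE.uA_pos ⟨he.1, he.2.le⟩
  have hyl := ht.loss_lt_self hE hd ⟨hy.1, hy.2.le⟩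
  have hlt : refund E (loss E m) y (m.eA y) < y - loss E m y := max_lt (by linarith) (by linarith)
  rw [← hR, Mech.RNA] at hlt
  nlinarith [mul_nonneg hp.1 hP.1]

lemma IsTight.no_refund_imp_eq (hE : E.Standing) (ht : IsTight E m) (hy : y ∈ Ioo E.lo E.hi)
    (hz : bindingIC E m y = {z}) {x : ℝ} (hx : x ∈ Icc y E.hi)
    (h : loss E m x = m.eP y * x + (1 - m.eP y) * y) : x = z := by
  have := mem_bindingIC_of_no_refund hE ht.1 hy.1.le hx h
  rwa [hz] at this

lemma IsTight.full_refund_imp_eq (hE : E.Standing) (ht : IsTight E m) (hy : y ∈ Ioo E.lo E.hi)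
    (hz : bindingIC E m y = {z}) {x : ℝ} (hx : x ∈ Icc y E.hi)
    (h : loss E m x - loss E m y - E.uA (m.eA y) = m.eP y * (x + E.tau)) : x = z := by
  have := mem_bindingIC_of_full_refund hE ht.1 hy.1.le hx h
  rwa [hz] at this

/-- The binding type is the unique maximizer of the loss net of the line with slope `eP y`. -/
lemma IsTight.sub_lt_of_ne_binding (hE : E.Standing) (ht : IsTight E m) (hd : DoublyUnique E m)
    (hy : y ∈ Ioo E.lo E.hi) (hz : bindingIC E m y = {z}) {x : ℝ} (hx : x ∈ Icc E.lo E.hi)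
    (hxz : x ≠ z) : loss E m x - m.eP y * x < loss E m z - m.eP y * z := by
  obtain ⟨hyz, hzh⟩ := ht.lt_binding hE hd hy hz
  have hzm : z ∈ bindingIC E m y := by rw [hz]; rfl
  have hright : ∀ w ∈ Icc y E.hi, w ≠ z →
      loss E m w - m.eP y * w < loss E m z - m.eP y * z := by
    intro w hw hwz
    have h1 := loss_le_devLoss hE ht.1 ⟨hy.1.le, hw.1⟩ hw.2
    have h2 : loss E m w ≠ devLoss m w y := fun h => hwz (by
      have : w ∈ bindingIC E m y := ⟨hw, h⟩
      rwa [hz] at this)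
    have h3 := lt_of_le_of_ne h1 h2
    have h4 := hzm.2
    unfold devLoss at h3 h4
    linarith
  rcases le_or_gt y x with h | h
  · exact hright x ⟨h, hx.2⟩ hxz
  -- To the left of `y` there are no constraints at `y`; here concavity of the loss carries the
  -- strict inequality at `y` over to `x`, as `y` lies between `x` and `z`.
  · by_contra! hge
    have hc := (ht.concaveOn_loss hE).2 hx ⟨hy.1.le.trans hyz.le, hzh⟩
      (show 0 ≤ (z - y) / (z - x) from div_nonneg (by linarith) (by linarith))
      (show 0 ≤ (y - x) / (z - x) from div_nonneg (by linarith) (by linarith))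
      (by rw [← add_div, div_eq_one_iff_eq (by linarith)]; ring)
    have hxz0 : (0 : ℝ) < z - x := by linarith
    have e1 : (z - y) / (z - x) * x + (y - x) / (z - x) * z = y := by field_simp; ring
    simp only [smul_eq_mul, e1] at hc
    have h5 := hright y ⟨le_rfl, hy.2.le⟩ hyz.ne
    have e2 : (z - y) / (z - x) * loss E m x + (y - x) / (z - x) * loss E m z =
        ((z - y) * loss E m x + (y - x) * loss E m z) / (z - x) := by field_simp
    rw [e2, div_le_iff₀ hxz0] at hc
    nlinarith

lemma IsTight.active (hE : E.Standing) (ht : IsTight E m) (hd : DoublyUnique E m)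
    (hy : y ∈ Ioo E.lo E.hi) (hz : bindingIC E m y = {z}) :
    loss E m z = m.eP y * z + (1 - m.eP y) * y ∨
      loss E m z - loss E m y - E.uA (m.eA y) = m.eP y * (z + E.tau) := by
  obtain ⟨x, hx, h⟩ := ht.exists_active hE (Ioo_subset_Icc_self hy) (ht.eA_mem_Ioo hE hd hy)
    (ht.eP_mem_Ioo hE hd hy).1
  rcases h with h | h
  · have := ht.no_refund_imp_eq hE hy hz hx h
    subst this; exact Or.inl h
  · have := ht.full_refund_imp_eq hE hy hz hx h
    subst this; exact Or.inr h

/-- The first-order condition at an interior type, in terms of the binding type. -/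
lemma IsTight.first_order (hE : E.Standing) (ht : IsTight E m) (hd : DoublyUnique E m)
    (hy : y ∈ Ioo E.lo E.hi) (hz : bindingIC E m y = {z}) {δ π ρ : ℝ}
    (h1 : loss E m z = m.eP y * z + (1 - m.eP y) * y → 0 < π)
    (h2 : loss E m z - loss E m y - E.uA (m.eA y) = m.eP y * (z + E.tau) →
      0 < π * (z + E.tau) + effDeriv E.uA (m.eA y) * δ)
    (hρ1 : 0 ≤ d1 E m y → -effDeriv E.uA (m.eA y) * δ ≤ ρ) (hρ2 : d1 E m y ≤ 0 → 0 ≤ ρ) :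
    0 ≤ ρ + ((effDeriv E.cA (m.eA y) + effDeriv E.uA (m.eA y) - E.cP (m.eP y)) * δ
      + marginalAudit E m y * π) := by
  have hyI := Ioo_subset_Icc_self hy
  obtain ⟨hyz, hzh⟩ := ht.lt_binding hE hd hy hz
  have e1 : y - loss E m y - E.uA (m.eA y) = d1 E m y := by unfold d1; ring
  refine first_order_nonneg hE ((ht.continuousOn_loss hE).mono (Icc_subset_Icc_left hyI.1))
    (effortFeasible_of_isMechanism hE ht.1 hyI) (fun _ _ h => ht.effortCost_le hE hyI h)
    (ht.eA_mem_Ioo hE hd hy) (eventually_ray_mem_Icc (ht.eP_mem_Ioo hE hd hy) π) ?_ ?_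
    (by rwa [e1]) (by rwa [e1])
  · intro x hx h
    have := ht.no_refund_imp_eq hE hy hz hx h
    subst this
    exact mul_pos (h1 h) (by linarith)
  · intro x hx h
    have := ht.full_refund_imp_eq hE hy hz hx h
    subst this
    exact h2 h

lemma IsTight.effDeriv_uA_pos (hE : E.Standing) (ht : IsTight E m) (hd : DoublyUnique E m)
    (hy : y ∈ Ioo E.lo E.hi) : 0 < effDeriv E.uA (m.eA y) :=
  have he := ht.eA_mem_Ioo hE hd hy
  hE.effDeriv_uA_pos ⟨he.1, he.2.le⟩

lemma IsTight.marginalAudit_pos (hE : E.Standing) (ht : IsTight E m) (hd : DoublyUnique E m)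
    (hy : y ∈ Ioo E.lo E.hi) : 0 < marginalAudit E m y := by
  have he := ht.eA_mem_Ioo hE hd hy
  have hp := ht.eP_mem_Ioo hE hd hy
  exact mul_pos (sub_pos.2 he.2) (hE.costP.effDeriv_pos ⟨hp.1, hp.2.le⟩)

/-! ### First-order bounds on the direct impact -/

lemma nonneg_of_forall_pos {a b : ℝ} (h : ∀ κ > 0, 0 ≤ a + b * κ) : 0 ≤ a := by
  have : Tendsto (fun κ : ℝ => a + b * κ) (𝓝[>] 0) (𝓝 a) := by
    have : Tendsto (fun κ : ℝ => a + b * κ) (𝓝 0) (𝓝 (a + b * 0)) :=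
      (continuous_const.add (continuous_const.mul continuous_id)).tendsto 0
    rw [mul_zero, add_zero] at this
    exact this.mono_left nhdsWithin_le_nhds
  exact ge_of_tendsto this (by filter_upwards [self_mem_nhdsWithin] with κ hκ using h κ hκ)

/-- Raising the agent's effort is always feasible up to an arbitrarily small extra audit `κ`, and it
never raises the refund, so `ρ = 0` is allowed. -/
lemma IsTight.neg_one_le_directImpact (hE : E.Standing) (ht : IsTight E m)
    (hd : DoublyUnique E m) (hy : y ∈ Ioo E.lo E.hi) : -1 ≤ directImpact E m y := by
  obtain ⟨z, hz⟩ := hd.1 y hy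
  have hu := ht.effDeriv_uA_pos hE hd hy
  obtain ⟨hyz, -⟩ := ht.lt_binding hE hd hy hz
  have hzt : 0 < z + E.tau := by linarith [hE.lo_nonneg, hE.tau_pos, hy.1]
  rw [directImpact, le_div_iff₀ hu]
  have := nonneg_of_forall_pos (b := marginalAudit E m y)
    (a := effDeriv E.cA (m.eA y) + effDeriv E.uA (m.eA y) - E.cP (m.eP y)) fun κ hκ => by
      have := ht.first_order hE hd hy hz (δ := 1) (π := κ) (ρ := 0) (fun _ => hκ)
        (fun _ => by nlinarith [mul_pos hκ hzt]) (fun _ => by linarith) (fun _ => le_rfl)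
      linarith
  linarith

/-- The agent's effort is lowered while audits rise just fast enough to preserve the full-refund
constraint at `z`. -/
lemma IsTight.directImpact_le (hE : E.Standing) (ht : IsTight E m)
    (hd : DoublyUnique E m) (hy : y ∈ Ioo E.lo E.hi) (hz : bindingIC E m y = {z}) :
    directImpact E m y ≤ marginalAudit E m y / (z + E.tau) := by
  have hu := ht.effDeriv_uA_pos hE hd hy
  obtain ⟨hyz, -⟩ := ht.lt_binding hE hd hy hz
  have hzt : 0 < z + E.tau := by linarith [hE.lo_nonneg, hE.tau_pos, hy.1]
  rw [directImpact, div_le_iff₀ hu]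
  have := nonneg_of_forall_pos (b := marginalAudit E m y / (z + E.tau))
    (a := marginalAudit E m y / (z + E.tau) * effDeriv E.uA (m.eA y) -
      (effDeriv E.cA (m.eA y) - E.cP (m.eP y))) fun κ hκ => by
      have := ht.first_order hE hd hy hz (δ := -1)
        (π := (effDeriv E.uA (m.eA y) + κ) / (z + E.tau)) (ρ := effDeriv E.uA (m.eA y))
        (fun _ => by positivity) (fun _ => by rw [div_mul_cancel₀ _ hzt.ne']; linarith)
        (fun _ => by linarith) (fun _ => hu.le)
      have e : marginalAudit E m y * ((effDeriv E.uA (m.eA y) + κ) / (z + E.tau)) =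
        marginalAudit E m y / (z + E.tau) * effDeriv E.uA (m.eA y) +
          marginalAudit E m y / (z + E.tau) * κ := by ring
      linarith
  linarith

/-- With the full-refund constraint slack, agent effort can be replaced by refunds without more
audits than an arbitrarily small `κ`. -/
lemma IsTight.directImpact_nonpos (hE : E.Standing) (ht : IsTight E m)
    (hd : DoublyUnique E m) (hy : y ∈ Ioo E.lo E.hi) (hz : bindingIC E m y = {z})
    (h : loss E m z - loss E m y - E.uA (m.eA y) ≠ m.eP y * (z + E.tau)) :
    directImpact E m y ≤ 0 := by
  have hu := ht.effDeriv_uA_pos hE hd hy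
  rw [directImpact, div_le_iff₀ hu]
  have := nonneg_of_forall_pos (b := marginalAudit E m y)
    (a := E.cP (m.eP y) - effDeriv E.cA (m.eA y)) fun κ hκ => by
      have := ht.first_order hE hd hy hz (δ := -1) (π := κ) (ρ := effDeriv E.uA (m.eA y))
        (fun _ => hκ) (fun h' => absurd h' h) (fun _ => by linarith) (fun _ => hu.le)
      linarith
  linarith

/-- When the information rent exceeds the evidence rent the refund is positive, so additional
evidence rent displaces refunds one for one. -/
lemma IsTight.directImpact_nonneg (hE : E.Standing) (ht : IsTight E m)
    (hd : DoublyUnique E m) (hy : y ∈ Ioo E.lo E.hi) (h : 0 < d1 E m y) :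
    0 ≤ directImpact E m y := by
  obtain ⟨z, hz⟩ := hd.1 y hy
  have hu := ht.effDeriv_uA_pos hE hd hy
  obtain ⟨hyz, -⟩ := ht.lt_binding hE hd hy hz
  have hzt : 0 < z + E.tau := by linarith [hE.lo_nonneg, hE.tau_pos, hy.1]
  rw [directImpact, le_div_iff₀ hu]
  have := nonneg_of_forall_pos (b := marginalAudit E m y)
    (a := effDeriv E.cA (m.eA y) - E.cP (m.eP y)) fun κ hκ => by
      have := ht.first_order hE hd hy hz (δ := 1) (π := κ) (ρ := -effDeriv E.uA (m.eA y))
        (fun _ => hκ) (fun _ => by nlinarith [mul_pos hκ hzt]) (fun _ => by linarith)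
        (fun h' => absurd h (not_lt.2 h'))
      linarith
  linarith

/-- With only the full-refund constraint possibly active, audits can fall as agent effort rises;
this reverses the direction used in `IsTight.directImpact_le`. -/
lemma IsTight.le_directImpact (hE : E.Standing) (ht : IsTight E m)
    (hd : DoublyUnique E m) (hy : y ∈ Ioo E.lo E.hi) (hz : bindingIC E m y = {z})
    (h1 : 0 < d1 E m y) (h : loss E m z ≠ m.eP y * z + (1 - m.eP y) * y) :
    marginalAudit E m y / (z + E.tau) ≤ directImpact E m y := by
  have hu := ht.effDeriv_uA_pos hE hd hy
  obtain ⟨hyz, -⟩ := ht.lt_binding hE hd hy hz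
  have hzt : 0 < z + E.tau := by linarith [hE.lo_nonneg, hE.tau_pos, hy.1]
  rw [directImpact, le_div_iff₀ hu]
  have := nonneg_of_forall_pos (b := marginalAudit E m y / (z + E.tau))
    (a := (effDeriv E.cA (m.eA y) - E.cP (m.eP y)) -
      marginalAudit E m y / (z + E.tau) * effDeriv E.uA (m.eA y)) fun κ hκ => by
      have := ht.first_order hE hd hy hz (δ := 1)
        (π := (-effDeriv E.uA (m.eA y) + κ) / (z + E.tau)) (ρ := -effDeriv E.uA (m.eA y))
        (fun h' => absurd h' h) (fun _ => by rw [div_mul_cancel₀ _ hzt.ne']; linarith)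
        (fun _ => by linarith) (fun h' => absurd h1 (not_lt.2 h'))
      have e : marginalAudit E m y * ((-effDeriv E.uA (m.eA y) + κ) / (z + E.tau)) =
        -(marginalAudit E m y / (z + E.tau) * effDeriv E.uA (m.eA y)) +
          marginalAudit E m y / (z + E.tau) * κ := by ring
      linarith
  linarith

/-- Types whose information rent is below their evidence rent. -/
lemma IsTight.directImpact_eq_neg_one (hE : E.Standing) (ht : IsTight E m)
    (hy : y ∈ Icc E.lo E.hi) (hp : 0 < m.eP y) (h : d1 E m y < 0) : directImpact E m y = -1 := by
  have hf := effortFeasible_of_isMechanism hE ht.1 hy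
  have hg : 0 < E.uA (m.eA y) - (y - loss E m y) := by unfold d1 at h; linarith
  have he0 : 0 < m.eA y := by
    refine lt_of_le_of_ne hf.agent.1 fun h0 => ?_
    rw [← h0, hE.uA_zero] at hg
    linarith [loss_le_self hE ht.1 hy]
  have he : m.eA y ∈ Ioo (0 : ℝ) 1 := ⟨he0, ht.eA_lt_one hE hy⟩
  have heI := Ioo_subset_Icc_self he
  have hu := hE.effDeriv_uA_pos ⟨he.1, he.2.le⟩
  -- For efforts near `eA y` the refund stays zero and the full-refund constraint follows from the
  -- no-refund one, so `eA y` is an unconstrained local minimizer. No binding type is needed, which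
  -- lets the result cover `lo`.
  have hnear : ∀ᶠ e in 𝓝 (m.eA y), y - loss E m y < E.uA e :=
    (hE.hasDerivAt_uA he).continuousAt.eventually_const_lt (by linarith)
  have hmin : IsLocalMin (fun e => e * effDeriv E.cA e + (1 - e) * E.cP (m.eP y)) (m.eA y) := by
    filter_upwards [hnear, Icc_mem_nhds he.1 he.2] with e h1 h2
    have hyt : 0 < y + E.tau := by linarith [hy.1, hE.lo_nonneg, hE.tau_pos]
    have := ht.effortCost_le hE hy (e := e) (p := m.eP y) ⟨h2, hf.principal, hf.no_refund,
      fun x hx => by nlinarith [hf.no_refund x hx, mul_pos hp hyt]⟩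
    unfold effortCost refund at this
    rw [max_eq_right (by linarith), max_eq_right (by linarith)] at this
    linarith
  have hder := hmin.hasDerivAt_eq_zero (((hasDerivAt_id (m.eA y)).mul
    (hE.costA.hasDerivAt_effDeriv he)).add
    (((hasDerivAt_id (m.eA y)).const_sub 1).mul_const (E.cP (m.eP y))))
  simp only [id] at hder
  rw [directImpact, div_eq_iff hu.ne', hE.effDeriv_uA heI]
  linarith

/-! ### The minimal audit probability and the indirect impact -/

lemma IsTight.alpha_le (hE : E.Standing) (ht : IsTight E m) (hy : y ∈ Icc E.lo E.hi) :
    alpha E m y ≤ m.eP y := by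
  have hf := effortFeasible_of_isMechanism hE ht.1 hy
  unfold alpha
  split_ifs with h
  · refine max_le hf.principal.1 (csSup_le ((nonempty_Ioc.2 h).image _) ?_)
    rintro _ ⟨x, hx, rfl⟩
    have := hf.no_refund x ⟨hx.1.le, hx.2⟩
    rw [div_le_iff₀ (sub_pos.2 hx.1)]
    linarith
  · exact hf.principal.1

lemma IsTight.le_alpha (hE : E.Standing) (ht : IsTight E m) (hy : y ∈ Icc E.lo E.hi) {x : ℝ}
    (hx : x ∈ Ioc y E.hi) : (loss E m x - y) / (x - y) ≤ alpha E m y := by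
  have hf := effortFeasible_of_isMechanism hE ht.1 hy
  rw [alpha, if_pos (hx.1.trans_le hx.2)]
  refine le_max_of_le_right (le_csSup ⟨m.eP y, ?_⟩ (mem_image_of_mem _ hx))
  rintro _ ⟨w, hw, rfl⟩
  have := hf.no_refund w ⟨hw.1.le, hw.2⟩
  rw [div_le_iff₀ (sub_pos.2 hw.1)]
  linarith

lemma IsTight.alpha_eq (hE : E.Standing) (ht : IsTight E m) (hd : DoublyUnique E m)
    (hy : y ∈ Ioo E.lo E.hi) (hz : bindingIC E m y = {z})
    (h : loss E m z = m.eP y * z + (1 - m.eP y) * y) : alpha E m y = m.eP y := by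
  have hyI := Ioo_subset_Icc_self hy
  obtain ⟨hyz, hzh⟩ := ht.lt_binding hE hd hy hz
  refine le_antisymm (ht.alpha_le hE hyI) ?_
  have := ht.le_alpha hE hyI ⟨hyz, hzh⟩
  rwa [h, show m.eP y * z + (1 - m.eP y) * y - y = m.eP y * (z - y) by ring,
    mul_div_cancel_right₀ _ (sub_pos.2 hyz).ne'] at this

/-- If the full refund after evidence is not exhausted then the audit probability is minimal. -/
lemma IsTight.not_full_refund (hE : E.Standing) (ht : IsTight E m) (hd : DoublyUnique E m)
    (hy : y ∈ Ioo E.lo E.hi) (hz : bindingIC E m y = {z})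
    (h : d1 E m y ≤ 0 ∨ d2 E m y < 0) :
    loss E m z - loss E m y - E.uA (m.eA y) ≠ m.eP y * (z + E.tau) := by
  have hyI := Ioo_subset_Icc_self hy
  obtain ⟨hyz, hzh⟩ := ht.lt_binding hE hd hy hz
  have hyt : 0 < y + E.tau := by linarith [hy.1, hE.lo_nonneg, hE.tau_pos]
  have h1 := (effortFeasible_of_isMechanism hE ht.1 hyI).no_refund z ⟨hyz.le, hzh⟩
  have h2 := mul_pos (ht.eP_mem_Ioo hE hd hy).1 hyt
  have h3 := mul_le_mul_of_nonneg_right (ht.alpha_le hE hyI) hyt.le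
  intro h4
  unfold d1 d2 at h
  rcases h with h | h <;> nlinarith

/-- An active no-refund constraint means `eP y = alpha y`, and then the full-refund constraint at
`z` is exactly `d2 ≤ 0`. -/
lemma IsTight.not_no_refund (hE : E.Standing) (ht : IsTight E m) (hd : DoublyUnique E m)
    (hy : y ∈ Ioo E.lo E.hi) (hz : bindingIC E m y = {z}) (h : 0 < d2 E m y) :
    loss E m z ≠ m.eP y * z + (1 - m.eP y) * y := by
  have hyI := Ioo_subset_Icc_self hy
  obtain ⟨hyz, hzh⟩ := ht.lt_binding hE hd hy hz
  intro h1
  have h2 := ht.alpha_eq hE hd hy hz h1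
  have h3 := (effortFeasible_of_isMechanism hE ht.1 hyI).full_refund z ⟨hyz.le, hzh⟩
  unfold d2 at h
  rw [h2] at h
  linarith

lemma IsTight.alpha_nonneg (y : ℝ) : 0 ≤ alpha E m y := by
  unfold alpha
  split_ifs
  · exact le_max_left _ _
  · exact le_rfl

lemma IsTight.alpha_pos (hE : E.Standing) (ht : IsTight E m) (hd : DoublyUnique E m)
    (hy : y ∈ Ioo E.lo E.hi) (h : d1 E m y ≤ 0) : 0 < alpha E m y := by
  obtain ⟨z, hz⟩ := hd.1 y hy
  have h1 := (ht.active hE hd hy hz).resolve_right (ht.not_full_refund hE hd hy hz (Or.inl h))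
  rw [ht.alpha_eq hE hd hy hz h1]
  exact (ht.eP_mem_Ioo hE hd hy).1

lemma d2_eq (E : Env) (m : Mech) (y : ℝ) :
    d2 E m y = d1 E m y - alpha E m y * (y + E.tau) := by
  unfold d1 d2
  ring

/-- A single formula for the indirect impact of all interior types. -/
lemma IsTight.indirectImpact_eq (hE : E.Standing) (ht : IsTight E m) (hd : DoublyUnique E m)
    {xhat : ℝ → ℝ} (hy : y ∈ Ioo E.lo E.hi) (hz : bindingIC E m y = {xhat y}) :
    indirectImpact E m xhat y =
      (marginalAudit E m y - (y + E.tau) * max (directImpact E m y) 0) / (xhat y - y) := by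
  have hyI := Ioo_subset_Icc_self hy
  have hmem : y ∈ interiorTypes E m := ⟨hyI, ht.eP_mem_Ioo hE hd hy⟩
  have hyt : 0 < y + E.tau := by linarith [hy.1, hE.lo_nonneg, hE.tau_pos]
  obtain ⟨hyz, hzh⟩ := ht.lt_binding hE hd hy hz
  have hα := IsTight.alpha_nonneg (E := E) (m := m) y
  have h12 := d2_eq E m y
  have hD1 := ht.directImpact_le hE hd hy hz
  have hlow : ∀ h : d1 E m y ≤ 0 ∨ d2 E m y < 0, max (directImpact E m y) 0 = 0 := fun h =>
    max_eq_right (ht.directImpact_nonpos hE hd hy hz (ht.not_full_refund hE hd hy hz h))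
  have hfirst : d1 E m y ≤ 0 ∨ d2 E m y < 0 → y ∈ SuperLow E m ∪ Low E m ∪ Middle E m →
      indirectImpact E m xhat y =
      (marginalAudit E m y - (y + E.tau) * max (directImpact E m y) 0) / (xhat y - y) := by
    intro h1 h2
    rw [indirectImpact, if_pos h2, hlow h1, mul_zero, sub_zero]
    rfl
  rcases lt_trichotomy (d1 E m y) 0 with h | h | h
  · exact hfirst (Or.inl h.le) (Or.inl (Or.inl ⟨hmem, h⟩))
  · refine hfirst (Or.inl h.le) (Or.inl (Or.inr ⟨hmem, ?_, h⟩))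
    have := mul_pos (ht.alpha_pos hE hd hy h.le) hyt
    linarith
  · have hD0 := ht.directImpact_nonneg hE hd hy h
    rcases lt_trichotomy (d2 E m y) 0 with h' | h' | h'
    · exact hfirst (Or.inr h') (Or.inr ⟨hmem, h', h⟩)
    · have h1 : y ∉ SuperLow E m ∪ Low E m ∪ Middle E m := by
        rintro ((h1 | h1) | h1)
        · exact absurd h1.2 (not_lt.2 h.le)
        · exact absurd h1.2.1 (not_lt.2 h'.ge)
        · exact absurd h1.2.1 (not_lt.2 h'.ge)
      rw [indirectImpact, if_neg h1, if_pos (show y ∈ High E m from ⟨hmem, h', h⟩), max_eq_left hD0,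
        sub_div, marginalAudit]
      ring
    · have h1 : y ∉ SuperLow E m ∪ Low E m ∪ Middle E m := by
        rintro ((h1 | h1) | h1)
        · exact absurd h1.2 (not_lt.2 h.le)
        · exact absurd h1.2.1 (not_lt.2 h'.le)
        · exact absurd h1.2.1 (not_lt.2 h'.le)
      have h2 : y ∉ High E m := fun h2 => h'.ne' h2.2.1
      -- Here `D = k / (z + tau)`, where `z = xhat y` and `k` is the marginal audit cost; with this
      -- value the general formula collapses to `k / (z + tau)`.
      rw [indirectImpact, if_neg h1, if_neg h2, if_pos (show y ∈ SuperHigh E m from ⟨hmem, h'⟩),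
        max_eq_left hD0, le_antisymm hD1 (ht.le_directImpact hE hd hy hz h
          (ht.not_no_refund hE hd hy hz h'))]
      change marginalAudit E m y / (xhat y + E.tau) = _
      have : xhat y + E.tau ≠ 0 := by linarith
      have : xhat y - y ≠ 0 := by linarith
      field_simp
      ring

/-- Positivity comes from `max D 0 ≤ k / (z + tau)` together with `y < z`, with `z = xhat y` and `k`
the marginal audit cost. Dropping the nonnegative correction and using `k ≤ c_P'(1)` gives the upper
bound. -/
lemma IsTight.indirectImpact_bounds (hE : E.Standing) (ht : IsTight E m) (hd : DoublyUnique E m)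
    {xhat : ℝ → ℝ} (hy : y ∈ Ioo E.lo E.hi) (hz : bindingIC E m y = {xhat y}) :
    0 < indirectImpact E m xhat y ∧
      indirectImpact E m xhat y ≤ effDeriv E.cP 1 / (xhat y - y) := by
  have hyt : 0 < y + E.tau := by linarith [hy.1, hE.lo_nonneg, hE.tau_pos]
  obtain ⟨hyz, hzh⟩ := ht.lt_binding hE hd hy hz
  have hk := ht.marginalAudit_pos hE hd hy
  have hzt : 0 < xhat y + E.tau := by linarith
  rw [ht.indirectImpact_eq hE hd hy hz]
  constructor
  · refine div_pos ?_ (sub_pos.2 hyz)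
    have h1 : max (directImpact E m y) 0 ≤ marginalAudit E m y / (xhat y + E.tau) :=
      max_le (ht.directImpact_le hE hd hy hz) (by positivity)
    have h2 : (y + E.tau) * (marginalAudit E m y / (xhat y + E.tau)) < marginalAudit E m y := by
      rw [← mul_div_assoc, div_lt_iff₀ hzt]
      nlinarith
    nlinarith
  · refine div_le_div_of_nonneg_right ?_ (sub_pos.2 hyz).le
    have he := ht.eA_mem_Ioo hE hd hy
    have hp := Ioo_subset_Icc_self (ht.eP_mem_Ioo hE hd hy)
    have h1 : marginalAudit E m y ≤ effDeriv E.cP 1 := by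
      unfold marginalAudit
      nlinarith [hE.costP.effDeriv_le_one hp, hE.costP.effDeriv_nonneg hp, he.1]
    nlinarith [le_max_right (directImpact E m y) 0]

end Interior

end TaxMech

namespace TaxMech

/-! ### Uniqueness and continuity of the optimal efforts -/

variable {E : Env} {m : Mech}

/-- The regularity assumption makes the cost convex along a binding full-refund constraint. -/
lemma strictConvexOn_full_refund_cost (hE : E.Standing) {C u k : ℝ} (hk0 : 0 ≤ k)
    (hk : k * (E.lo + E.tau) ≤ effDeriv E.cP 1) :
    StrictConvexOn ℝ (Icc (0 : ℝ) 1) (fun z => E.cA z + (1 - z) * (C + k * (u - E.uA z))) := by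
  have hd : ∀ z ∈ Ioo (0 : ℝ) 1,
      HasDerivAt (fun z => E.cA z + (1 - z) * (C + k * (u - E.uA z)))
        (effDeriv E.cA z + (-1 * (C + k * (u - E.uA z)) +
          (1 - z) * (k * -(z * effDeriv (effDeriv E.cA) z)))) z := fun z hz => by
    have h1 := (hE.hasDerivAt_uA hz)
    rw [hE.effDeriv_uA (Ioo_subset_Icc_self hz)] at h1
    exact (hE.costA.hasDerivAt hz).add (((hasDerivAt_id z).const_sub 1).mul
      (((h1.const_sub u).const_mul k).const_add C))
  have hd2 : ∀ z ∈ Ioo (0 : ℝ) 1,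
      HasDerivAt (fun z => effDeriv E.cA z + (-1 * (C + k * (u - E.uA z)) +
          (1 - z) * (k * -(z * effDeriv (effDeriv E.cA) z))))
        (effDeriv (effDeriv E.cA) z + (-1 * (k * -(z * effDeriv (effDeriv E.cA) z)) +
          (-1 * (k * -(z * effDeriv (effDeriv E.cA) z)) + (1 - z) * (k * -(1 *
            effDeriv (effDeriv E.cA) z + z * effDeriv (effDeriv (effDeriv E.cA)) z))))) z :=
    fun z hz => by
    have h1 := (hE.hasDerivAt_uA hz)
    rw [hE.effDeriv_uA (Ioo_subset_Icc_self hz)] at h1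
    have h2 : HasDerivAt (fun z => z * effDeriv (effDeriv E.cA) z) (1 *
        effDeriv (effDeriv E.cA) z + z * effDeriv (effDeriv (effDeriv E.cA)) z) z :=
      (hasDerivAt_id z).mul (hE.costA.hasDerivAt_effDeriv_effDeriv hz)
    exact (hE.costA.hasDerivAt_effDeriv hz).add
      (((((h1.const_sub u).const_mul k).const_add C).const_mul (-1)).add
        (((hasDerivAt_id z).const_sub 1).mul (h2.neg.const_mul k)))
  refine StrictMonoOn.strictConvexOn_of_deriv (convex_Icc 0 1) ?_ ?_
  · have h1 := hE.costA.continuousOn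
    have h2 := hE.continuousOn_uA
    fun_prop
  rw [interior_Icc]
  refine StrictMonoOn.congr ?_ (fun z hz => (hd z hz).deriv.symm)
  refine strictMonoOn_of_deriv_pos (convex_Ioo 0 1)
    (fun z hz => (hd2 z hz).continuousAt.continuousWithinAt) fun z hz => ?_
  rw [interior_Ioo] at hz
  rw [(hd2 z hz).deriv]
  have hc := hE.effDeriv_effDeriv_cA_pos ⟨hz.1, hz.2.le⟩
  have hcp := hE.costP.effDeriv_pos (e := 1) ⟨zero_lt_one, le_rfl⟩
  have hreg := hE.regularity z (Ioo_subset_Icc_self hz)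
  set c2 := effDeriv (effDeriv E.cA) z
  set c3 := effDeriv (effDeriv (effDeriv E.cA)) z
  set P := effDeriv E.cP 1
  -- The second derivative is `c2 + 2 * k * z * c2 - k * (1 - z) * (c2 + z * c3)`. Regularity times
  -- `k * c2` bounds the subtracted term by `c2 + k * z * c2`, strictly if `k > 0`; if `k = 0` only
  -- `c2 > 0` remains.
  have hq : k * ((E.lo + E.tau) / P) ≤ 1 := by
    rw [← mul_div_assoc, div_le_one hcp]; exact hk
  have h3 : k * ((1 - z) * (c2 + z * c3)) ≤ k * (c2 * ((E.lo + E.tau) / P + z)) := by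
    refine mul_le_mul_of_nonneg_left ?_ hk0
    have := mul_le_mul_of_nonneg_left hreg.le hc.le
    have e : c2 * (z * (1 - z) * (c3 / c2) + (1 - z)) = (1 - z) * (c2 + z * c3) := by
      field_simp; ring
    rwa [e] at this
  have h3' : k * ((1 - z) * (c2 + z * c3)) = k * (c2 * ((E.lo + E.tau) / P + z)) → k = 0 := by
    intro h
    by_contra hk'
    have h := mul_left_cancel₀ hk' h
    have := mul_lt_mul_of_pos_left hreg hc
    have e : c2 * (z * (1 - z) * (c3 / c2) + (1 - z)) = (1 - z) * (c2 + z * c3) := by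
      field_simp; ring
    rw [e] at this
    linarith
  have h4 : c2 * (k * ((E.lo + E.tau) / P)) ≤ c2 := by nlinarith
  have h5 : 0 ≤ k * z * c2 := mul_nonneg (mul_nonneg hk0 hz.1.le) hc.le
  have h6 : k * (c2 * ((E.lo + E.tau) / P + z)) =
    c2 * (k * ((E.lo + E.tau) / P)) + k * z * c2 := by ring
  rcases hk0.eq_or_lt with h | h
  · rw [← h]; simpa using hc
  · have h7 := lt_of_le_of_ne h3 (fun h' => h.ne' (h3' h'))
    nlinarith

lemma StrictConvexOn.map_midpoint_lt {f : ℝ → ℝ} {s : Set ℝ} (hf : StrictConvexOn ℝ s f)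
    {a b : ℝ} (ha : a ∈ s) (hb : b ∈ s) (hab : a ≠ b) : f ((a + b) / 2) < (f a + f b) / 2 := by
  have := hf.2 ha hb hab (by norm_num : (0 : ℝ) < 1 / 2) (by norm_num : (0 : ℝ) < 1 / 2)
    (by norm_num)
  simp only [smul_eq_mul] at this
  rw [show (a + b) / 2 = 1 / 2 * a + 1 / 2 * b by ring]
  linarith

/-- With the smallest audit probability that is feasible for the agent's effort `e`, either the
probability is below every one satisfying the no-refund constraints, or a full-refund constraint
binds. -/
lemma IsTight.exists_minimal_audit (hE : E.Standing) (ht : IsTight E m) {y e : ℝ}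
    (hy : y ∈ Icc E.lo E.hi) (he : e ∈ Icc (0 : ℝ) 1) :
    ∃ p, EffortFeasible E (loss E m) y e p ∧
      ((∀ e' p', EffortFeasible E (loss E m) y e' p' → p ≤ p') ∨
        ∃ x ∈ Icc y E.hi, loss E m x - loss E m y - E.uA e = p * (x + E.tau)) := by
  set S : Set ℝ := {p | EffortFeasible E (loss E m) y e p} with hS
  have hclosed : IsClosed S := by
    have : S = Icc 0 1 ∩ ((⋂ x ∈ Icc y E.hi, {p | loss E m x ≤ p * x + (1 - p) * y}) ∩
        ⋂ x ∈ Icc y E.hi, {p | loss E m x - loss E m y - E.uA e ≤ p * (x + E.tau)}) := by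
      ext p
      simp only [hS, mem_ofPred_eq, mem_inter_iff, mem_iInter]
      exact ⟨fun h => ⟨h.principal, h.no_refund, h.full_refund⟩,
        fun h => ⟨he, h.1, h.2.1, h.2.2⟩⟩
    rw [this]
    refine isClosed_Icc.inter (IsClosed.inter ?_ ?_)
    · exact isClosed_biInter fun x _ => isClosed_le continuous_const (by fun_prop)
    · exact isClosed_biInter fun x _ => isClosed_le continuous_const (by fun_prop)
  have hne : S.Nonempty := ⟨1, effortFeasible_one hE (ht.admissible_loss hE) hy he⟩
  have hbdd : BddBelow S := ⟨0, fun p hp => hp.principal.1⟩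
  have hmem : sInf S ∈ S := hclosed.csInf_mem hne hbdd
  refine ⟨sInf S, hmem, ?_⟩
  by_contra! hno
  obtain ⟨⟨e', p', hf', hlt⟩, hno2⟩ := hno
  have hcont := (ht.continuousOn_loss hE).mono (Icc_subset_Icc_left hy.1 (b := E.hi))
  -- If the infimum exceeds some feasible `p'` and no full-refund constraint binds, the audit
  -- probability can be lowered further, because the no-refund constraints do not involve the
  -- agent's effort.
  obtain ⟨κ, hκ, hk⟩ := exists_pos_eventually_forall_le (isCompact_Icc (a := y) (b := E.hi))
    (s := fun x => sInf S * (x + E.tau) - (loss E m x - loss E m y - E.uA e))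
    (w := fun x => -(x + E.tau)) (by fun_prop) (by fun_prop)
    (fun x hx => by linarith [hmem.full_refund x hx])
    (fun x hx h => absurd (by linarith) (hno2 x hx))
  obtain ⟨t, ht1, ht2⟩ := (hk.and (Ioo_mem_nhdsGT (sub_pos.2 hlt))).exists
  have : sInf S - t ∈ S := by
    refine ⟨he, ⟨by linarith [ht2.2, hf'.principal.1], by linarith [ht2.1, hmem.principal.2]⟩,
      fun x hx => ?_, fun x hx => ?_⟩
    · nlinarith [hf'.no_refund x hx, hx.1, ht2.2]
    · have := ht1 x hx
      nlinarith [mul_pos ht2.1 hκ]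
  linarith [csInf_le hbdd this, ht2.1]

/-- For two optimal pairs, the midpoint of the agent efforts with its minimal audit `q` would be
strictly cheaper. If `q` is at most both audits, strict convexity of the two branches of
`effortCost_eq` suffices. If a full-refund constraint binds, it bounds both costs below by a
function that regularity makes strictly convex. Once the agent's effort is known to be unique and
below `1`, strict monotonicity of `cP` pins down the audit. -/
lemma IsTight.effort_unique (hE : E.Standing) (ht : IsTight E m) {y e p : ℝ}
    (hy : y ∈ Icc E.lo E.hi) (hf : EffortFeasible E (loss E m) y e p)
    (hle : effortCost E (loss E m) y e p ≤ effortCost E (loss E m) y (m.eA y) (m.eP y)) :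
    e = m.eA y ∧ p = m.eP y := by
  have hfm := effortFeasible_of_isMechanism hE ht.1 hy
  have heq := le_antisymm hle (ht.effortCost_le hE hy hf)
  have hee : e = m.eA y := by
    by_contra hne
    set e2 := m.eA y
    set p2 := m.eP y
    have hc : (e + e2) / 2 ∈ Icc (0 : ℝ) 1 :=
      ⟨by linarith [hf.agent.1, hfm.agent.1], by linarith [hf.agent.2, hfm.agent.2]⟩
    obtain ⟨q, hfq, h⟩ := ht.exists_minimal_audit hE hy hc
    have hmin := ht.effortCost_le hE hy hfq
    rcases h with h | ⟨x, hx, h⟩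
    · have h1 := StrictConvexOn.map_midpoint_lt hE.costA.strictConvex hf.agent hfm.agent hne
      have h2 := StrictConvexOn.map_midpoint_lt hE.rent_regularity hf.agent hfm.agent hne
      have a1 := mul_le_mul_of_nonneg_left (hE.costP.strictMono.monotoneOn hfq.principal
        hf.principal (h e p hf)) (sub_nonneg.2 hf.agent.2)
      have a2 := mul_le_mul_of_nonneg_left (hE.costP.strictMono.monotoneOn hfq.principal
        hfm.principal (h e2 p2 hfm)) (sub_nonneg.2 hfm.agent.2)
      rw [effortCost_eq] at hmin heq
      rw [effortCost_eq] at hmin heq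
      have h3 : max (y - loss E m y + E.cA ((e + e2) / 2))
          ((e + e2) / 2 * effDeriv E.cA ((e + e2) / 2)) <
          (max (y - loss E m y + E.cA e) (e * effDeriv E.cA e) +
            max (y - loss E m y + E.cA e2) (e2 * effDeriv E.cA e2)) / 2 := by
        refine max_lt ?_ ?_
        · linarith [le_max_left (y - loss E m y + E.cA e) (e * effDeriv E.cA e),
            le_max_left (y - loss E m y + E.cA e2) (e2 * effDeriv E.cA e2)]
        · linarith [le_max_right (y - loss E m y + E.cA e) (e * effDeriv E.cA e),
            le_max_right (y - loss E m y + E.cA e2) (e2 * effDeriv E.cA e2)]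
      nlinarith
    · have hyt : 0 < y + E.tau := by linarith [hy.1, hE.lo_nonneg, hE.tau_pos]
      have hxt : 0 < x + E.tau := by linarith [hx.1]
      have hcq := hE.costP.effDeriv_nonneg hfq.principal
      have h1 := hfq.no_refund x hx
      have h2 := mul_nonneg hfq.principal.1 hyt.le
      have hk0 : 0 ≤ effDeriv E.cP q / (x + E.tau) := div_nonneg hcq hxt.le
      have hk : effDeriv E.cP q / (x + E.tau) * (E.lo + E.tau) ≤ effDeriv E.cP 1 := by
        rw [div_mul_eq_mul_div, div_le_iff₀ hxt]
        have := hE.costP.effDeriv_le_one hfq.principal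
        have := mul_le_mul this (show E.lo + E.tau ≤ x + E.tau by linarith [hx.1, hy.1])
          (by linarith [hE.lo_nonneg, hE.tau_pos]) (hcq.trans this)
        exact this
      -- Here `cP` is replaced by its tangent at `q`, and the audit by the least one that the
      -- binding constraint at `x` permits; the resulting lower bound is exact at the midpoint.
      have hΦ := StrictConvexOn.map_midpoint_lt (strictConvexOn_full_refund_cost hE
        (C := E.cP q) (u := E.uA ((e + e2) / 2)) hk0 hk) hf.agent hfm.agent hne
      have key : ∀ e' p', EffortFeasible E (loss E m) y e' p' → y - loss E m y + (E.cA e' +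
          (1 - e') * (E.cP q + effDeriv E.cP q / (x + E.tau) * (E.uA ((e + e2) / 2) - E.uA e')))
          ≤ effortCost E (loss E m) y e' p' := by
        intro e' p' hf'
        rw [effortCost_eq, ← add_assoc]
        refine add_le_add (le_max_left _ _)
          (mul_le_mul_of_nonneg_left ?_ (sub_nonneg.2 hf'.agent.2))
        have h3 := hE.costP.tangent_le hfq.principal hf'.principal
        have h4 : (E.uA ((e + e2) / 2) - E.uA e') / (x + E.tau) ≤ p' - q := by
          rw [div_le_iff₀ hxt]
          linarith [hf'.full_refund x hx]
        have h5 := mul_le_mul_of_nonneg_left h4 hcq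
        have h6 : effDeriv E.cP q / (x + E.tau) * (E.uA ((e + e2) / 2) - E.uA e') =
          effDeriv E.cP q * ((E.uA ((e + e2) / 2) - E.uA e') / (x + E.tau)) := by ring
        linarith
      have k1 := key e p hf
      have k2 := key e2 p2 hfm
      have k3 : effortCost E (loss E m) y ((e + e2) / 2) q = y - loss E m y +
          (E.cA ((e + e2) / 2) + (1 - (e + e2) / 2) * E.cP q) := by
        have hu : E.uA ((e + e2) / 2) = (e + e2) / 2 * effDeriv E.cA ((e + e2) / 2) -
          E.cA ((e + e2) / 2) := rfl
        rw [effortCost, refund, max_eq_left (by nlinarith)]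
        linarith
      simp only [sub_self, mul_zero, add_zero] at hΦ
      linarith
  refine ⟨hee, ?_⟩
  rw [hee] at heq
  have h1 := sub_pos.2 (ht.eA_lt_one hE hy)
  unfold effortCost at heq
  have h2 : (1 - m.eA y) * E.cP p = (1 - m.eA y) * E.cP (m.eP y) := by linarith
  exact hE.costP.strictMono.injOn hf.principal hfm.principal (mul_left_cancel₀ h1.ne' h2)

/-- The efforts at `y`, with more audits, remain feasible at nearby types. -/
lemma IsTight.eventually_effortFeasible (hE : E.Standing) (ht : IsTight E m)
    (hd : DoublyUnique E m) {y t : ℝ} (hy : y ∈ Ioo E.lo E.hi) (ht0 : 0 < t)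
    (ht1 : m.eP y + t ≤ 1) :
    ∀ᶠ w in 𝓝 y, EffortFeasible E (loss E m) w (m.eA y) (m.eP y + t) := by
  have hyI := Ioo_subset_Icc_self hy
  have hf := effortFeasible_of_isMechanism hE ht.1 hyI
  have hyl := ht.loss_lt_self hE hd ⟨hy.1, hy.2.le⟩
  have hcont := (ht.continuousOn_loss hE).mono (Icc_subset_Icc_left hyI.1 (b := E.hi))
  obtain ⟨x0, hx0, hmin⟩ := (isCompact_Icc (a := y) (b := E.hi)).exists_isMinOn
    (nonempty_Icc.2 hyI.2)
    (show ContinuousOn (fun x => (m.eP y + t) * x + (1 - (m.eP y + t)) * y - loss E m x)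
      (Icc y E.hi) by fun_prop)
  set κ := (m.eP y + t) * x0 + (1 - (m.eP y + t)) * y - loss E m x0 with hκdef
  have hκ : 0 < κ := by
    rcases hx0.1.eq_or_lt with h | h
    · rw [hκdef, ← h]; linarith
    · have := hf.no_refund x0 hx0
      have := mul_pos ht0 (sub_pos.2 h)
      rw [hκdef]; linarith
  have htτ := mul_pos ht0 hE.tau_pos
  have hp0 : 0 ≤ m.eP y := hf.principal.1
  filter_upwards [Icc_mem_nhds (show y - κ < y by linarith) (show y < y + κ by linarith),
    Icc_mem_nhds (show y - t * E.tau / 2 < y by linarith)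
      (show y < y + t * E.tau / 2 by linarith), Ioo_mem_nhds hy.1 hy.2] with w h1 h2 hw
  have hwI := Ioo_subset_Icc_self hw
  refine ⟨hf.agent, ⟨by linarith, ht1⟩, fun x hx => ?_, fun x hx => ?_⟩
  -- When `w < y`, the constraints at `w` also involve types `x < y`, for which nothing is known at
  -- `y`; they are compared with `max x y` by monotonicity of the loss.
  · have hx' : max x y ∈ Icc y E.hi := ⟨le_max_right _ _, max_le hx.2 hyI.2⟩
    have a1 := hmin hx'
    change κ ≤ _ at a1
    have a2 := ht.monotoneOn_loss hE ⟨hwI.1.trans hx.1, hx.2⟩ ⟨hyI.1.trans hx'.1, hx'.2⟩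
      (le_max_left x y)
    simp only at a1
    rcases le_total x y with h | h
    · rw [max_eq_right h] at a1 a2
      nlinarith [hx.1, h1.1]
    · rw [max_eq_left h] at a1
      nlinarith [h1.1, h1.2]
  · have hx' : max x y ∈ Icc y E.hi := ⟨le_max_right _ _, max_le hx.2 hyI.2⟩
    have a1 := hf.full_refund _ hx'
    have a2 := ht.monotoneOn_loss hE ⟨hwI.1.trans hx.1, hx.2⟩ ⟨hyI.1.trans hx'.1, hx'.2⟩
      (le_max_left x y)
    have hx0 : 0 ≤ x := hE.lo_nonneg.trans (hwI.1.trans hx.1)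
    have a3 : loss E m y - loss E m w ≤ t * E.tau / 2 := by
      rcases le_total y w with h | h
      · linarith [ht.monotoneOn_loss hE hyI hwI h]
      · linarith [ht.loss_sub_le hE hwI.1 h hyI.2, h2.1]
    have a4 : m.eP y * max x y ≤ m.eP y * x + t * E.tau / 2 := by
      rcases le_total x y with h | h
      · rw [max_eq_right h]
        nlinarith [hx.1, h2.1, hf.principal.2]
      · rw [max_eq_left h]; linarith
    nlinarith

lemma tendsto_effortCost {ι : Type*} {l : Filter ι} {lam : ℝ → ℝ} {y e p : ι → ℝ}
    {y0 e0 p0 : ℝ} (hE : E.Standing) (hlam : Tendsto (fun i => lam (y i)) l (𝓝 (lam y0)))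
    (hy : Tendsto y l (𝓝 y0)) (he : Tendsto e l (𝓝 e0)) (hp : Tendsto p l (𝓝 p0))
    (heI : ∀ᶠ i in l, e i ∈ Icc (0 : ℝ) 1) (hpI : ∀ᶠ i in l, p i ∈ Icc (0 : ℝ) 1)
    (he0 : e0 ∈ Icc (0 : ℝ) 1) (hp0 : p0 ∈ Icc (0 : ℝ) 1) :
    Tendsto (fun i => effortCost E lam (y i) (e i) (p i)) l (𝓝 (effortCost E lam y0 e0 p0)) := by
  have he' : Tendsto e l (𝓝[Icc 0 1] e0) := tendsto_nhdsWithin_iff.2 ⟨he, heI⟩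
  have hp' : Tendsto p l (𝓝[Icc 0 1] p0) := tendsto_nhdsWithin_iff.2 ⟨hp, hpI⟩
  have h1 := (hE.continuousOn_uA e0 he0).tendsto.comp he'
  have h2 := (hE.costA.continuousOn_effDeriv e0 he0).tendsto.comp he'
  have h3 := (hE.costP.continuousOn p0 hp0).tendsto.comp hp'
  exact ((((hy.sub hlam).sub h1).max tendsto_const_nhds).add (he.mul h2)).add
    ((tendsto_const_nhds.sub he).mul h3)

/-- Every cluster point of nearby efforts is feasible at `y` and no costlier than the optimum there,
so uniqueness identifies it and compactness yields convergence. -/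
lemma IsTight.tendsto_efforts (hE : E.Standing) (ht : IsTight E m) (hd : DoublyUnique E m)
    {y : ℝ} (hy : y ∈ Ioo E.lo E.hi) :
    Tendsto (fun w => (m.eA w, m.eP w)) (𝓝 y) (𝓝 (m.eA y, m.eP y)) := by
  have hyI := Ioo_subset_Icc_self hy
  have hf := effortFeasible_of_isMechanism hE ht.1 hyI
  have hpI := ht.eP_mem_Ioo hE hd hy
  have hnear : ∀ᶠ w in 𝓝 y, w ∈ Ioo E.lo E.hi := Ioo_mem_nhds hy.1 hy.2
  have hfw : ∀ᶠ w in 𝓝 y, EffortFeasible E (loss E m) w (m.eA w) (m.eP w) :=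
    hnear.mono fun w hw => effortFeasible_of_isMechanism hE ht.1 (Ioo_subset_Icc_self hw)
  have hlc : ContinuousAt (loss E m) y := (ht.continuousOn_loss hE).continuousAt
    (Icc_mem_nhds hy.1 hy.2)
  refine IsCompact.tendsto_nhds_of_unique_mapClusterPt
    ((isCompact_Icc (a := (0 : ℝ)) (b := 1)).prod (isCompact_Icc (a := (0 : ℝ)) (b := 1)))
    (hfw.mono fun w hw => ⟨hw.agent, hw.principal⟩) ?_
  rintro ⟨e, p⟩ ⟨heI, hpI'⟩ hcl
  simp only at heI hpI'
  obtain ⟨U, hU, hlim⟩ := mapClusterPt_iff_ultrafilter.1 hcl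
  have hy' : Tendsto (fun w : ℝ => w) U (𝓝 y) := hU
  have hl' : Tendsto (fun w => loss E m w) U (𝓝 (loss E m y)) := hlc.tendsto.comp hy'
  have he' : Tendsto (fun w => m.eA w) U (𝓝 e) := (continuous_fst.tendsto _).comp hlim
  have hp' : Tendsto (fun w => m.eP w) U (𝓝 p) := (continuous_snd.tendsto _).comp hlim
  have hfU := hfw.filter_mono hU
  have hu' : Tendsto (fun w => E.uA (m.eA w)) U (𝓝 (E.uA e)) :=
    (hE.continuousOn_uA e heI).tendsto.comp
      (tendsto_nhdsWithin_iff.2 ⟨he', hfU.mono fun w hw => hw.agent⟩)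
  have hlt : ∀ x, y < x → ∀ᶠ w in (U : Filter ℝ), w < x := fun x hx =>
    hy'.eventually_lt_const hx
  have hfeas : EffortFeasible E (loss E m) y e p := by
    refine ⟨heI, hpI', fun x hx => ?_, fun x hx => ?_⟩
    · rcases hx.1.eq_or_lt with h | h
      · subst h
        linarith [loss_le_self hE ht.1 hyI]
      · refine le_of_tendsto_of_tendsto tendsto_const_nhds
          ((hp'.mul_const x).add ((tendsto_const_nhds.sub hp').mul hy')) ?_
        filter_upwards [hfU, hlt x h] with w h1 h2 using h1.no_refund x ⟨h2.le, hx.2⟩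
    · rcases hx.1.eq_or_lt with h | h
      · subst h
        have := mul_nonneg hpI'.1
          (show 0 ≤ y + E.tau by linarith [hyI.1, hE.lo_nonneg, hE.tau_pos])
        linarith [hE.uA_nonneg heI]
      · refine le_of_tendsto_of_tendsto ((tendsto_const_nhds.sub hl').sub hu')
          (hp'.mul_const _) ?_
        filter_upwards [hfU, hlt x h] with w h1 h2 using h1.full_refund x ⟨h2.le, hx.2⟩
  have hcost : effortCost E (loss E m) y e p ≤
      effortCost E (loss E m) y (m.eA y) (m.eP y) := by
    have hc1 := tendsto_effortCost hE hl' hy' he' hp' (hfU.mono fun w hw => hw.agent)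
      (hfU.mono fun w hw => hw.principal) heI hpI'
    -- The optimal pair at `y` may be infeasible at nearby types, so it is used as a competitor only
    -- after adding a little auditing `t`, which then tends to `0`.
    have hstep : ∀ t ∈ Ioo 0 (1 - m.eP y), effortCost E (loss E m) y e p ≤
        effortCost E (loss E m) y (m.eA y) (m.eP y + t) := by
      intro t htI
      have hpt : m.eP y + t ∈ Icc (0 : ℝ) 1 :=
        ⟨by linarith [htI.1, hpI.1], by linarith [htI.2]⟩
      have hc2 := tendsto_effortCost (l := (U : Filter ℝ)) hE hl' hy'
        (tendsto_const_nhds (x := m.eA y)) (tendsto_const_nhds (x := m.eP y + t))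
        (Eventually.of_forall fun _ => hf.agent) (Eventually.of_forall fun _ => hpt) hf.agent hpt
      refine le_of_tendsto_of_tendsto hc1 hc2 ?_
      filter_upwards [(ht.eventually_effortFeasible hE hd hy htI.1
        (by linarith [htI.2])).filter_mono hU, hnear.filter_mono hU] with w h1 h2
      exact ht.effortCost_le hE (Ioo_subset_Icc_self h2) h1
    have hc3 : Tendsto (fun t => effortCost E (loss E m) y (m.eA y) (m.eP y + t)) (𝓝[>] 0)
        (𝓝 (effortCost E (loss E m) y (m.eA y) (m.eP y))) := by
      have h0 : Tendsto (fun t : ℝ => m.eP y + t) (𝓝[>] 0) (𝓝 (m.eP y)) := by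
        have : Tendsto (fun t : ℝ => m.eP y + t) (𝓝 0) (𝓝 (m.eP y + 0)) :=
          (continuous_const.add continuous_id).tendsto 0
        rw [add_zero] at this
        exact this.mono_left nhdsWithin_le_nhds
      exact tendsto_effortCost hE tendsto_const_nhds tendsto_const_nhds tendsto_const_nhds h0
        (Eventually.of_forall fun _ => hf.agent)
        (h0.eventually (Icc_mem_nhds hpI.1 hpI.2)) hf.agent hf.principal
    refine ge_of_tendsto hc3 ?_
    filter_upwards [Ioo_mem_nhdsGT (sub_pos.2 hpI.2)] with t h using hstep t h
  obtain ⟨h1, h2⟩ := ht.effort_unique hE hyI hfeas hcost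
  rw [h1, h2]

lemma IsTight.continuousAt_eA (hE : E.Standing) (ht : IsTight E m) (hd : DoublyUnique E m)
    {y : ℝ} (hy : y ∈ Ioo E.lo E.hi) : ContinuousAt m.eA y :=
  (continuous_fst.tendsto _).comp (ht.tendsto_efforts hE hd hy)

lemma IsTight.continuousAt_eP (hE : E.Standing) (ht : IsTight E m) (hd : DoublyUnique E m)
    {y : ℝ} (hy : y ∈ Ioo E.lo E.hi) : ContinuousAt m.eP y :=
  (continuous_snd.tendsto _).comp (ht.tendsto_efforts hE hd hy)

/-! ### The binding type -/

lemma DoublyUnique.bindingIC_eq (hd : DoublyUnique E m) {xhat : ℝ → ℝ}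
    (hx : ∀ y ∈ Ioo E.lo E.hi, xhat y ∈ bindingIC E m y) {y : ℝ} (hy : y ∈ Ioo E.lo E.hi) :
    bindingIC E m y = {xhat y} := by
  obtain ⟨z, hz⟩ := hd.1 y hy
  have := hx y hy
  rw [hz] at this ⊢
  rw [show xhat y = z from this]

section Binding

variable {xhat : ℝ → ℝ}

/-- `xhat y` is the unique maximizer of `loss x - eP y * x` over a compact set not depending on `y`,
and `eP` is continuous. -/
lemma IsTight.continuousAt_xhat (hE : E.Standing) (ht : IsTight E m) (hd : DoublyUnique E m)
    (hx : ∀ y ∈ Ioo E.lo E.hi, xhat y ∈ bindingIC E m y) {y : ℝ} (hy : y ∈ Ioo E.lo E.hi) :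
    ContinuousAt xhat y := by
  have hnear : ∀ᶠ w in 𝓝 y, w ∈ Ioo E.lo E.hi := Ioo_mem_nhds hy.1 hy.2
  refine IsCompact.tendsto_nhds_of_unique_mapClusterPt (isCompact_Icc (a := E.lo) (b := E.hi))
    (hnear.mono fun w hw => ⟨hw.1.le.trans (hx w hw).1.1, (hx w hw).1.2⟩) ?_
  intro z hz hcl
  obtain ⟨U, hU, hlim⟩ := mapClusterPt_iff_ultrafilter.1 hcl
  have hzU : Tendsto xhat U (𝓝 z) := hlim
  have hpU : Tendsto m.eP U (𝓝 (m.eP y)) := (ht.continuousAt_eP hE hd hy).tendsto.comp hU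
  have hnU := hnear.filter_mono hU
  have hzU' : Tendsto xhat U (𝓝[Icc E.lo E.hi] z) := tendsto_nhdsWithin_iff.2
    ⟨hzU, hnU.mono fun w hw => ⟨hw.1.le.trans (hx w hw).1.1, (hx w hw).1.2⟩⟩
  have hlU := (ht.continuousOn_loss hE z hz).tendsto.comp hzU'
  by_contra hne
  have hyx := hx y hy
  have h1 := ht.sub_lt_of_ne_binding hE hd hy (hd.bindingIC_eq hx hy) hz hne
  refine absurd h1 (not_lt.2 ?_)
  refine le_of_tendsto_of_tendsto (tendsto_const_nhds.sub (hpU.mul_const (xhat y)))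
    (hlU.sub (hpU.mul hzU)) ?_
  filter_upwards [hnU] with w hw
  have hyI : xhat y ∈ Icc E.lo E.hi := ⟨hy.1.le.trans hyx.1.1, hyx.1.2⟩
  rcases eq_or_ne (xhat y) (xhat w) with h | h
  · simp only [Function.comp, h, le_refl]
  · exact (ht.sub_lt_of_ne_binding hE hd hw (hd.bindingIC_eq hx hw) hyI h).le

/-- If `xhat b < c < xhat a` with `a < b`, the value `c` is attained on `[a, b]`, and again on `[b,
c]` because `xhat c > c`. Uniqueness of the type bound by `c` forces both points to be `b`, which is
absurd. -/
lemma IsTight.monotoneOn_xhat (hE : E.Standing) (ht : IsTight E m) (hd : DoublyUnique E m)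
    (hx : ∀ y ∈ Ioo E.lo E.hi, xhat y ∈ bindingIC E m y) :
    MonotoneOn xhat (Ioo E.lo E.hi) := by
  intro a ha b hb hab
  by_contra! hlt
  have hab' : a < b := lt_of_le_of_ne hab fun h => by rw [h] at hlt; exact lt_irrefl _ hlt
  have hbx := (ht.lt_binding hE hd hb (hd.bindingIC_eq hx hb)).1
  have hah := (hx a ha).1.2
  have hcont : ContinuousOn xhat (Ioo E.lo E.hi) := fun y hy =>
    (ht.continuousAt_xhat hE hd hx hy).continuousWithinAt
  obtain ⟨c, hc1, hc2⟩ := exists_between hlt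
  have hcI : c ∈ Ioo E.lo E.hi := ⟨by linarith [hb.1], by linarith⟩
  obtain ⟨w1, hw1, e1⟩ := intermediate_value_Icc' hab
    (hcont.mono (Icc_subset_Ioo ha.1 hb.2)) ⟨hc1.le, hc2.le⟩
  have hbc : b < c := hbx.trans hc1
  have hcx := (ht.lt_binding hE hd hcI (hd.bindingIC_eq hx hcI)).1
  obtain ⟨w2, hw2, e2⟩ := intermediate_value_Icc hbc.le
    (hcont.mono (Icc_subset_Ioo hb.1 hcI.2)) ⟨hc1.le, hcx.le⟩
  have hw1I : w1 ∈ Ioo E.lo E.hi := ⟨ha.1.trans_le hw1.1, hw1.2.trans_lt hb.2⟩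
  have hw2I : w2 ∈ Ioo E.lo E.hi := ⟨hb.1.trans_le hw2.1, hw2.2.trans_lt hcI.2⟩
  have : w1 = w2 := hd.2 c hcI w1 hw1I w2 hw2I (e1 ▸ hx w1 hw1I) (e2 ▸ hx w2 hw2I)
  have hwb : w1 = b := le_antisymm hw1.2 (this ▸ hw2.1)
  rw [hwb] at e1
  linarith

end Binding

end TaxMech

namespace TaxMech

/-! ### Mechanisms with measurable profit for perturbed targets -/

variable {E : Env} {m : Mech}

lemma isCompact_effortFeasible (hE : E.Standing) {lam : ℝ → ℝ}
    (hlam : ContinuousOn lam (Icc E.lo E.hi)) :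
    IsCompact {q : ℝ × ℝ × ℝ | q.1 ∈ Icc E.lo E.hi ∧ EffortFeasible E lam q.1 q.2.1 q.2.2} := by
  set B : Set (ℝ × ℝ × ℝ) := Icc E.lo E.hi ×ˢ Icc (0 : ℝ) 1 ×ˢ Icc (0 : ℝ) 1 with hB
  have hBc : IsCompact B := isCompact_Icc.prod (isCompact_Icc.prod isCompact_Icc)
  have h1 : ContinuousOn (fun q : ℝ × ℝ × ℝ => lam q.1) B :=
    hlam.comp continuousOn_fst fun q hq => hq.1
  have h2 : ContinuousOn (fun q : ℝ × ℝ × ℝ => E.uA q.2.1) B :=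
    hE.continuousOn_uA.comp (by fun_prop) fun q hq => hq.2.1
  -- Indexing constraints by `max x y` for all `x` in the type space removes the dependence of the
  -- index set on `y`, so the feasible set is an intersection of closed sets.
  have h3 : ∀ x ∈ Icc E.lo E.hi, ContinuousOn (fun q : ℝ × ℝ × ℝ => lam (max x q.1)) B :=
    fun x hx => hlam.comp (by fun_prop) fun q hq =>
      ⟨hx.1.trans (le_max_left _ _), max_le hx.2 hq.1.2⟩
  have : {q : ℝ × ℝ × ℝ | q.1 ∈ Icc E.lo E.hi ∧ EffortFeasible E lam q.1 q.2.1 q.2.2} =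
      B ∩ ⋂ x ∈ Icc E.lo E.hi,
        (B ∩ (fun q : ℝ × ℝ × ℝ => q.2.2 * max x q.1 + (1 - q.2.2) * q.1 - lam (max x q.1)) ⁻¹'
          Ici 0) ∩
        (B ∩ (fun q : ℝ × ℝ × ℝ => q.2.2 * (max x q.1 + E.tau) -
          (lam (max x q.1) - lam q.1 - E.uA q.2.1)) ⁻¹' Ici 0) := by
    ext ⟨y, e, p⟩
    simp only [mem_ofPred_eq, mem_inter_iff, mem_iInter, mem_preimage, mem_Ici, sub_nonneg]
    constructor
    · rintro ⟨hy, hf⟩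
      have hb : (y, e, p) ∈ B := ⟨hy, hf.agent, hf.principal⟩
      refine ⟨hb, fun x hx => ⟨⟨hb, ?_⟩, hb, ?_⟩⟩
      · exact hf.no_refund _ ⟨le_max_right _ _, max_le hx.2 hy.2⟩
      · exact hf.full_refund _ ⟨le_max_right _ _, max_le hx.2 hy.2⟩
    · rintro ⟨hb, h⟩
      refine ⟨hb.1, hb.2.1, hb.2.2, fun x hx => ?_, fun x hx => ?_⟩
      · have := (h x ⟨hb.1.1.trans hx.1, hx.2⟩).1.2
        rwa [max_eq_left hx.1] at this
      · have := (h x ⟨hb.1.1.trans hx.1, hx.2⟩).2.2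
        rwa [max_eq_left hx.1] at this
  rw [this]
  refine hBc.inter_right (isClosed_biInter fun x hx => IsClosed.inter ?_ ?_)
  · have h4 : ContinuousOn (fun q : ℝ × ℝ × ℝ => q.2.2 * max x q.1 + (1 - q.2.2) * q.1) B := by
      fun_prop
    exact (h4.sub (h3 x hx)).preimage_isClosed_of_isClosed hBc.isClosed isClosed_Ici
  · have h4 : ContinuousOn (fun q : ℝ × ℝ × ℝ => q.2.2 * (max x q.1 + E.tau)) B := by fun_prop
    exact (h4.sub (((h3 x hx).sub h1).sub h2)).preimage_isClosed_of_isClosed hBc.isClosed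
      isClosed_Ici

lemma continuousOn_effortCost (hE : E.Standing) {lam : ℝ → ℝ}
    (hlam : ContinuousOn lam (Icc E.lo E.hi)) :
    ContinuousOn (fun q : ℝ × ℝ × ℝ => effortCost E lam q.1 q.2.1 q.2.2)
      (Icc E.lo E.hi ×ˢ Icc (0 : ℝ) 1 ×ˢ Icc (0 : ℝ) 1) := by
  set B : Set (ℝ × ℝ × ℝ) := Icc E.lo E.hi ×ˢ Icc (0 : ℝ) 1 ×ˢ Icc (0 : ℝ) 1 with hB
  have h1 : ContinuousOn (fun q : ℝ × ℝ × ℝ => lam q.1) B :=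
    hlam.comp continuousOn_fst fun q hq => hq.1
  have h2 : ContinuousOn (fun q : ℝ × ℝ × ℝ => E.uA q.2.1) B :=
    hE.continuousOn_uA.comp (by fun_prop) fun q hq => hq.2.1
  have h3 : ContinuousOn (fun q : ℝ × ℝ × ℝ => effDeriv E.cA q.2.1) B :=
    hE.costA.continuousOn_effDeriv.comp (by fun_prop) fun q hq => hq.2.1
  have h4 : ContinuousOn (fun q : ℝ × ℝ × ℝ => E.cP q.2.2) B :=
    hE.costP.continuousOn.comp (by fun_prop) fun q hq => hq.2.2
  have h5 : ContinuousOn (fun q : ℝ × ℝ × ℝ => q.1) B := by fun_prop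
  have h6 : ContinuousOn (fun q : ℝ × ℝ × ℝ => q.2.1) B := by fun_prop
  exact ((((h5.sub h1).sub h2).sup continuousOn_const).add (h6.mul h3)).add
    ((continuousOn_const.sub h6).mul h4)

/-- An admissible continuous target is implemented at pointwise minimal cost by a mechanism with
measurable profit. -/
lemma exists_mechanism_measurableProfit (hE : E.Standing) {lam : ℝ → ℝ}
    (hlam : ContinuousOn lam (Icc E.lo E.hi)) (hadm : Admissible E lam) :
    ∃ m', IsMechanism E m' ∧ MeasurableProfit E m' ∧ ∀ y ∈ Icc E.lo E.hi, ∀ e p,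
      EffortFeasible E lam y e p → y - effortCost E lam y e p ≤ profit E m' y := by
  set T : Set (ℝ × ℝ × ℝ) :=
    {q | q.1 ∈ Icc E.lo E.hi ∧ EffortFeasible E lam q.1 q.2.1 q.2.2} with hT
  have hTc : IsCompact T := isCompact_effortFeasible hE hlam
  have hcost : ContinuousOn (fun q : ℝ × ℝ × ℝ => effortCost E lam q.1 q.2.1 q.2.2) T :=
    (continuousOn_effortCost hE hlam).mono fun q hq => ⟨hq.1, hq.2.agent, hq.2.principal⟩
  have hex : ∀ y, ∃ e p, y ∈ Icc E.lo E.hi → EffortFeasible E lam y e p ∧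
      ∀ e' p', EffortFeasible E lam y e' p' →
        effortCost E lam y e p ≤ effortCost E lam y e' p' := by
    intro y
    by_cases hy : y ∈ Icc E.lo E.hi
    · have hc : IsCompact (T ∩ {q | q.1 = y}) :=
        hTc.inter_right (isClosed_eq continuous_fst continuous_const)
      have h1 := effortFeasible_one hE hadm hy (e := 0) (left_mem_Icc.2 zero_le_one)
      obtain ⟨⟨y', e, p⟩, ⟨hq, rfl⟩, hmin⟩ := hc.exists_isMinOn ⟨(y, 0, 1), ⟨hy, h1⟩, rfl⟩
        (hcost.mono inter_subset_left)
      exact ⟨e, p, fun _ => ⟨hq.2, fun e' p' hf' => hmin (a := (y', e', p')) ⟨⟨hy, hf'⟩, rfl⟩⟩⟩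
    · exact ⟨0, 0, fun h => absurd h hy⟩
  choose e p hep using hex
  obtain ⟨m', hm', h'⟩ := exists_mechanism hE hadm fun y hy => (hep y hy).1
  refine ⟨m', hm', ?_, fun y hy e' p' hf' => ?_⟩
  · have hK : Measurable (fun y : Icc E.lo E.hi => effortCost E lam y (e y) (p y)) := by
      -- Sublevel sets of the minimal cost are projections of compact sets, hence closed. The profit
      -- is therefore measurable although the chosen minimizers need not be.
      refine measurable_of_Iic fun c => IsClosed.measurableSet ?_
      have hcl : IsClosed (Prod.fst '' (T ∩ (fun q : ℝ × ℝ × ℝ =>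
          effortCost E lam q.1 q.2.1 q.2.2) ⁻¹' Iic c)) :=
        ((hTc.of_isClosed_subset (hcost.preimage_isClosed_of_isClosed hTc.isClosed isClosed_Iic)
          inter_subset_left).image continuous_fst).isClosed
      convert hcl.preimage continuous_subtype_val using 1
      ext ⟨y, hy⟩
      simp only [mem_preimage, mem_Iic, mem_image, mem_inter_iff, Prod.exists]
      constructor
      · intro h
        exact ⟨y, e y, p y, ⟨⟨hy, (hep y hy).1⟩, h⟩, rfl⟩
      · rintro ⟨y', e', p', ⟨⟨_, hf'⟩, h⟩, rfl⟩
        exact ((hep y' hy).2 e' p' hf').trans h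
    have : (fun y : Icc E.lo E.hi => profit E m' y) =
        fun y : Icc E.lo E.hi => (y : ℝ) - effortCost E lam y (e y) (p y) :=
      funext fun y => (h' y y.2).2
    rw [MeasurableProfit, this]
    exact measurable_subtype_coe.sub hK
  · rw [(h' y hy).2]
    linarith [(hep y hy).2 e' p' hf']

lemma integrableOn_profit (hE : E.Standing) (F : Measure ℝ) [IsFiniteMeasure F]
    (hm : IsMechanism E m) (hp : MeasurableProfit E m) :
    IntegrableOn (profit E m) (Icc E.lo E.hi) F := by
  have hmeas : AEStronglyMeasurable (profit E m) (F.restrict (Icc E.lo E.hi)) :=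
    (aemeasurable_restrict_of_measurable_subtype measurableSet_Icc hp).aestronglyMeasurable
  refine Integrable.of_bound hmeas (E.hi + 2 * E.tau + E.cP 1) ?_
  refine (ae_restrict_iff' measurableSet_Icc).2 (Eventually.of_forall fun y hy => ?_)
  obtain ⟨ha, hpp, -, hP, h0⟩ := hm.1 y hy
  have h1 : m.RNA y ≤ y + E.tau := by
    unfold Mech.RNA
    nlinarith [mul_le_mul_of_nonneg_left hP.2 hpp.1,
      mul_le_mul_of_nonneg_left h0.2 (sub_nonneg.2 hpp.2)]
  have h2 : 0 ≤ m.RNA y :=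
    add_nonneg (mul_nonneg hpp.1 hP.1) (mul_nonneg (sub_nonneg.2 hpp.2) h0.1)
  have h3 := (hE.costA.effDeriv_le_one ha).trans hE.budget.1
  have h4 := hE.costA.effDeriv_nonneg ha
  have h5 : m.eA y * effDeriv E.cA (m.eA y) ≤ E.tau := by nlinarith [ha.1, ha.2]
  have h5' := mul_nonneg ha.1 h4
  have h6 := hE.costP.nonneg hpp
  have h7 := hE.costP.le_one hpp
  have h8 : (1 - m.eA y) * E.cP (m.eP y) ≤ E.cP 1 := by nlinarith [ha.1]
  have h8' := mul_nonneg (sub_nonneg.2 ha.2) h6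
  have h9 : profit E m y = y - m.RNA y - m.eA y * effDeriv E.cA (m.eA y) -
      (1 - m.eA y) * E.cP (m.eP y) := by unfold profit Env.uA; ring
  rw [Real.norm_eq_abs, abs_le, h9]
  constructor <;> linarith [hy.1, hy.2, hE.lo_nonneg, hE.tau_pos, h6.trans h7]

/-- A perturbation of the loss of a tight optimal mechanism cannot lower the expected cost to
first order. -/
lemma integral_variation_nonneg (hE : E.Standing) {F : Measure ℝ} [IsFiniteMeasure F]
    (ht : IsTight E m) (hopt : IsOptimal E F m) {eta ψ : ℝ → ℝ} {C : ℝ}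
    (heta : ContinuousOn eta (Icc E.lo E.hi))
    (hadm : ∀ᶠ t in 𝓝[>] (0 : ℝ), Admissible E fun x => loss E m x + t * eta x)
    (hbound : ∀ᶠ t in 𝓝[>] (0 : ℝ), ∀ y ∈ Icc E.lo E.hi, ∃ e p,
      EffortFeasible E (fun x => loss E m x + t * eta x) y e p ∧
      effortCost E (fun x => loss E m x + t * eta x) y e p ≤
        effortCost E (loss E m) y (m.eA y) (m.eP y) + t * C)
    (hψ : ∀ᵐ y ∂F.restrict (Icc E.lo E.hi), ∀ κ > 0, ∀ᶠ t in 𝓝[>] (0 : ℝ), ∃ e p,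
      EffortFeasible E (fun x => loss E m x + t * eta x) y e p ∧
      effortCost E (fun x => loss E m x + t * eta x) y e p ≤
        effortCost E (loss E m) y (m.eA y) (m.eP y) + t * (ψ y + κ))
    (hψi : IntegrableOn ψ (Icc E.lo E.hi) F) :
    0 ≤ ∫ y in Icc E.lo E.hi, ψ y ∂F := by
  have hM : ∀ t : ℝ, ∃ M, Admissible E (fun x => loss E m x + t * eta x) →
      IsMechanism E M ∧ MeasurableProfit E M ∧ ∀ y ∈ Icc E.lo E.hi, ∀ e p,
        EffortFeasible E (fun x => loss E m x + t * eta x) y e p →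
          y - effortCost E (fun x => loss E m x + t * eta x) y e p ≤ profit E M y := by
    intro t
    by_cases h : Admissible E fun x => loss E m x + t * eta x
    · obtain ⟨M, hM⟩ := exists_mechanism_measurableProfit hE
        ((ht.continuousOn_loss hE).add (continuousOn_const.mul heta)) h
      exact ⟨M, fun _ => hM⟩
    · exact ⟨m, fun h' => absurd h' h⟩
  choose M hM using hM
  set μ := F.restrict (Icc E.lo E.hi) with hμ
  -- Only upper bounds on the cost quotients are available. Taking the maximum with `ψ` supplies the
  -- missing lower bound, so dominated convergence applies, and it can only increase the integral,
  -- which optimality makes nonnegative.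
  have hlim : Tendsto (fun t => ∫ y, max ((profit E m y - profit E (M t) y) / t) (ψ y) ∂μ)
      (𝓝[>] (0 : ℝ)) (𝓝 (∫ y, ψ y ∂μ)) := by
    refine tendsto_integral_filter_of_dominated_convergence (fun y => |C| + |ψ y|) ?_ ?_ ?_ ?_
    · filter_upwards [hadm] with t h
      have h1 := (integrableOn_profit hE F ht.1 hopt.2.1).aestronglyMeasurable
      have h2 := (integrableOn_profit hE F (hM t h).1 (hM t h).2.1).aestronglyMeasurable
      exact ((h1.sub h2).mul_const t⁻¹).sup hψi.aestronglyMeasurable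
    · filter_upwards [hadm, hbound, self_mem_nhdsWithin] with t h hb ht0
      refine (ae_restrict_iff' measurableSet_Icc).2 (Eventually.of_forall fun y hy => ?_)
      obtain ⟨e, p, hf, hc⟩ := hb y hy
      have h1 := (hM t h).2.2 y hy e p hf
      rw [Real.norm_eq_abs, abs_le]
      have h2 : (profit E m y - profit E (M t) y) / t ≤ C := by
        rw [div_le_iff₀ ht0, ht.profit_eq hE hy]
        linarith
      refine ⟨?_, max_le ?_ ?_⟩
      · linarith [le_max_right ((profit E m y - profit E (M t) y) / t) (ψ y),
          neg_abs_le (ψ y), abs_nonneg C]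
      · linarith [le_abs_self C, abs_nonneg (ψ y)]
      · linarith [abs_nonneg C, le_abs_self (ψ y)]
    · exact (integrable_const _).add hψi.abs
    · filter_upwards [hψ, ae_restrict_mem measurableSet_Icc] with y hy hyI
      rw [Metric.tendsto_nhds]
      intro κ hκ
      filter_upwards [hadm, hy (κ / 2) (by linarith), self_mem_nhdsWithin] with t h ⟨e, p, hf, hc⟩
        ht0
      have h1 := (hM t h).2.2 y hyI e p hf
      have h2 : (profit E m y - profit E (M t) y) / t ≤ ψ y + κ / 2 := by
        rw [div_le_iff₀ ht0, ht.profit_eq hE hyI]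
        linarith
      rw [Real.dist_eq, abs_lt]
      constructor
      · linarith [le_max_right ((profit E m y - profit E (M t) y) / t) (ψ y)]
      · have : max ((profit E m y - profit E (M t) y) / t) (ψ y) ≤ ψ y + κ / 2 :=
          max_le h2 (by linarith)
        linarith
  refine ge_of_tendsto hlim ?_
  filter_upwards [hadm, self_mem_nhdsWithin] with t h ht0
  have i1 := integrableOn_profit hE F ht.1 hopt.2.1
  have i2 := integrableOn_profit hE F (hM t h).1 (hM t h).2.1
  have h1 := hopt.2.2 (M t) (hM t h).1 (hM t h).2.1
  have i3 : Integrable (fun y => (profit E m y - profit E (M t) y) / t) μ :=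
    (i1.sub i2).div_const t
  have h2 : 0 ≤ ∫ y, (profit E m y - profit E (M t) y) / t ∂μ := by
    rw [integral_div, integral_sub i1 i2]
    exact div_nonneg (sub_nonneg.2 h1) (le_of_lt ht0)
  exact h2.trans (integral_mono i3 (i3.sup hψi) fun y => le_max_left _ _)

/-! ### The first variation at interior types -/

section Interior

variable {y z : ℝ} {eta : ℝ → ℝ}

lemma IsTight.variation (hE : E.Standing) (ht : IsTight E m) (hd : DoublyUnique E m)
    (heta : ContinuousOn eta (Icc E.lo E.hi))
    (hy : y ∈ Ioo E.lo E.hi) (hz : bindingIC E m y = {z}) (δ π ρ : ℝ) {κ : ℝ}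
    (h1 : loss E m z = m.eP y * z + (1 - m.eP y) * y → eta z < π * (z - y))
    (h2 : loss E m z - loss E m y - E.uA (m.eA y) = m.eP y * (z + E.tau) →
      eta z - eta y < π * (z + E.tau) + effDeriv E.uA (m.eA y) * δ)
    (hρ1 : 0 ≤ d1 E m y → -eta y - effDeriv E.uA (m.eA y) * δ ≤ ρ)
    (hρ2 : d1 E m y ≤ 0 → 0 ≤ ρ) {v : ℝ}
    (hv : ρ + ((effDeriv E.cA (m.eA y) + effDeriv E.uA (m.eA y) - E.cP (m.eP y)) * δ
      + marginalAudit E m y * π) < v + κ) :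
    ∀ᶠ t in 𝓝[>] (0 : ℝ), ∃ e p,
      EffortFeasible E (fun x => loss E m x + t * eta x) y e p ∧
      effortCost E (fun x => loss E m x + t * eta x) y e p ≤
        effortCost E (loss E m) y (m.eA y) (m.eP y) + t * (v + κ) := by
  have hyI := Ioo_subset_Icc_self hy
  obtain ⟨hyz, hzh⟩ := ht.lt_binding hE hd hy hz
  have e1 : y - loss E m y - E.uA (m.eA y) = d1 E m y := by unfold d1; ring
  have := eventually_effortFeasible_and_effortCost_le hE (δ := δ) (π := π) (ρ := ρ)
    ((ht.continuousOn_loss hE).mono (Icc_subset_Icc_left hyI.1))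
    (heta.mono (Icc_subset_Icc_left hyI.1))
    (effortFeasible_of_isMechanism hE ht.1 hyI)
    (ht.eA_mem_Ioo hE hd hy) (eventually_ray_mem_Icc (ht.eP_mem_Ioo hE hd hy) π)
    (fun x hx h => by
      have := ht.no_refund_imp_eq hE hy hz hx h
      subst this
      exact h1 h)
    (fun x hx h => by
      have := ht.full_refund_imp_eq hE hy hz hx h
      subst this
      exact h2 h)
    (by rwa [e1]) (by rwa [e1]) (sub_pos.2 hv)
  filter_upwards [this] with t h
  refine ⟨_, _, h.1, h.2.trans (le_of_eq ?_)⟩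
  unfold marginalAudit
  ring

/-- The derivative of the minimal cost at an interior type when the loss moves in the direction
`eta`, in terms of the direct and the indirect impact. -/
lemma IsTight.variation_impact (hE : E.Standing) (ht : IsTight E m) (hd : DoublyUnique E m)
    {xhat : ℝ → ℝ} (heta : ContinuousOn eta (Icc E.lo E.hi)) (hy : y ∈ Ioo E.lo E.hi)
    (hz : bindingIC E m y = {xhat y}) {κ : ℝ} (hκ : 0 < κ) :
    ∀ᶠ t in 𝓝[>] (0 : ℝ), ∃ e p,
      EffortFeasible E (fun x => loss E m x + t * eta x) y e p ∧
      effortCost E (fun x => loss E m x + t * eta x) y e p ≤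
        effortCost E (loss E m) y (m.eA y) (m.eP y) +
          t * (indirectImpact E m xhat y * eta (xhat y)
            - (1 + directImpact E m y) * eta y + κ) := by
  have hyt : 0 < y + E.tau := by linarith [hy.1, hE.lo_nonneg, hE.tau_pos]
  obtain ⟨hyz, -⟩ := ht.lt_binding hE hd hy hz
  rw [ht.indirectImpact_eq hE hd hy hz]
  set z := xhat y
  have hzy : 0 < z - y := sub_pos.2 hyz
  have hzt : 0 < z + E.tau := by linarith
  have hk := ht.marginalAudit_pos hE hd hy
  have hu := ht.effDeriv_uA_pos hE hd hy
  set k := marginalAudit E m y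
  have hD : effDeriv E.cA (m.eA y) - E.cP (m.eP y) =
    directImpact E m y * effDeriv E.uA (m.eA y) := by
      rw [directImpact, div_mul_cancel₀ _ hu.ne']
  set D := directImpact E m y
  set u := effDeriv E.uA (m.eA y)
  obtain ⟨θ, hθ, hkθ⟩ : ∃ θ > 0, k * θ < κ :=
    ⟨κ / (2 * k), by positivity, by field_simp; linarith⟩
  have hπ : eta z < (eta z / (z - y) + θ) * (z - y) := by
    rw [add_mul, div_mul_cancel₀ _ hzy.ne']
    linarith [mul_pos hθ hzy]
  -- Each interval gets its own response. `π` follows the active constraint, with `θ` making it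
  -- strict at a cost covered by `κ`. The agent's effort is fixed except at Low, where it keeps the
  -- information and evidence rents equal to first order, and at High.
  rcases lt_trichotomy (d1 E m y) 0 with h | h | h
  · have hf := ht.not_full_refund hE hd hy hz (Or.inl h.le)
    have hD1 : D = -1 :=
      ht.directImpact_eq_neg_one hE (Ioo_subset_Icc_self hy) (ht.eP_mem_Ioo hE hd hy).1 h
    refine ht.variation hE hd heta hy hz 0 (eta z / (z - y) + θ) 0 (fun _ => hπ)
      (fun h' => absurd h' hf) (fun h' => absurd h (not_lt.2 h')) (fun _ => le_rfl) ?_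
    rw [hD1, max_eq_right (by norm_num)]
    have : k * (eta z / (z - y) + θ) = (k - (y + E.tau) * 0) / (z - y) * eta z + k * θ := by ring
    linarith
  · have hf := ht.not_full_refund hE hd hy hz (Or.inl h.le)
    have hD0 : D ≤ 0 := ht.directImpact_nonpos hE hd hy hz hf
    refine ht.variation hE hd heta hy hz (-eta y / u) (eta z / (z - y) + θ) 0 (fun _ => hπ)
      (fun h' => absurd h' hf) (fun _ => by change -eta y - u * (-eta y / u) ≤ 0; field_simp; simp)
      (fun _ => le_rfl) ?_
    rw [max_eq_right hD0]
    have e1 : k * (eta z / (z - y) + θ) = (k - (y + E.tau) * 0) / (z - y) * eta z + k * θ := by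
      ring
    have e2 : (effDeriv E.cA (m.eA y) + u - E.cP (m.eP y)) * (-eta y / u) =
        -((1 + D) * eta y) := by
      rw [show effDeriv E.cA (m.eA y) + u - E.cP (m.eP y) = (1 + D) * u by linarith]
      field_simp
    rw [e1, e2]
    linarith
  have hD0 : 0 ≤ D := ht.directImpact_nonneg hE hd hy h
  rcases lt_trichotomy (d2 E m y) 0 with h' | h' | h'
  · have hf := ht.not_full_refund hE hd hy hz (Or.inr h')
    have hD1 : D = 0 := le_antisymm (ht.directImpact_nonpos hE hd hy hz hf) hD0
    refine ht.variation hE hd heta hy hz 0 (eta z / (z - y) + θ) (-eta y) (fun _ => hπ)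
      (fun h' => absurd h' hf) (fun _ => by simp) (fun h' => absurd h (not_lt.2 h')) ?_
    rw [hD1, max_self]
    have : k * (eta z / (z - y) + θ) = (k - (y + E.tau) * 0) / (z - y) * eta z + k * θ := by ring
    linarith
  -- At High both constraints may be active: `π` follows the no-refund constraint, and `δ` is chosen
  -- so that the full-refund constraint then holds as well, the refund moving at rate `(y + tau) *
  -- π`.
  · refine ht.variation hE hd heta hy hz ((-eta y - (y + E.tau) * (eta z / (z - y) + θ)) / u)
      (eta z / (z - y) + θ) ((y + E.tau) * (eta z / (z - y) + θ)) (fun _ => hπ) (fun _ => ?_)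
      (fun _ => ?_) (fun h' => absurd h (not_lt.2 h')) ?_
    · rw [mul_div_cancel₀ _ hu.ne']
      linarith
    · rw [mul_div_cancel₀ _ hu.ne']
      linarith
    · rw [max_eq_left hD0]
      have e2 : (effDeriv E.cA (m.eA y) + u - E.cP (m.eP y)) *
          ((-eta y - (y + E.tau) * (eta z / (z - y) + θ)) / u) =
          (1 + D) * (-eta y - (y + E.tau) * (eta z / (z - y) + θ)) := by
        rw [show effDeriv E.cA (m.eA y) + u - E.cP (m.eP y) = (1 + D) * u by linarith]
        field_simp
      rw [e2]
      have e3 : (k - (y + E.tau) * D) / (z - y) * eta z =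
        (k - (y + E.tau) * D) * (eta z / (z - y)) := by ring
      rw [e3]
      have := mul_nonneg (mul_nonneg hyt.le hD0) hθ.le
      linarith
  · have hn := ht.not_no_refund hE hd hy hz h'
    have hD1 : D = k / (z + E.tau) :=
      le_antisymm (ht.directImpact_le hE hd hy hz) (ht.le_directImpact hE hd hy hz h hn)
    refine ht.variation hE hd heta hy hz 0 ((eta z - eta y) / (z + E.tau) + θ) (-eta y)
      (fun h' => absurd h' hn) (fun _ => ?_) (fun _ => by simp)
      (fun h' => absurd h (not_lt.2 h')) ?_
    · rw [add_mul, div_mul_cancel₀ _ hzt.ne']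
      linarith [mul_pos hθ hzt]
    · rw [max_eq_left hD0, hD1]
      have e1 : (k - (y + E.tau) * (k / (z + E.tau))) / (z - y) = k / (z + E.tau) := by
        field_simp; ring
      rw [e1]
      have e2 : k * ((eta z - eta y) / (z + E.tau) + θ) =
        k / (z + E.tau) * eta z - k / (z + E.tau) * eta y + k * θ := by ring
      linarith

end Interior

end TaxMech

namespace TaxMech

/-! ### Test functions -/

variable {E : Env} {m : Mech}

/-- Perturbing the loss above `c` costs at most a constant times the size of the perturbation. -/
lemma IsTight.exists_perturbation_bound (hE : E.Standing) (ht : IsTight E m)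
    (hd : DoublyUnique E m) {c : ℝ} (hc : c ∈ Ioo E.lo E.hi) :
    ∃ C, ∀ eta : ℝ → ℝ, (∀ x ∈ Icc E.lo E.hi, |eta x| ≤ 1) →
      (∀ x ∈ Icc E.lo E.hi, x < c → eta x = 0) → ∀ᶠ t in 𝓝[>] (0 : ℝ),
        Admissible E (fun x => loss E m x + t * eta x) ∧ ∀ y ∈ Icc E.lo E.hi, ∃ e p,
          EffortFeasible E (fun x => loss E m x + t * eta x) y e p ∧
          effortCost E (fun x => loss E m x + t * eta x) y e p ≤
            effortCost E (loss E m) y (m.eA y) (m.eP y) + t * C := by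
  have hG := sub_pos.2 (ht.loss_lt_self hE hd ⟨hc.1, hc.2.le⟩)
  set G := c - loss E m c with hGdef
  have hgap : ∀ x ∈ Icc c E.hi, G ≤ x - loss E m x := fun x hx => by
    have := ht.loss_sub_le hE hc.1.le hx.1 hx.2
    rw [hGdef]; linarith
  have hτ := hE.tau_pos
  -- The term `2 / G` repairs the no-refund constraints when `x - y ≥ G / 2`; for closer `x ≥ c` the
  -- gap `G` leaves them slack. The term `2 / tau` repairs the full-refund ones, where the target
  -- moves by at most `2 * t`.
  set C0 := 2 / G + 2 / E.tau with hC0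
  have hC0G : 1 ≤ C0 * (G / 2) := by
    rw [hC0, add_mul, div_mul_div_comm, mul_comm 2 G, div_self (by positivity)]
    linarith [show 0 ≤ 2 / E.tau * (G / 2) by positivity]
  have hC0τ : 2 ≤ C0 * E.tau := by
    rw [hC0, add_mul, div_mul_cancel₀ _ hτ.ne']
    linarith [show 0 ≤ 2 / G * E.tau by positivity]
  have hC0p : 0 < C0 := by positivity
  refine ⟨1 + effDeriv E.cP 1 * C0, fun eta h1 h0 => ?_⟩
  have hslack : 0 < E.tau - E.cA 1 := sub_pos.2 hE.cA_one_lt_tau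
  filter_upwards [Ioo_mem_nhdsGT (show 0 < G / 2 by linarith), Ioo_mem_nhdsGT hslack]
    with t htG hts
  have ht0 : 0 < t := htG.1
  have heta : ∀ x ∈ Icc E.lo E.hi, -t ≤ t * eta x ∧ t * eta x ≤ t := fun x hx => by
    have := abs_le.1 (h1 x hx)
    constructor <;> nlinarith
  have hadm : Admissible E (fun x => loss E m x + t * eta x) := by
    intro x hx
    refine ⟨?_, ?_⟩
    · rcases lt_or_ge x c with h | h
      · simpa [h0 x hx h] using loss_le_self hE ht.1 hx
      · linarith [hgap x ⟨h, hx.2⟩, (heta x hx).2, htG.2]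
    · linarith [ht.lo_le_loss hE hx, (heta x hx).1, hts.2, hE.lo_nonneg]
  refine ⟨hadm, fun y hy => ?_⟩
  have hf := effortFeasible_of_isMechanism hE ht.1 hy
  have hfeas : EffortFeasible E (fun x => loss E m x + t * eta x) y (m.eA y)
      (min 1 (m.eP y + C0 * t)) := by
    rcases min_cases 1 (m.eP y + C0 * t) with h | h
    · rw [h.1]
      exact effortFeasible_one hE hadm hy hf.agent
    rw [h.1]
    have hCt := mul_pos hC0p ht0
    refine ⟨hf.agent, ⟨by linarith [hf.principal.1], h.2.le⟩, fun x hx => ?_, fun x hx => ?_⟩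
    · have hxI : x ∈ Icc E.lo E.hi := ⟨hy.1.trans hx.1, hx.2⟩
      have a1 := hf.no_refund x hx
      have a2 := mul_nonneg hCt.le (sub_nonneg.2 hx.1)
      have a3 := mul_nonneg (add_nonneg hf.principal.1 hCt.le) (sub_nonneg.2 hx.1)
      rcases lt_or_ge x c with hxc | hxc
      · rw [h0 x hxI hxc]; linarith
      · rcases le_or_gt (G / 2) (x - y) with hxy | hxy
        · have a4 := mul_le_mul_of_nonneg_left hxy hC0p.le
          nlinarith [(heta x hxI).2]
        · linarith [hgap x ⟨hxc, hx.2⟩, (heta x hxI).2, htG.2]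
    · have hxI : x ∈ Icc E.lo E.hi := ⟨hy.1.trans hx.1, hx.2⟩
      have a1 := hf.full_refund x hx
      have a2 := mul_nonneg hCt.le (hE.lo_nonneg.trans hxI.1)
      have a3 := mul_le_mul_of_nonneg_right hC0τ ht0.le
      nlinarith [(heta x hxI).2, (heta y hy).1]
  refine ⟨_, _, hfeas, ?_⟩
  have hmin0 : m.eP y ≤ min 1 (m.eP y + C0 * t) :=
    le_min hf.principal.2 (by linarith [mul_pos hC0p ht0])
  have hP : E.cP (min 1 (m.eP y + C0 * t)) - E.cP (m.eP y) ≤ effDeriv E.cP 1 * (C0 * t) := by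
    have a1 := hE.costP.tangent_le hfeas.principal hf.principal
    have a2 := hE.costP.effDeriv_le_one hfeas.principal
    have a3 := hE.costP.effDeriv_nonneg hfeas.principal
    have a4 : min 1 (m.eP y + C0 * t) - m.eP y ≤ C0 * t := by
      linarith [min_le_right 1 (m.eP y + C0 * t)]
    have a5 := mul_le_mul a2 a4 (sub_nonneg.2 hmin0) (a3.trans a2)
    linarith
  have hQ : (1 - m.eA y) * (E.cP (min 1 (m.eP y + C0 * t)) - E.cP (m.eP y)) ≤
      effDeriv E.cP 1 * (C0 * t) := by
    have a1 := sub_nonneg.2 (hE.costP.strictMono.monotoneOn hf.principal hfeas.principal hmin0)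
    nlinarith [hf.agent.1]
  have hR : refund E (fun x => loss E m x + t * eta x) y (m.eA y) ≤
      refund E (loss E m) y (m.eA y) + t := by
    unfold refund
    refine max_le ?_ ?_
    · linarith [le_max_left (y - loss E m y - E.uA (m.eA y)) 0, (heta y hy).1]
    · linarith [le_max_right (y - loss E m y - E.uA (m.eA y)) 0]
  unfold effortCost
  linarith

/-! ### Continuity of the impacts and their balance on intervals -/

section Continuity

variable {xhat : ℝ → ℝ}

lemma IsTight.continuousOn_directImpact (hE : E.Standing) (ht : IsTight E m)
    (hd : DoublyUnique E m) : ContinuousOn (directImpact E m) (Ioo E.lo E.hi) := by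
  intro y hy
  have he := ht.eA_mem_Ioo hE hd hy
  have hp := ht.eP_mem_Ioo hE hd hy
  have cA := ht.continuousAt_eA hE hd hy
  have cP := ht.continuousAt_eP hE hd hy
  have h1 : ContinuousAt (fun y => effDeriv E.cA (m.eA y)) y :=
    (hE.costA.continuousOn_effDeriv.continuousAt (Icc_mem_nhds he.1 he.2)).comp' cA
  have h2 : ContinuousAt (fun y => effDeriv E.uA (m.eA y)) y :=
    (hE.continuousOn_effDeriv_uA.continuousAt (Icc_mem_nhds he.1 he.2)).comp' cA
  have h3 : ContinuousAt (fun y => E.cP (m.eP y)) y :=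
    (hE.costP.continuousOn.continuousAt (Icc_mem_nhds hp.1 hp.2)).comp' cP
  exact ((h1.sub h3).div h2 (ht.effDeriv_uA_pos hE hd hy).ne').continuousWithinAt

lemma IsTight.continuousOn_xhat (hE : E.Standing) (ht : IsTight E m) (hd : DoublyUnique E m)
    (hx : ∀ y ∈ Ioo E.lo E.hi, xhat y ∈ bindingIC E m y) :
    ContinuousOn xhat (Ioo E.lo E.hi) :=
  fun _ hy => (ht.continuousAt_xhat hE hd hx hy).continuousWithinAt

lemma IsTight.continuousOn_indirectImpact (hE : E.Standing) (ht : IsTight E m)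
    (hd : DoublyUnique E m) (hx : ∀ y ∈ Ioo E.lo E.hi, xhat y ∈ bindingIC E m y) :
    ContinuousOn (indirectImpact E m xhat) (Ioo E.lo E.hi) := by
  have hk : ContinuousOn (marginalAudit E m) (Ioo E.lo E.hi) := by
    intro y hy
    have hp := ht.eP_mem_Ioo hE hd hy
    have h1 : ContinuousAt (fun y => effDeriv E.cP (m.eP y)) y :=
      (hE.costP.continuousOn_effDeriv.continuousAt (Icc_mem_nhds hp.1 hp.2)).comp'
        (ht.continuousAt_eP hE hd hy)
    exact ((continuousAt_const.sub (ht.continuousAt_eA hE hd hy)).mul h1).continuousWithinAt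
  have hD := ht.continuousOn_directImpact hE hd
  have hxc := ht.continuousOn_xhat hE hd hx
  refine ContinuousOn.congr (f := fun y => (marginalAudit E m y -
    (y + E.tau) * max (directImpact E m y) 0) / (xhat y - y)) ?_
    fun y hy => ht.indirectImpact_eq hE hd hy (hd.bindingIC_eq hx hy)
  refine ContinuousOn.div (hk.sub ((continuousOn_id.add continuousOn_const).mul
    (hD.sup continuousOn_const))) (hxc.sub continuousOn_id) fun y hy => ?_
  exact (sub_pos.2 (ht.lt_binding hE hd hy (hd.bindingIC_eq hx hy)).1).ne'

/-- Uniform bounds for test functions supported in `[c, d]`. -/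
lemma IsTight.exists_impact_bound (hE : E.Standing) (ht : IsTight E m)
    (hd : DoublyUnique E m) (hx : ∀ y ∈ Ioo E.lo E.hi, xhat y ∈ bindingIC E m y) {c d : ℝ}
    (hc : E.lo < c) (hcd : c ≤ d) (hdh : d < E.hi) :
    ∃ B, ∀ eta : ℝ → ℝ, (∀ x, |eta x| ≤ 1) → (∀ x, x ∉ Icc c d → eta x = 0) →
      ∀ y ∈ Ioo E.lo E.hi, |(1 + directImpact E m y) * eta y| ≤ B ∧
        |indirectImpact E m xhat y * eta (xhat y)| ≤ B := by
  obtain ⟨B1, hB1⟩ := (isCompact_Icc (a := c) (b := d)).exists_bound_of_continuousOn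
    (f := fun y => 1 + directImpact E m y)
    (continuousOn_const.add ((ht.continuousOn_directImpact hE hd).mono (Icc_subset_Ioo hc hdh)))
  obtain ⟨w, hw, hmin⟩ := (isCompact_Icc (a := (E.lo + c) / 2) (b := d)).exists_isMinOn
    (nonempty_Icc.2 (by linarith))
    (f := fun y => xhat y - y)
    (((ht.continuousOn_xhat hE hd hx).mono
      (Icc_subset_Ioo (by linarith) hdh)).sub continuousOn_id)
  have hwI : w ∈ Ioo E.lo E.hi := ⟨by linarith [hw.1], by linarith [hw.2]⟩
  have hr0 := sub_pos.2 (ht.lt_binding hE hd hwI (hd.bindingIC_eq hx hwI)).1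
  -- This bounds `xhat y - y` below whenever `xhat y` lies in `[c, d]`: by compactness if `y ≥ (lo +
  -- c) / 2`, and because `xhat y ≥ c` otherwise. It matters as `indirectImpact` may blow up near
  -- the end points.
  set r := min (xhat w - w) ((c - E.lo) / 2) with hr
  have hrpos : 0 < r := lt_min hr0 (by linarith)
  have hP := hE.costP.effDeriv_nonneg (e := 1) ⟨zero_le_one, le_rfl⟩
  refine ⟨max (max B1 0) (effDeriv E.cP 1 / r), fun eta h1 h0 y hy => ⟨?_, ?_⟩⟩
  · by_cases hyc : y ∈ Icc c d
    · refine le_trans ?_ ((le_max_left B1 0).trans (le_max_left _ _))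
      rw [abs_mul]
      have := hB1 y hyc
      rw [Real.norm_eq_abs] at this
      nlinarith [h1 y, abs_nonneg (1 + directImpact E m y)]
    · rw [h0 y hyc, mul_zero, abs_zero]
      exact (le_max_right B1 0).trans (le_max_left _ _)
  · by_cases hyc : xhat y ∈ Icc c d
    · refine le_trans ?_ (le_max_right _ _)
      obtain ⟨hI0, hI1⟩ := ht.indirectImpact_bounds hE hd hy (hd.bindingIC_eq hx hy)
      have hyx := (ht.lt_binding hE hd hy (hd.bindingIC_eq hx hy)).1
      have hry : r ≤ xhat y - y := by
        rcases le_or_gt ((E.lo + c) / 2) y with h | h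
        · exact (min_le_left _ _).trans (hmin ⟨h, hyx.le.trans hyc.2⟩)
        · exact (min_le_right _ _).trans (by linarith [hyc.1])
      rw [abs_mul, abs_of_pos hI0]
      have : effDeriv E.cP 1 / (xhat y - y) ≤ effDeriv E.cP 1 / r :=
        div_le_div_of_nonneg_left hP hrpos hry
      nlinarith [h1 (xhat y), abs_nonneg (eta (xhat y))]
    · rw [h0 _ hyc, mul_zero, abs_zero]
      exact (le_max_right B1 0).trans (le_max_left _ _)

variable {F : Measure ℝ} [IsFiniteMeasure F]

lemma IsTight.integrableOn_test (hE : E.Standing) (ht : IsTight E m)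
    (hd : DoublyUnique E m) (hx : ∀ y ∈ Ioo E.lo E.hi, xhat y ∈ bindingIC E m y) {c d : ℝ}
    (hc : E.lo < c) (hcd : c ≤ d) (hdh : d < E.hi) {eta : ℝ → ℝ} (heta : Continuous eta)
    (h1 : ∀ x, |eta x| ≤ 1) (h0 : ∀ x, x ∉ Icc c d → eta x = 0) :
    IntegrableOn (fun y => (1 + directImpact E m y) * eta y) (Ioo E.lo E.hi) F ∧
      IntegrableOn (fun y => indirectImpact E m xhat y * eta (xhat y)) (Ioo E.lo E.hi) F := by
  obtain ⟨B, hB⟩ := ht.exists_impact_bound hE hd hx hc hcd hdh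
  constructor
  · refine Integrable.of_bound (ContinuousOn.aestronglyMeasurable ?_ measurableSet_Ioo) B
      ((ae_restrict_iff' measurableSet_Ioo).2 (Eventually.of_forall fun y hy =>
        (hB eta h1 h0 y hy).1))
    exact (continuousOn_const.add (ht.continuousOn_directImpact hE hd)).mul heta.continuousOn
  · refine Integrable.of_bound (ContinuousOn.aestronglyMeasurable ?_ measurableSet_Ioo) B
      ((ae_restrict_iff' measurableSet_Ioo).2 (Eventually.of_forall fun y hy =>
        (hB eta h1 h0 y hy).2))
    exact (ht.continuousOn_indirectImpact hE hd hx).mul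
      (heta.comp_continuousOn (ht.continuousOn_xhat hE hd hx))

lemma IsTight.integral_test_le [NullSingletonClass F] (hE : E.Standing) (ht : IsTight E m)
    (hopt : IsOptimal E F m) (hd : DoublyUnique E m)
    (hx : ∀ y ∈ Ioo E.lo E.hi, xhat y ∈ bindingIC E m y) {c d : ℝ}
    (hc : E.lo < c) (hcd : c ≤ d) (hdh : d < E.hi) {eta : ℝ → ℝ} (heta : Continuous eta)
    (h1 : ∀ x, |eta x| ≤ 1) (h0 : ∀ x, x ∉ Icc c d → eta x = 0) :
    ∫ y in Ioo E.lo E.hi, (1 + directImpact E m y) * eta y ∂F ≤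
      ∫ y in Ioo E.lo E.hi, indirectImpact E m xhat y * eta (xhat y) ∂F := by
  obtain ⟨i1, i2⟩ := ht.integrableOn_test (F := F) hE hd hx hc hcd hdh heta h1 h0
  obtain ⟨C, hC⟩ := ht.exists_perturbation_bound hE hd ⟨hc, hcd.trans_lt hdh⟩
  have hev := hC eta (fun x _ => h1 x) fun x _ hxc => h0 x fun h => absurd h.1 (not_le.2 hxc)
  have := integral_variation_nonneg hE ht hopt
    (ψ := fun y => indirectImpact E m xhat y * eta (xhat y) - (1 + directImpact E m y) * eta y)
    heta.continuousOn (hev.mono fun t h => h.1) (hev.mono fun t h => h.2) (by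
      rw [← restrict_Ioo_eq_restrict_Icc]
      filter_upwards [ae_restrict_mem measurableSet_Ioo] with y hy κ hκ
      exact ht.variation_impact hE hd heta.continuousOn hy (hd.bindingIC_eq hx hy) hκ) (by
      rw [integrableOn_Icc_iff_integrableOn_Ioo]
      exact i2.sub i1)
  rw [integral_Icc_eq_integral_Ioo, integral_sub i2 i1] at this
  linarith

/-- The class of test functions is symmetric, so the inequality for `-eta` turns the first-order
condition into an equation. -/
lemma IsTight.integral_test_eq [NullSingletonClass F] (hE : E.Standing) (ht : IsTight E m)
    (hopt : IsOptimal E F m) (hd : DoublyUnique E m)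
    (hx : ∀ y ∈ Ioo E.lo E.hi, xhat y ∈ bindingIC E m y) {c d : ℝ}
    (hc : E.lo < c) (hcd : c ≤ d) (hdh : d < E.hi) {eta : ℝ → ℝ} (heta : Continuous eta)
    (h1 : ∀ x, |eta x| ≤ 1) (h0 : ∀ x, x ∉ Icc c d → eta x = 0) :
    ∫ y in Ioo E.lo E.hi, (1 + directImpact E m y) * eta y ∂F =
      ∫ y in Ioo E.lo E.hi, indirectImpact E m xhat y * eta (xhat y) ∂F := by
  refine le_antisymm (ht.integral_test_le hE hopt hd hx hc hcd hdh heta h1 h0) ?_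
  have := ht.integral_test_le hE hopt hd hx hc hcd hdh heta.neg
    (fun x => by simpa using h1 x) fun x hxc => by simp [h0 x hxc]
  simp only [Pi.neg_apply, mul_neg, integral_neg] at this
  linarith

/-- A trapezoid with plateau `[c, d]` and slopes `n`. -/
noncomputable def trapezoid (c d : ℝ) (n : ℕ) (x : ℝ) : ℝ :=
  max 0 (1 - n * max (max (c - x) (x - d)) 0)

lemma continuous_trapezoid (c d : ℝ) (n : ℕ) : Continuous (trapezoid c d n) := by
  unfold trapezoid
  fun_prop

lemma abs_trapezoid_le_one (c d : ℝ) (n : ℕ) (x : ℝ) : |trapezoid c d n x| ≤ 1 := by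
  have h : 0 ≤ (n : ℝ) * max (max (c - x) (x - d)) 0 :=
    mul_nonneg n.cast_nonneg (le_max_right _ _)
  rw [trapezoid, abs_of_nonneg (le_max_left _ _)]
  exact max_le zero_le_one (by linarith)

lemma tendsto_trapezoid {c d : ℝ} (x : ℝ) :
    Tendsto (fun n => trapezoid c d n x) atTop (𝓝 ((Icc c d).indicator 1 x)) := by
  by_cases hx : x ∈ Icc c d
  · have : ∀ n, trapezoid c d n x = 1 := fun n => by
      rw [trapezoid, max_eq_right (max_le (by linarith [hx.1]) (by linarith [hx.2]) :
        max (c - x) (x - d) ≤ 0)]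
      simp
    simp [this, hx]
  · rw [indicator_of_notMem hx]
    have hpos : 0 < max (max (c - x) (x - d)) 0 := by
      rw [lt_max_iff, lt_max_iff]
      left
      by_contra! h
      exact hx ⟨by linarith, by linarith⟩
    obtain ⟨N, hN⟩ := exists_nat_ge (max (max (c - x) (x - d)) 0)⁻¹
    refine tendsto_const_nhds.congr' ?_
    filter_upwards [eventually_ge_atTop N] with n hn
    rw [trapezoid, eq_comm, max_eq_left]
    have h1 : (max (max (c - x) (x - d)) 0)⁻¹ ≤ n := hN.trans (by exact_mod_cast hn)
    have := mul_le_mul_of_nonneg_right h1 hpos.le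
    rw [inv_mul_cancel₀ hpos.ne'] at this
    linarith

/-- The direct impacts of the types in `[c, d]` balance the indirect impacts of the types they
bind. -/
lemma IsTight.integral_directImpact_eq [NullSingletonClass F] (hE : E.Standing) (ht : IsTight E m)
    (hopt : IsOptimal E F m) (hd : DoublyUnique E m)
    (hx : ∀ y ∈ Ioo E.lo E.hi, xhat y ∈ bindingIC E m y) {c d : ℝ}
    (hc : E.lo < c) (hcd : c ≤ d) (hdh : d < E.hi) :
    ∫ y in Icc c d, (1 + directImpact E m y) ∂F =
      ∫ y in Ioo E.lo E.hi ∩ xhat ⁻¹' Icc c d, indirectImpact E m xhat y ∂F := by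
  set c' := (E.lo + c) / 2 with hc'
  set d' := (d + E.hi) / 2 with hd'
  have hc'1 : E.lo < c' := by linarith
  have hd'1 : d' < E.hi := by linarith
  have hcd' : c' ≤ d' := by linarith
  have hsupp : ∀ᶠ n : ℕ in atTop, ∀ x, x ∉ Icc c' d' → trapezoid c d n x = 0 := by
    obtain ⟨N, hN⟩ := exists_nat_ge (min (c - c') (d' - d))⁻¹
    have hpos : 0 < min (c - c') (d' - d) := lt_min (by linarith) (by linarith)
    filter_upwards [eventually_ge_atTop N] with n hn x hxI
    have h1 : min (c - c') (d' - d) ≤ max (max (c - x) (x - d)) 0 := by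
      refine le_trans ?_ (le_max_left _ _)
      rcases lt_or_ge x c' with h | h
      · exact (min_le_left _ _).trans ((by linarith : c - c' ≤ c - x).trans (le_max_left _ _))
      · have : d' < x := by
          by_contra! h'
          exact hxI ⟨h, h'⟩
        exact (min_le_right _ _).trans ((by linarith : d' - d ≤ x - d).trans (le_max_right _ _))
    have h2 : (min (c - c') (d' - d))⁻¹ ≤ n := hN.trans (by exact_mod_cast hn)
    have h3 := mul_le_mul h2 h1 hpos.le n.cast_nonneg
    rw [inv_mul_cancel₀ hpos.ne'] at h3
    rw [trapezoid, max_eq_left]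
    linarith
  obtain ⟨B, hB⟩ := ht.exists_impact_bound hE hd hx hc'1 hcd' hd'1
  set S := Ioo E.lo E.hi ∩ xhat ⁻¹' Icc c d with hS
  have hSm : MeasurableSet S := by
    -- Monotonicity of `xhat` makes `S` an interval.
    refine OrdConnected.measurableSet ⟨fun a ha b hb w hw => ?_⟩
    have hwI : w ∈ Ioo E.lo E.hi := ⟨ha.1.1.trans_le hw.1, hw.2.trans_lt hb.1.2⟩
    have hmono := ht.monotoneOn_xhat hE hd hx
    exact ⟨hwI, ha.2.1.trans (hmono ha.1 hwI hw.1), (hmono hwI hb.1 hw.2).trans hb.2.2⟩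
  have lim1 : Tendsto (fun n => ∫ y in Ioo E.lo E.hi,
      (1 + directImpact E m y) * trapezoid c d n y ∂F) atTop
      (𝓝 (∫ y in Ioo E.lo E.hi, (Icc c d).indicator (fun y => 1 + directImpact E m y) y ∂F)) := by
    refine tendsto_integral_filter_of_dominated_convergence (fun _ => B) ?_ ?_
      (integrable_const _) ?_
    · filter_upwards [hsupp] with n hn
      exact (ht.integrableOn_test hE hd hx hc'1 hcd' hd'1 (continuous_trapezoid c d n)
        (abs_trapezoid_le_one c d n) hn).1.aestronglyMeasurable
    · filter_upwards [hsupp] with n hn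
      exact (ae_restrict_iff' measurableSet_Ioo).2 (Eventually.of_forall fun y hy =>
        (hB _ (abs_trapezoid_le_one c d n) hn y hy).1)
    · refine Eventually.of_forall fun y => ?_
      have := (tendsto_trapezoid (c := c) (d := d) y).const_mul (1 + directImpact E m y)
      convert this using 2
      by_cases h : y ∈ Icc c d <;> simp [h]
  have lim2 : Tendsto (fun n => ∫ y in Ioo E.lo E.hi,
      indirectImpact E m xhat y * trapezoid c d n (xhat y) ∂F) atTop
      (𝓝 (∫ y in Ioo E.lo E.hi, S.indicator (indirectImpact E m xhat) y ∂F)) := by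
    refine tendsto_integral_filter_of_dominated_convergence (fun _ => B) ?_ ?_
      (integrable_const _) ?_
    · filter_upwards [hsupp] with n hn
      exact (ht.integrableOn_test hE hd hx hc'1 hcd' hd'1 (continuous_trapezoid c d n)
        (abs_trapezoid_le_one c d n) hn).2.aestronglyMeasurable
    · filter_upwards [hsupp] with n hn
      exact (ae_restrict_iff' measurableSet_Ioo).2 (Eventually.of_forall fun y hy =>
        (hB _ (abs_trapezoid_le_one c d n) hn y hy).2)
    · filter_upwards [ae_restrict_mem measurableSet_Ioo] with y hy
      have := (tendsto_trapezoid (c := c) (d := d) (xhat y)).const_mul (indirectImpact E m xhat y)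
      convert this using 2
      by_cases h : xhat y ∈ Icc c d
      · rw [indicator_of_mem (show y ∈ S from ⟨hy, h⟩), indicator_of_mem h]; simp
      · rw [indicator_of_notMem (fun h' : y ∈ S => h h'.2), indicator_of_notMem h, mul_zero]
  have heq := tendsto_nhds_unique (lim1.congr' (by
    filter_upwards [hsupp] with n hn
    exact ht.integral_test_eq hE hopt hd hx hc'1 hcd' hd'1 (continuous_trapezoid c d n)
      (abs_trapezoid_le_one c d n) hn)) lim2
  rw [setIntegral_indicator measurableSet_Icc, setIntegral_indicator hSm,
    inter_eq_self_of_subset_right (Icc_subset_Ioo hc hdh),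
    inter_eq_self_of_subset_right inter_subset_left] at heq
  exact heq

/-! ### Full support, and excluding the highest type as a binding type -/

lemma measure_Icc_pos_of_support {F : Measure ℝ} (hF : F.support = Icc E.lo E.hi) {a b : ℝ}
    (ha : E.lo ≤ a) (hab : a < b) (hb : b ≤ E.hi) : 0 < F (Icc a b) := by
  have h : (a + b) / 2 ∈ F.support := by
    rw [hF]; exact ⟨by linarith, by linarith⟩
  exact (Measure.mem_support_iff_forall _).1 h _ (Icc_mem_nhds (by linarith) (by linarith))

lemma setIntegral_Icc_pos (hF : F.support = Icc E.lo E.hi) {f : ℝ → ℝ} {a b : ℝ}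
    (ha : E.lo ≤ a) (hab : a < b) (hb : b ≤ E.hi) (hf : ContinuousOn f (Icc a b))
    (hpos : ∀ y ∈ Icc a b, 0 < f y) : 0 < ∫ y in Icc a b, f y ∂F := by
  obtain ⟨w, hw, hmin⟩ := isCompact_Icc.exists_isMinOn (nonempty_Icc.2 hab.le) hf
  have h1 : f w * F.real (Icc a b) ≤ ∫ y in Icc a b, f y ∂F := by
    have := setIntegral_mono_on (μ := F) (integrableOn_const (measure_ne_top F (Icc a b)))
      (hf.integrableOn_compact isCompact_Icc) measurableSet_Icc (f := fun _ => f w)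
      (fun y hy => hmin hy)
    rwa [setIntegral_const, smul_eq_mul, mul_comm] at this
  have h2 : 0 < F.real (Icc a b) :=
    ENNReal.toReal_pos (measure_Icc_pos_of_support hF ha hab hb).ne' (measure_ne_top _ _)
  exact (mul_pos (hpos w hw) h2).trans_le h1

/-- No interior type is bound by the highest type. -/
lemma IsTight.xhat_lt_hi [NullSingletonClass F] (hE : E.Standing) (hF : F.support = Icc E.lo E.hi)
    (ht : IsTight E m) (hopt : IsOptimal E F m) (hd : DoublyUnique E m)
    (hx : ∀ y ∈ Ioo E.lo E.hi, xhat y ∈ bindingIC E m y) {y : ℝ} (hy : y ∈ Ioo E.lo E.hi) :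
    xhat y < E.hi := by
  refine lt_of_le_of_ne (hx y hy).1.2 fun hhi => ?_
  set b := (y + E.hi) / 2 with hb
  have hyb : y < b := by linarith [hy.2]
  have hbh : b < E.hi := by linarith [hy.2]
  have hsub : Icc y b ⊆ Ioo E.lo E.hi := Icc_subset_Ioo hy.1 hbh
  have hIc := (ht.continuousOn_indirectImpact hE hd hx).mono hsub
  have hJ : 0 < ∫ w in Icc y b, indirectImpact E m xhat w ∂F :=
    setIntegral_Icc_pos hF hy.1.le hyb hbh.le hIc fun w hw =>
      (ht.indirectImpact_bounds hE hd (hsub hw) (hd.bindingIC_eq hx (hsub hw))).1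
  set J := ∫ w in Icc y b, indirectImpact E m xhat w ∂F
  obtain ⟨C, hC⟩ := ht.exists_perturbation_bound hE hd hy
  -- If `xhat y = hi`, monotonicity makes `hi` the binding type of all of `[y, b]`. Lowering the
  -- loss near `hi` then saves at rate `J`, while affected types above `hi - δ` cost at most `C`
  -- each; since `hi` is no atom, `δ` can make their total cost smaller than `J`.
  obtain ⟨U, hUsub, hUo, hUF⟩ := Set.exists_isOpen_lt_of_lt ({E.hi} : Set ℝ)
    (ENNReal.ofReal (J / (|C| + 1))) (μ := F)
    (by rw [measure_singleton]; exact ENNReal.ofReal_pos.2 (by positivity))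
  obtain ⟨δ0, hδ0, hball⟩ := Metric.isOpen_iff.1 hUo E.hi (hUsub rfl)
  set δ := min δ0 (E.hi - b) with hδ
  have hδpos : 0 < δ := lt_min hδ0 (by linarith)
  have hδb : b ≤ E.hi - δ := by linarith [min_le_right δ0 (E.hi - b)]
  have hFδ : F.real (Icc E.lo E.hi ∩ Ioi (E.hi - δ)) < J / (|C| + 1) := by
    have h1 : Icc E.lo E.hi ∩ Ioi (E.hi - δ) ⊆ U := fun w hw => hball (by
      rw [Metric.mem_ball, Real.dist_eq, abs_lt]
      have := hw.2
      rw [mem_Ioi] at this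
      exact ⟨by linarith [min_le_left δ0 (E.hi - b)], by linarith [hw.1.2]⟩)
    exact (ENNReal.toReal_lt_of_lt_ofReal ((measure_mono h1).trans_lt hUF))
  -- A downward tent of depth `1` at `hi` and width `δ`. Its nonzero value at `hi` puts it outside
  -- the test functions of the balance identity, so it enters the variational inequality directly.
  set eta : ℝ → ℝ := fun x => -max 0 (1 - |E.hi - x| / δ) with heta
  have hetac : Continuous eta := by fun_prop
  have heta1 : ∀ x, |eta x| ≤ 1 := fun x => by
    have : 0 ≤ |E.hi - x| / δ := by positivity
    rw [heta, abs_neg, abs_of_nonneg (le_max_left _ _)]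
    exact max_le zero_le_one (by linarith)
  have heta0 : ∀ x, x ≤ E.hi - δ → eta x = 0 := fun x hxd => by
    have : 1 ≤ |E.hi - x| / δ := by
      rw [le_div_iff₀ hδpos, one_mul]
      exact le_trans (by linarith) (le_abs_self _)
    rw [heta]
    simp only [neg_eq_zero]
    exact max_eq_left (by linarith)
  have hetan : ∀ x, eta x ≤ 0 := fun x => neg_nonpos.2 (le_max_left _ _)
  have hetahi : eta E.hi = -1 := by simp [heta]
  have hev := hC eta (fun x _ => heta1 x) fun x _ hxy => heta0 x (by linarith)
  set ψ : ℝ → ℝ := fun w => (Icc y b).indicator (fun w => -indirectImpact E m xhat w) w +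
    (Ioi (E.hi - δ)).indicator (fun _ => C) w with hψ
  have i1 : IntegrableOn ((Icc y b).indicator (fun w => -indirectImpact E m xhat w))
      (Icc E.lo E.hi) F := by
    have : IntegrableOn (fun w => -indirectImpact E m xhat w) (Icc y b) F :=
      (hIc.integrableOn_compact isCompact_Icc).neg
    exact (this.integrable_indicator measurableSet_Icc).integrableOn
  have i2 : IntegrableOn ((Ioi (E.hi - δ)).indicator (fun _ => C)) (Icc E.lo E.hi) F :=
    ((integrable_const C).indicator measurableSet_Ioi).integrableOn
  have hres := integral_variation_nonneg hE ht hopt (ψ := ψ) hetac.continuousOn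
    (hev.mono fun t h => h.1) (hev.mono fun t h => h.2) (by
      rw [← restrict_Ioo_eq_restrict_Icc]
      filter_upwards [ae_restrict_mem measurableSet_Ioo] with w hw κ hκ
      rcases lt_or_ge (E.hi - δ) w with hwδ | hwδ
      · have : ψ w = C := by
          simp only [hψ]
          rw [indicator_of_notMem (fun h => by linarith [h.2]),
            indicator_of_mem (show w ∈ Ioi (E.hi - δ) from hwδ), zero_add]
        rw [this]
        filter_upwards [hev, self_mem_nhdsWithin] with t h ht0
        obtain ⟨e, p, hf, hc⟩ := h.2 w (Ioo_subset_Icc_self hw)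
        exact ⟨e, p, hf, hc.trans (by linarith [mul_pos (show (0 : ℝ) < t from ht0) hκ])⟩
      · have hle : indirectImpact E m xhat w * eta (xhat w) -
            (1 + directImpact E m w) * eta w ≤ ψ w := by
          simp only [hψ]
          rw [heta0 w hwδ, mul_zero, sub_zero, 
            indicator_of_notMem (show w ∉ Ioi (E.hi - δ) from not_lt.2 hwδ), add_zero]
          have hI := (ht.indirectImpact_bounds hE hd hw (hd.bindingIC_eq hx hw)).1
          by_cases hwy : w ∈ Icc y b
          · have : xhat w = E.hi := le_antisymm (hx w hw).1.2
              (hhi ▸ ht.monotoneOn_xhat hE hd hx hy hw hwy.1)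
            rw [indicator_of_mem hwy, this, hetahi]
            linarith
          · rw [indicator_of_notMem hwy]
            exact mul_nonpos_of_nonneg_of_nonpos hI.le (hetan _)
        filter_upwards [ht.variation_impact hE hd hetac.continuousOn hw (hd.bindingIC_eq hx hw) hκ,
          self_mem_nhdsWithin] with t ⟨e, p, hf, hc⟩ ht0
        exact ⟨e, p, hf, hc.trans (by
          have := mul_le_mul_of_nonneg_left hle (le_of_lt ht0)
          linarith)⟩) (i1.add i2)
  simp only [hψ] at hres
  rw [integral_add i1 i2, setIntegral_indicator measurableSet_Icc,
    setIntegral_indicator measurableSet_Ioi, setIntegral_const, integral_neg,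
    inter_eq_self_of_subset_right (hsub.trans Ioo_subset_Icc_self), smul_eq_mul] at hres
  rw [lt_div_iff₀ (by positivity)] at hFδ
  have h3 : F.real (Icc E.lo E.hi ∩ Ioi (E.hi - δ)) * C ≤
      F.real (Icc E.lo E.hi ∩ Ioi (E.hi - δ)) * (|C| + 1) :=
    mul_le_mul_of_nonneg_left (by linarith [le_abs_self C]) measureReal_nonneg
  linarith

end Continuity

end TaxMech

namespace TaxMech

/-! ### The intervals of types -/

variable {E : Env} {m : Mech}

/-- No higher type needs deterring at `hi`, so zero efforts are feasible and attain the lower bound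
`hi - loss hi` on the cost; uniqueness of the efforts does the rest. -/
lemma IsTight.eP_hi (hE : E.Standing) (ht : IsTight E m) : m.eP E.hi = 0 := by
  have hy := right_mem_Icc.2 hE.lo_lt_hi.le
  have hf := effortFeasible_of_isMechanism hE ht.1 hy
  have h0 : (0 : ℝ) ∈ Icc (0 : ℝ) 1 := left_mem_Icc.2 zero_le_one
  have hl := loss_le_self hE ht.1 hy
  refine (ht.effort_unique hE hy (e := 0) (p := 0) ⟨h0, h0, fun x hx => ?_, fun x hx => ?_⟩
    ?_).2.symm
  · have : x = E.hi := le_antisymm hx.2 hx.1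
    rw [this]; linarith
  · have : x = E.hi := le_antisymm hx.2 hx.1
    rw [this, hE.uA_zero]; linarith
  · rw [effortCost_eq, effortCost_eq, hE.costA.zero, hE.costP.zero, zero_mul,
      max_eq_left (a := E.hi - loss E m E.hi + 0) (by linarith)]
    linarith [le_max_left (E.hi - loss E m E.hi + E.cA (m.eA E.hi))
        (m.eA E.hi * effDeriv E.cA (m.eA E.hi)), hE.costA.nonneg hf.agent,
      mul_nonneg (sub_nonneg.2 hf.agent.2) (hE.costP.nonneg hf.principal)]

lemma IsTight.lt_hi_of_mem_interiorTypes (hE : E.Standing) (ht : IsTight E m) {y : ℝ}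
    (hy : y ∈ interiorTypes E m) : y < E.hi :=
  lt_of_le_of_ne hy.1.2 fun h => by
    have := hy.2.1
    rw [h, ht.eP_hi hE] at this
    exact lt_irrefl _ this

lemma IsTight.mem_Ioo_of_d1_pos (hE : E.Standing) (ht : IsTight E m) {y : ℝ}
    (hy : y ∈ interiorTypes E m) (h : 0 < d1 E m y) : y ∈ Ioo E.lo E.hi := by
  refine ⟨lt_of_le_of_ne hy.1.1 fun hlo => ?_, ht.lt_hi_of_mem_interiorTypes hE hy⟩
  rw [← hlo, d1, ht.loss_lo hE] at h
  linarith [hE.uA_nonneg (effortFeasible_of_isMechanism hE ht.1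
    (left_mem_Icc.2 hE.lo_lt_hi.le)).agent]

lemma IsTight.directImpact_eq_zero (hE : E.Standing) (ht : IsTight E m) (hd : DoublyUnique E m)
    {y : ℝ} (hy : y ∈ Middle E m) : directImpact E m y = 0 := by
  have hyI := ht.mem_Ioo_of_d1_pos hE hy.1 hy.2.2
  obtain ⟨z, hz⟩ := hd.1 y hyI
  exact le_antisymm (ht.directImpact_nonpos hE hd hyI hz
    (ht.not_full_refund hE hd hyI hz (Or.inr hy.2.1))) (ht.directImpact_nonneg hE hd hyI hy.2.2)

section Binding

variable {xhat : ℝ → ℝ}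

lemma IsTight.directImpact_eq_indirectImpact (hE : E.Standing) (ht : IsTight E m)
    (hd : DoublyUnique E m) (hx : ∀ y ∈ Ioo E.lo E.hi, xhat y ∈ bindingIC E m y)
    {y : ℝ} (hy : y ∈ SuperHigh E m) : directImpact E m y = indirectImpact E m xhat y := by
  have hyt : 0 < y + E.tau := by linarith [hy.1.1.1, hE.lo_nonneg, hE.tau_pos]
  have h2 : 0 < d2 E m y := hy.2
  have h1 : 0 < d1 E m y := by
    have := mul_nonneg (IsTight.alpha_nonneg (E := E) (m := m) y) hyt.le
    rw [d2_eq] at h2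
    linarith
  have hyI := ht.mem_Ioo_of_d1_pos hE hy.1 h1
  have hz := hd.bindingIC_eq hx hyI
  have hyz := (ht.lt_binding hE hd hyI hz).1
  rw [ht.indirectImpact_eq hE hd hyI hz, max_eq_left (ht.directImpact_nonneg hE hd hyI h1),
    le_antisymm (ht.directImpact_le hE hd hyI hz)
      (ht.le_directImpact hE hd hyI hz h1 (ht.not_no_refund hE hd hyI hz h2))]
  have : xhat y + E.tau ≠ 0 := by linarith
  have : xhat y - y ≠ 0 := by linarith
  field_simp
  ring

/-! ### Strict monotonicity and the cut-off of SuperLow -/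

variable {F : Measure ℝ} [IsFiniteMeasure F] [NullSingletonClass F]

/-- Double uniqueness gives injectivity only at binding types below `hi`, which is why
`IsTight.xhat_lt_hi` is needed first. -/
lemma IsTight.strictMonoOn_xhat (hE : E.Standing) (hF : F.support = Icc E.lo E.hi)
    (ht : IsTight E m) (hopt : IsOptimal E F m) (hd : DoublyUnique E m)
    (hx : ∀ y ∈ Ioo E.lo E.hi, xhat y ∈ bindingIC E m y) :
    StrictMonoOn xhat (Ioo E.lo E.hi) := by
  refine (ht.monotoneOn_xhat hE hd hx).strictMonoOn_of_injOn fun a ha b hb hab => ?_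
  refine hd.2 (xhat a) ⟨ha.1.trans_le (hx a ha).1.1, ht.xhat_lt_hi hE hF hopt hd hx ha⟩ a ha b hb
    (hx a ha) ?_
  rw [hab]
  exact hx b hb

/-- The balance of direct and indirect impacts. -/
lemma IsTight.integral_impact_eq (hE : E.Standing) (hF : F.support = Icc E.lo E.hi)
    (ht : IsTight E m) (hopt : IsOptimal E F m) (hd : DoublyUnique E m)
    (hx : ∀ y ∈ Ioo E.lo E.hi, xhat y ∈ bindingIC E m y) {a b : ℝ} (ha : a ∈ Ioo E.lo E.hi)
    (hb : b ∈ Ioo E.lo E.hi) (hab : a ≤ b) :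
    ∫ y in Icc a b, indirectImpact E m xhat y ∂F =
      ∫ y in Icc (xhat a) (xhat b), (1 + directImpact E m y) ∂F := by
  have hmono := ht.strictMonoOn_xhat hE hF hopt hd hx
  rw [ht.integral_directImpact_eq hE hopt hd hx (ha.1.trans_le (hx a ha).1.1)
    (hmono.monotoneOn ha hb hab) (ht.xhat_lt_hi hE hF hopt hd hx hb)]
  congr 2
  ext y
  constructor
  · intro hy
    have hyI : y ∈ Ioo E.lo E.hi := ⟨ha.1.trans_le hy.1, hy.2.trans_lt hb.2⟩
    exact ⟨hyI, hmono.monotoneOn ha hyI hy.1, hmono.monotoneOn hyI hb hy.2⟩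
  · rintro ⟨hyI, h1, h2⟩
    exact ⟨(hmono.le_iff_le ha hyI).1 h1, (hmono.le_iff_le hyI hb).1 h2⟩

/-- Revealed preference: the maximality of `xhat a` for slope `eP a` and of `xhat b` for slope `eP
b` add up to `(eP a - eP b) * (xhat b - xhat a) > 0`. -/
lemma IsTight.eP_strictAntiOn (hE : E.Standing) (hF : F.support = Icc E.lo E.hi)
    (ht : IsTight E m) (hopt : IsOptimal E F m) (hd : DoublyUnique E m)
    (hx : ∀ y ∈ Ioo E.lo E.hi, xhat y ∈ bindingIC E m y) :
    StrictAntiOn m.eP (Ioo E.lo E.hi) := by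
  intro a ha b hb hab
  have hlt := ht.strictMonoOn_xhat hE hF hopt hd hx ha hb hab
  have hI : ∀ w ∈ Ioo E.lo E.hi, xhat w ∈ Icc E.lo E.hi := fun w hw =>
    ⟨hw.1.le.trans (hx w hw).1.1, (hx w hw).1.2⟩
  have h1 := ht.sub_lt_of_ne_binding hE hd ha (hd.bindingIC_eq hx ha) (hI b hb) hlt.ne'
  have h2 := ht.sub_lt_of_ne_binding hE hd hb (hd.bindingIC_eq hx hb) (hI a ha) hlt.ne
  nlinarith

/-- The loss starts at `loss lo = lo` and lies strictly below the diagonal at `x`, so by concavity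
its slope beyond `x` is strictly below `1`. -/
lemma IsTight.sub_loss_lt (hE : E.Standing) (ht : IsTight E m) (hd : DoublyUnique E m) {x y : ℝ}
    (hx : E.lo < x) (hxy : x < y) (hy : y ≤ E.hi) : x - loss E m x < y - loss E m y := by
  have h1 := (ht.concaveOn_loss hE).slope_anti_adjacent (left_mem_Icc.2 hE.lo_lt_hi.le)
    ⟨(hx.trans hxy).le, hy⟩ hx hxy
  have h2 := ht.loss_lt_self hE hd ⟨hx, hxy.le.trans hy⟩
  have h3 : (loss E m x - loss E m E.lo) / (x - E.lo) < 1 := by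
    rw [div_lt_one (sub_pos.2 hx), ht.loss_lo hE]
    linarith
  have h4 := h1.trans_lt h3
  rw [div_lt_one (sub_pos.2 hxy)] at h4
  linarith

lemma strictMonoOn_rent_deriv (hE : E.Standing) :
    StrictMonoOn (fun e => effDeriv E.cA e + effDeriv E.uA e) (Icc 0 1) := by
  have hder : ∀ e ∈ Icc (0 : ℝ) 1, HasDerivWithinAt (fun e => e * effDeriv E.cA e)
      (effDeriv E.cA e + effDeriv E.uA e) (Icc 0 1) e := fun e he => by
    rw [hE.effDeriv_uA he]
    exact ((hasDerivWithinAt_id e (Icc (0 : ℝ) 1)).mul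
      (hE.costA.hasDerivWithinAt_effDeriv he)).congr_deriv (by simp only [id]; ring)
  refine (hE.rent_regularity.strictMonoOn_derivWithin
    fun e he => (hder e he).differentiableWithinAt).congr fun e he => ?_
  exact (hder e he).derivWithin (uniqueDiffOn_Icc zero_lt_one e he)

/-- The lowest types have an information rent below their evidence rent. -/
lemma IsTight.exists_superLow (hE : E.Standing) (ht : IsTight E m) (hd : DoublyUnique E m) :
    ∃ y ∈ Ioo E.lo E.hi, y ∈ SuperLow E m := by
  have hlh := hE.lo_lt_hi
  have hL := ht.lo_lt_loss_hi hE hd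
  have hLh := loss_le_self hE ht.1 (right_mem_Icc.2 hlh.le)
  -- Deterring `hi` forces audits of at least `q` at all types near `lo`; the factor `2` leaves room
  -- for `y` slightly above `lo`.
  set q := (loss E m E.hi - E.lo) / (2 * (E.hi - E.lo)) with hq
  have hhl : 0 < E.hi - E.lo := sub_pos.2 hlh
  have hq0 : 0 < q := div_pos (by linarith) (by linarith)
  have hq1 : q ≤ 1 := by rw [hq, div_le_one (by linarith)]; linarith
  have hcq := hE.costP.pos ⟨hq0, hq1⟩
  have h0 : (0 : ℝ) ∈ Icc (0 : ℝ) 1 := left_mem_Icc.2 zero_le_one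
  -- Auditing at least `q` makes agent effort worth raising above `ε`. Near `lo` the evidence rent
  -- then exceeds `uA ε`, more than the information rent, which is below `y - lo`.
  obtain ⟨ε, hε, hεI⟩ : ∃ ε, effDeriv E.cA ε + effDeriv E.uA ε < E.cP q ∧ ε ∈ Ioo (0 : ℝ) 1 := by
    have h2 := (hE.costA.continuousOn_effDeriv.add hE.continuousOn_effDeriv_uA 0
      h0).eventually_lt_const (u := E.cP q)
      (by simpa [hE.costA.deriv_zero, hE.effDeriv_uA h0] using hcq)
    have h3 : ∀ᶠ z in 𝓝[Ioo (0 : ℝ) 1] 0, effDeriv E.cA z + effDeriv E.uA z < E.cP q :=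
      h2.filter_mono (nhdsWithin_mono _ Ioo_subset_Icc_self)
    have : (𝓝[Ioo (0 : ℝ) 1] 0).NeBot := by
      rw [nhdsWithin_Ioo_eq_nhdsGT zero_lt_one]; infer_instance
    exact (h3.and self_mem_nhdsWithin).exists
  have hu := hE.uA_pos ⟨hεI.1, hεI.2.le⟩
  obtain ⟨y, hy1, hy2⟩ : ∃ y, E.lo < y ∧
      y < min (E.lo + E.uA ε) (E.lo + (loss E m E.hi - E.lo) / 2) :=
    exists_between (lt_min (by linarith) (by linarith))
  have hy3 := hy2.trans_le (min_le_left _ _)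
  have hy4 := hy2.trans_le (min_le_right _ _)
  have hy : y ∈ Ioo E.lo E.hi := ⟨hy1, by linarith⟩
  have hyI := Ioo_subset_Icc_self hy
  refine ⟨y, hy, ⟨hyI, ht.eP_mem_Ioo hE hd hy⟩, ?_⟩
  by_contra! hd1
  have he := ht.eA_mem_Ioo hE hd hy
  have hp := ht.eP_mem_Ioo hE hd hy
  have hqp : q ≤ m.eP y := by
    have h1 := (effortFeasible_of_isMechanism hE ht.1 hyI).no_refund E.hi ⟨hy.2.le, le_rfl⟩
    rw [hq, div_le_iff₀ (by linarith)]
    nlinarith [mul_nonneg hp.1.le (sub_nonneg.2 hy1.le)]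
  have h1 := hE.costP.strictMono.monotoneOn ⟨hq0.le, hq1⟩ (Ioo_subset_Icc_self hp) hqp
  have h2 := ht.neg_one_le_directImpact hE hd hy
  rw [directImpact, le_div_iff₀ (ht.effDeriv_uA_pos hE hd hy)] at h2
  have h3 : ε < m.eA y := by
    by_contra! h
    have := (strictMonoOn_rent_deriv hE).monotoneOn (Ioo_subset_Icc_self he)
      (Ioo_subset_Icc_self hεI) h
    beta_reduce at this
    linarith
  have h4 := hE.strictMonoOn_uA (Ioo_subset_Icc_self hεI) (Ioo_subset_Icc_self he) h3
  unfold d1 at hd1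
  linarith [ht.lo_le_loss hE hyI]

lemma IsTight.continuousOn_d1 (hE : E.Standing) (ht : IsTight E m) (hd : DoublyUnique E m) :
    ContinuousOn (d1 E m) (Ioo E.lo E.hi) := by
  have h1 : ContinuousOn (fun y => E.uA (m.eA y)) (Ioo E.lo E.hi) :=
    hE.continuousOn_uA.comp
      (fun y hy => (ht.continuousAt_eA hE hd hy).continuousWithinAt)
      fun y hy => Ioo_subset_Icc_self (ht.eA_mem_Ioo hE hd hy)
  exact (continuousOn_id.sub h1).sub ((ht.continuousOn_loss hE).mono Ioo_subset_Icc_self)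

/-- The supremum of the types with slack information rent is the lowest binding type. -/
lemma IsTight.isLUB_superLow (hE : E.Standing) (hF : F.support = Icc E.lo E.hi)
    (ht : IsTight E m) (hopt : IsOptimal E F m) (hd : DoublyUnique E m)
    (hx : ∀ y ∈ Ioo E.lo E.hi, xhat y ∈ bindingIC E m y) {s : ℝ}
    (hs : IsGLB (xhat '' Ioo E.lo E.hi) s) : IsLUB (SuperLow E m) s := by
  have hlh := hE.lo_lt_hi
  have hmono := ht.strictMonoOn_xhat hE hF hopt hd hx
  have hD := ht.continuousOn_directImpact hE hd
  have hslo : E.lo ≤ s := hs.2 (by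
    rintro _ ⟨y, hy, rfl⟩
    exact hy.1.le.trans (hx y hy).1.1)
  have hnear : ∀ y ∈ Ioo E.lo E.hi, ∀ (P : ℝ → Prop) (l r : ℝ), l < y → y < r →
      (∀ᶠ w in 𝓝 y, P w) → ∃ c d, l < c ∧ c < d ∧ d < r ∧ ∀ w ∈ Icc c d, P w := by
    intro y hy P l r hl hr hP
    obtain ⟨a, b, hab, hsub⟩ := mem_nhds_iff_exists_Ioo_subset.1 (hP.and (Ioo_mem_nhds hl hr))
    obtain ⟨c, hc1, hc2⟩ := exists_between hab.1
    refine ⟨c, y, (hsub ⟨hc1, hc2.trans hab.2⟩).2.1, hc2, hr, fun w hw =>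
      (hsub ⟨hc1.trans_le hw.1, hw.2.trans_lt hab.2⟩).1⟩
  -- A SuperLow type above `s` would lie in an interval `[c, d]` of types with `D = -1`, which is
  -- the image under `xhat` of some `[a, b]`. The balance would equate the positive integral of `I`
  -- over `[a, b]` to zero.
  have hub : ∀ y ∈ SuperLow E m, y ≤ s := by
    intro y hy
    by_contra! hsy
    have hyI : y ∈ Ioo E.lo E.hi :=
      ⟨hslo.trans_lt hsy, ht.lt_hi_of_mem_interiorTypes hE hy.1⟩
    obtain ⟨c, d, hc, hcd, hdh, hneg⟩ := hnear y hyI (fun w => d1 E m w < 0) s E.hi hsy hyI.2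
      (((ht.continuousOn_d1 hE hd).continuousAt (Ioo_mem_nhds hyI.1 hyI.2)).eventually_lt_const
        hy.2)
    have hdI : d ∈ Ioo E.lo E.hi := ⟨by linarith, hdh⟩
    have hcI : c ∈ Ioo E.lo E.hi := ⟨by linarith, by linarith⟩
    obtain ⟨_, ⟨w, hw, rfl⟩, -, hwc⟩ := hs.exists_between hc
    have hwd : w ≤ d := by
      by_contra! h
      have := (ht.lt_binding hE hd hw (hd.bindingIC_eq hx hw)).1
      linarith
    have hdx := (ht.lt_binding hE hd hdI (hd.bindingIC_eq hx hdI)).1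
    have hivt := intermediate_value_Icc hwd ((ht.continuousOn_xhat hE hd hx).mono
      (Icc_subset_Ioo hw.1 hdI.2))
    obtain ⟨a, ha, hac⟩ := hivt ⟨hwc.le, by linarith⟩
    obtain ⟨b, hb, hbd⟩ := hivt (⟨by linarith, hdx.le⟩ : d ∈ Icc (xhat w) (xhat d))
    have haI : a ∈ Ioo E.lo E.hi := ⟨hw.1.trans_le ha.1, ha.2.trans_lt hdI.2⟩
    have hbI : b ∈ Ioo E.lo E.hi := ⟨hw.1.trans_le hb.1, hb.2.trans_lt hdI.2⟩
    have hab : a < b := (hmono.lt_iff_lt haI hbI).1 (by rw [hac, hbd]; exact hcd)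
    have heq := ht.integral_impact_eq hE hF hopt hd hx haI hbI hab.le
    have hsub : Icc a b ⊆ Ioo E.lo E.hi := Icc_subset_Ioo haI.1 hbI.2
    have hpos : 0 < ∫ y in Icc a b, indirectImpact E m xhat y ∂F :=
      setIntegral_Icc_pos hF haI.1.le hab hbI.2.le
        ((ht.continuousOn_indirectImpact hE hd hx).mono hsub) fun v hv =>
        (ht.indirectImpact_bounds hE hd (hsub hv) (hd.bindingIC_eq hx (hsub hv))).1
    rw [heq, hac, hbd, setIntegral_eq_zero_of_forall_eq_zero] at hpos
    · exact lt_irrefl _ hpos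
    · intro v hv
      have hvI : v ∈ Ioo E.lo E.hi := ⟨hcI.1.trans_le hv.1, hv.2.trans_lt hdh⟩
      rw [ht.directImpact_eq_neg_one hE (Ioo_subset_Icc_self hvI)
        (ht.eP_mem_Ioo hE hd hvI).1 (hneg v hv)]
      norm_num
  -- Types below `s` are no one's binding type, so the indirect side of the balance is an integral
  -- over the empty set.
  have hneg : ∀ y ∈ Ioo E.lo E.hi, y < s → directImpact E m y = -1 := by
    intro y hyI hys
    refine le_antisymm ?_ (ht.neg_one_le_directImpact hE hd hyI)
    by_contra! hgt
    obtain ⟨c, d, hc, hcd, hds, hpos⟩ := hnear y hyI (fun w => 0 < 1 + directImpact E m w) E.lo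
      (min s E.hi) hyI.1 (lt_min hys hyI.2)
      ((continuousAt_const.add (hD.continuousAt
        (Ioo_mem_nhds hyI.1 hyI.2))).eventually_const_lt
        (by change 0 < 1 + directImpact E m y; linarith))
    have hdh := hds.trans_le (min_le_right _ _)
    have heq := ht.integral_directImpact_eq hE hopt hd hx hc hcd.le hdh
    have hempty : Ioo E.lo E.hi ∩ xhat ⁻¹' Icc c d = ∅ := by
      refine eq_empty_of_forall_notMem fun v hv => ?_
      have h1 : s ≤ xhat v := hs.1 (mem_image_of_mem _ hv.1)
      linarith [hv.2.2, hds.trans_le (min_le_left s E.hi)]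
    rw [hempty, setIntegral_empty] at heq
    have := setIntegral_Icc_pos hF hc.le hcd hdh.le
      (continuousOn_const.add (hD.mono (Icc_subset_Ioo hc hdh))) hpos
    exact this.ne' heq
  refine ⟨hub, fun u hu => ?_⟩
  by_contra! hus
  have hlos : E.lo < s := by
    obtain ⟨y, hyI, hy⟩ := ht.exists_superLow hE hd
    exact hyI.1.trans_le (hub y hy)
  have hsh : s ≤ E.hi := by
    have hmid : (E.lo + E.hi) / 2 ∈ Ioo E.lo E.hi := ⟨by linarith, by linarith⟩
    exact (hs.1 (mem_image_of_mem _ hmid)).trans (hx _ hmid).1.2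
  obtain ⟨x, hx1, hxs⟩ := exists_between (max_lt hus hlos)
  obtain ⟨x', hxx', hx's⟩ := exists_between hxs
  have hxI : x ∈ Ioo E.lo E.hi := ⟨(le_max_right _ _).trans_lt hx1, by linarith⟩
  have hx'I : x' ∈ Ioo E.lo E.hi := ⟨hxI.1.trans hxx', by linarith⟩
  have hfoc : ∀ y ∈ Ioo E.lo E.hi, y < s →
      effDeriv E.cA (m.eA y) + effDeriv E.uA (m.eA y) = E.cP (m.eP y) := fun y hyI hys => by
    have := hneg y hyI hys
    rw [directImpact, div_eq_iff (ht.effDeriv_uA_pos hE hd hyI).ne'] at this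
    linarith
  -- `D = -1` only yields `d1 ≤ 0`. Strictness at `x` comes from comparison with a slightly higher
  -- `x'`: audits fall, hence by `hfoc` agent effort and evidence rent fall, while `y - loss y`
  -- rises.
  have hd1' : d1 E m x' ≤ 0 := by
    by_contra! h
    have := ht.directImpact_nonneg hE hd hx'I h
    rw [hneg x' hx'I hx's] at this
    linarith
  have hp := hE.costP.strictMono (Ioo_subset_Icc_self (ht.eP_mem_Ioo hE hd hx'I))
    (Ioo_subset_Icc_self (ht.eP_mem_Ioo hE hd hxI))
    (ht.eP_strictAntiOn hE hF hopt hd hx hxI hx'I hxx')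
  rw [← hfoc x hxI hxs, ← hfoc x' hx'I hx's] at hp
  have he : m.eA x' < m.eA x := ((strictMonoOn_rent_deriv hE).lt_iff_lt
    (Ioo_subset_Icc_self (ht.eA_mem_Ioo hE hd hx'I))
    (Ioo_subset_Icc_self (ht.eA_mem_Ioo hE hd hxI))).1 hp
  have hu' := hE.strictMonoOn_uA (Ioo_subset_Icc_self (ht.eA_mem_Ioo hE hd hx'I))
    (Ioo_subset_Icc_self (ht.eA_mem_Ioo hE hd hxI)) he
  have hg := ht.sub_loss_lt hE hd hxI.1 hxx' hx'I.2.le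
  have hmem : x ∈ SuperLow E m :=
    ⟨⟨Ioo_subset_Icc_self hxI, ht.eP_mem_Ioo hE hd hxI⟩, by unfold d1 at hd1' ⊢; linarith⟩
  exact absurd (hu hmem) (not_le.2 ((le_max_left _ _).trans_lt hx1))

end Binding

end TaxMech

theorem mainTheorem7 (E : TaxMech.Env) (hE : E.Standing)
    (F : Measure ℝ) [IsProbabilityMeasure F]
    (hF_ac : F ≪ volume) (hF_supp : F.support = Icc E.lo E.hi)
    (m : TaxMech.Mech) (hm_tight : TaxMech.IsTight E m) (hm_opt : TaxMech.IsOptimal E F m)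
    (hm_du : TaxMech.DoublyUnique E m)
    (xhat : ℝ → ℝ) (hxhat : ∀ y ∈ Ioo E.lo E.hi, xhat y ∈ TaxMech.bindingIC E m y) :
    (∀ a b : ℝ, a ≤ b → Icc a b ⊆ Ioo E.lo E.hi →
      IntegrableOn (TaxMech.indirectImpact E m xhat) (Icc a b) F ∧
      IntegrableOn (fun y => 1 + TaxMech.directImpact E m y) (Icc (xhat a) (xhat b)) F ∧
      ∫ y in Icc a b, TaxMech.indirectImpact E m xhat y ∂F
        = ∫ y in Icc (xhat a) (xhat b), (1 + TaxMech.directImpact E m y) ∂F) ∧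
    (∀ x ∈ TaxMech.SuperLow E m, TaxMech.directImpact E m x = -1) ∧
    (∀ x ∈ TaxMech.Middle E m, TaxMech.directImpact E m x = 0) ∧
    (∀ x ∈ TaxMech.SuperHigh E m,
      TaxMech.directImpact E m x = TaxMech.indirectImpact E m xhat x) ∧
    (∃ s : ℝ, IsLUB (TaxMech.SuperLow E m) s ∧ IsGLB (xhat '' Ioo E.lo E.hi) s) := by
  have : NullSingletonClass F := ⟨fun x => hF_ac (measure_singleton x)⟩
  have hlh := hE.lo_lt_hi
  have hI := hm_tight.continuousOn_indirectImpact hE hm_du hxhat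
  have hD := hm_tight.continuousOn_directImpact hE hm_du
  refine ⟨fun a b hab hsub => ?_, fun x hx => ?_, fun x hx => ?_, fun x hx => ?_, ?_⟩
  · have ha : a ∈ Ioo E.lo E.hi := hsub ⟨le_rfl, hab⟩
    have hb : b ∈ Ioo E.lo E.hi := hsub ⟨hab, le_rfl⟩
    refine ⟨(hI.mono hsub).integrableOn_compact isCompact_Icc, ?_,
      hm_tight.integral_impact_eq hE hF_supp hm_opt hm_du hxhat ha hb hab⟩
    refine ContinuousOn.integrableOn_compact isCompact_Icc (continuousOn_const.add (hD.mono ?_))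
    exact Icc_subset_Ioo (ha.1.trans_le (hxhat a ha).1.1)
      (hm_tight.xhat_lt_hi hE hF_supp hm_opt hm_du hxhat hb)
  · exact hm_tight.directImpact_eq_neg_one hE hx.1.1 hx.1.2.1 hx.2
  · exact hm_tight.directImpact_eq_zero hE hm_du hx
  · exact hm_tight.directImpact_eq_indirectImpact hE hm_du hxhat hx
  · have hne : (xhat '' Ioo E.lo E.hi).Nonempty := (nonempty_Ioo.2 hlh).image _
    have hglb := isGLB_csInf hne ⟨E.lo, by
      rintro _ ⟨y, hy, rfl⟩
      exact hy.1.le.trans (hxhat y hy).1.1⟩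
    -- In the reals an `IsLUB` of the empty set cannot exist, so this also records that SuperLow is
    -- non-empty.
    exact ⟨_, hm_tight.isLUB_superLow hE hF_supp hm_opt hm_du hxhat hglb, hglb⟩
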